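/- Let $d\ge 2$. Let $\mathcal T$ be the rooted $d$-regular tree (every vertex has exactly $d$ children). A subtree $S\subset\mathcal T$ is *admissible* if it is finite, contains the root, and contains all the children of each of its vertices that is not a leaf of $S$. Let $\mathcal T\backslash\!\backslash S$ denote the forest obtained from $\mathcal T$ by removing the edges and the interior (non-leaf) vertices of $S$. The Neretin group $\mathcal N_d=\mathrm{AAut}(\mathcal T)$ consists of the classes of triples $(\psi,S,S')$, where $S,S'$ are admissible and $\psi\colon\mathcal T\backslash\!\backslash S\to\mathcal T\backslash\!\backslash S'$ is an isomorphism of rooted forests, two triples being equivalent if they restrict to a common forest isomorphism $\mathcal T\backslash\!\backslash R\to\mathcal T\backslash\!\backslash R'$ with $R,R'$ admissible. It carries its usual topology, i.e. the group topology for which the pointwise stabilisers in $\mathrm{Aut}(\mathcal T)$ of the admissible subtrees form a neighbourhood basis of the identity. Let $\mathscr C$ be the following cube complex. Its vertices are the classes $[A,\varphi]$ of pairs with $A$ an admissible subtree and $\varphi\in\mathcal N_d$, where $(R,\mu)\sim(S,\nu)$ if $\mu^{-1}\nu$ is given by a forest isomorphism $\mathcal T\backslash\!\backslash S\to\mathcal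 T\backslash\!\backslash R$. Writing $c(a)$ for the set of children of $a$, the vertices $\{[A\cup\bigcup_{i\in I}c(a_i),\varphi] : I\subseteq\{1,\dots,k\}\}$ span a $k$-cube for all $\varphi\in\mathcal N_d$, all admissible $A$ and all pairwise distinct leaves $a_1,\dots,a_k$ of $A$ (the edges being the $1$-cubes). The group $\mathcal N_d$ acts on $\mathscr C$ by $\psi\cdot[A,\varphi]=[A,\psi\varphi]$. The height $\mathfrak h([A,\varphi])$ is the number of leaves of $A$. Then: 1. $\mathscr C$ is a locally finite (so its geometric realisation is locally compact) CAT(0) cube complex: two cubes that meet do so in a common face, its geometric realisation is simply connected, and the links of its vertices are flag simplicial complexes. 2. $\mathcal N_d$ acts properly (as a topological group) on the geometric realisation of $\mathscr C$, and the stabilisers of the vertices, and more generally the setwise stabilisers of the cubes, are compact and open in $\mathcal N_d$. 3. For every admissible $R$ and every $\varphi\in\mathcal N_d$, the stabiliser of the vertex $[R,\varphi]$ is $\varphi\,\mathrm{Aut}(\mathcal T\backslash\!\backslash R)\,\varphi^{-1}$, where the automorphism group $\mathrm{Aut}(\mathcal T\backslash\!\backslash R)$ of the cofinite subforest $\mathcal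 T\backslash\!\backslash R$ embeds in $\mathcal N_d$. 4. For every vertex $x$, the descending link of $x$ (the subcomplex of the link of $x$ formed by the simplices all of whose vertices are neighbours of $x$ of height smaller than $\mathfrak h(x)$) is isomorphic to the simplicial complex $\mathcal I(d,\mathfrak h(x))$, where the vertices of $\mathcal I(p,q)$ are the subsets of size $p$ of $\{1,\dots,q\}$ and its simplices are the finite sets of pairwise disjoint such subsets. -/

import Mathlib

open Set

/-! ## The rooted `d`-regular tree, admissible subtrees and forests -/

namespace NeretinCubes

/-- The vertices of the rooted `d`-regular tree `T_d` in which every vertex has exactly `d`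
children: finite words over `d` letters. The root is `[]`, and the children of `v` are the words
`i :: v` (the parent of a word is its tail). -/
abbrev Word (d : ℕ) : Type := List (Fin d)

/-- Admissible subtrees of `T_d`, given by their vertices: finite, containing the root, closed
under parents (so connected), and containing all the children of each of its vertices that has
at least one child in it. -/
@[ext]
structure AdmTree (d : ℕ) where
  verts : Finset (Word d)
  root_mem : [] ∈ verts
  parent_mem : ∀ {i : Fin d} {v : Word d}, i :: v ∈ verts → v ∈ verts
  full : ∀ {i : Fin d} {v : Word d}, i :: v ∈ verts → ∀ j : Fin d, j :: v ∈ verts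

namespace AdmTree

variable {d : ℕ}

instance : PartialOrder (AdmTree d) :=
  PartialOrder.lift AdmTree.verts (fun _ _ h => AdmTree.ext h)

/-- The interior vertices: those with a child in the subtree. -/
def interior (S : AdmTree d) : Finset (Word d) :=
  S.verts.filter (fun v => ∃ i : Fin d, i :: v ∈ S.verts)

/-- The leaves: the vertices without a child in the subtree. -/
def leaves (S : AdmTree d) : Finset (Word d) :=
  S.verts.filter (fun v => ∀ i : Fin d, i :: v ∉ S.verts)

/-- The subtree reduced to the root. -/
def root (d : ℕ) : AdmTree d where
  verts := {[]}
  root_mem := by simp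
  parent_mem := by simp
  full := by simp

/-- The union of two admissible subtrees. -/
def union (S S' : AdmTree d) : AdmTree d where
  verts := S.verts ∪ S'.verts
  root_mem := Finset.mem_union_left _ S.root_mem
  parent_mem := by
    intro i v h
    rcases Finset.mem_union.1 h with h | h
    · exact Finset.mem_union_left _ (S.parent_mem h)
    · exact Finset.mem_union_right _ (S'.parent_mem h)
  full := by
    intro i v h j
    rcases Finset.mem_union.1 h with h | h
    · exact Finset.mem_union_left _ (S.full h j)
    · exact Finset.mem_union_right _ (S'.full h j)

/-- `S.expand s` is `S ∪ ⋃ c(a)`, where `a` ranges over the vertices of `S` that belong to `s`,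
and `c(a)` is the set of all children of `a`. -/
def expand (S : AdmTree d) (s : Finset (Word d)) : AdmTree d where
  verts := S.verts ∪ (S.verts ∩ s).biUnion (fun a => Finset.univ.image (fun i : Fin d => i :: a))
  root_mem := Finset.mem_union_left _ S.root_mem
  parent_mem := by
    intro i v h
    simp only [Finset.mem_union, Finset.mem_biUnion, Finset.mem_inter, Finset.mem_image,
      Finset.mem_univ, true_and, List.cons.injEq] at h ⊢
    rcases h with h | ⟨a, ha, j, -, rfl⟩
    · exact Or.inl (S.parent_mem h)
    · exact Or.inl ha.1
  full := by
    intro i v h j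
    simp only [Finset.mem_union, Finset.mem_biUnion, Finset.mem_inter, Finset.mem_image,
      Finset.mem_univ, true_and, List.cons.injEq] at h ⊢
    rcases h with h | ⟨a, ha, k, -, rfl⟩
    · exact Or.inl (S.full h j)
    · exact Or.inr ⟨a, ha, j, rfl, rfl⟩

theorem mem_interior {S : AdmTree d} {v : Word d} :
    v ∈ S.interior ↔ ∃ i : Fin d, i :: v ∈ S.verts := by
  simp only [interior, Finset.mem_filter, and_iff_right_iff_imp]
  rintro ⟨i, hi⟩
  exact S.parent_mem hi

theorem interior_mono {S R : AdmTree d} (h : S ≤ R) {v : Word d} (hv : v ∉ R.interior) :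
    v ∉ S.interior := by
  intro hS
  obtain ⟨i, hi⟩ := mem_interior.1 hS
  exact hv (mem_interior.2 ⟨i, h hi⟩)

theorem le_of_interior {S R : AdmTree d} (h : ∀ v ∈ S.interior, v ∈ R.interior) : S ≤ R := by
  intro v hv
  cases v with
  | nil => exact R.root_mem
  | cons i u =>
    obtain ⟨j, hj⟩ := mem_interior.1 (h u (mem_interior.2 ⟨i, hv⟩))
    exact R.full hj i

theorem root_le (S : AdmTree d) : root d ≤ S := by
  intro v hv
  rw [Finset.mem_singleton.1 hv]
  exact S.root_mem

theorem le_union_left (S S' : AdmTree d) : S ≤ S.union S' :=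
  Finset.subset_union_left (s₁ := S.verts)

theorem le_union_right (S S' : AdmTree d) : S' ≤ S.union S' :=
  Finset.subset_union_right (s₂ := S'.verts)

end AdmTree

variable {d : ℕ}

/-- The vertices of the forest `T ∖∖ S`, obtained from `T_d` by removing the edges of `S` and the
interior vertices of `S`. Its components are the full subtrees rooted at the leaves of `S`. -/
abbrev Forest (S : AdmTree d) : Type := {v : Word d // v ∉ S.interior}

/-- The parent-child relation of the forest `T ∖∖ S`. -/
def forestRel (S : AdmTree d) (u v : Forest S) : Prop := ∃ i : Fin d, v.1 = i :: u.1

/-- Isomorphisms of (rooted) forests `T ∖∖ S → T ∖∖ S'`. -/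
abbrev ForestIso (S S' : AdmTree d) : Type := forestRel S ≃r forestRel S'

/-- If `ψ : T ∖∖ S → T ∖∖ S'` is a forest isomorphism and `S ⊆ R`, the admissible subtree `R'`
such that `ψ` restricts to `T ∖∖ R → T ∖∖ R'`. -/
def imageTree {S S' : AdmTree d} (ψ : ForestIso S S') (R : AdmTree d) : AdmTree d where
  verts := S'.verts ∪ (R.verts.subtype (fun v => v ∉ S.interior)).image (fun u => (ψ u).1)
  root_mem := Finset.mem_union_left _ S'.root_mem
  parent_mem := by
    intro i v h
    rcases Finset.mem_union.1 h with h | h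
    · exact Finset.mem_union_left _ (S'.parent_mem h)
    · obtain ⟨w, hw, hwv⟩ := Finset.mem_image.1 h
      by_cases hv : v ∈ S'.interior
      · obtain ⟨j, hj⟩ := AdmTree.mem_interior.1 hv
        exact Finset.mem_union_left _ (S'.parent_mem hj)
      · have hrel : forestRel S' (ψ (ψ.symm ⟨v, hv⟩)) (ψ w) := by
          rw [ψ.apply_symm_apply]
          exact ⟨i, hwv⟩
        obtain ⟨k, hk⟩ := ψ.map_rel_iff.1 hrel
        refine Finset.mem_union_right _ (Finset.mem_image.2 ⟨ψ.symm ⟨v, hv⟩, ?_, ?_⟩)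
        · rw [Finset.mem_subtype] at hw ⊢
          rw [hk] at hw
          exact R.parent_mem hw
        · rw [ψ.apply_symm_apply]
  full := by
    intro i v h j
    rcases Finset.mem_union.1 h with h | h
    · exact Finset.mem_union_left _ (S'.full h j)
    · obtain ⟨w, hw, hwv⟩ := Finset.mem_image.1 h
      by_cases hv : v ∈ S'.interior
      · obtain ⟨k, hk⟩ := AdmTree.mem_interior.1 hv
        exact Finset.mem_union_left _ (S'.full hk j)
      · have hj : j :: v ∉ S'.interior := by
          intro hj
          obtain ⟨k, hk⟩ := AdmTree.mem_interior.1 hj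
          exact hv (AdmTree.mem_interior.2 ⟨j, S'.parent_mem hk⟩)
        have hrel : forestRel S' (ψ (ψ.symm ⟨v, hv⟩)) (ψ w) := by
          rw [ψ.apply_symm_apply]
          exact ⟨i, hwv⟩
        obtain ⟨k, hk⟩ := ψ.map_rel_iff.1 hrel
        have hrel' : forestRel S' (ψ (ψ.symm ⟨v, hv⟩)) (ψ (ψ.symm ⟨j :: v, hj⟩)) := by
          rw [ψ.apply_symm_apply, ψ.apply_symm_apply]
          exact ⟨j, rfl⟩
        obtain ⟨l, hl⟩ := ψ.map_rel_iff.1 hrel'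
        refine Finset.mem_union_right _ (Finset.mem_image.2 ⟨ψ.symm ⟨j :: v, hj⟩, ?_, ?_⟩)
        · rw [Finset.mem_subtype] at hw ⊢
          rw [hk] at hw
          rw [hl]
          exact R.full hw l
        · rw [ψ.apply_symm_apply]

theorem apply_mem_interior_imageTree {S S' : AdmTree d} (ψ : ForestIso S S') (R : AdmTree d)
    (u : Forest S) : (ψ u).1 ∈ (imageTree ψ R).interior ↔ u.1 ∈ R.interior := by
  constructor
  · intro h
    obtain ⟨j, hj⟩ := AdmTree.mem_interior.1 h
    rcases Finset.mem_union.1 hj with hj | hj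
    · exact absurd (AdmTree.mem_interior.2 ⟨j, hj⟩) (ψ u).2
    · obtain ⟨w, hw, hwv⟩ := Finset.mem_image.1 hj
      obtain ⟨k, hk⟩ := ψ.map_rel_iff.1 (show forestRel S' (ψ u) (ψ w) from ⟨j, hwv⟩)
      rw [Finset.mem_subtype, hk] at hw
      exact AdmTree.mem_interior.2 ⟨k, hw⟩
  · intro h
    obtain ⟨k, hk⟩ := AdmTree.mem_interior.1 h
    have hkS : k :: u.1 ∉ S.interior := by
      intro hkS
      obtain ⟨l, hl⟩ := AdmTree.mem_interior.1 hkS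
      exact u.2 (AdmTree.mem_interior.2 ⟨k, S.parent_mem hl⟩)
    obtain ⟨j, hj⟩ := ψ.map_rel_iff.2 (show forestRel S u ⟨k :: u.1, hkS⟩ from ⟨k, rfl⟩)
    refine AdmTree.mem_interior.2 ⟨j, ?_⟩
    rw [← hj]
    exact Finset.mem_union_right _ (Finset.mem_image.2 ⟨⟨k :: u.1, hkS⟩, by simpa using hk, rfl⟩)

theorem le_imageTree {S S' : AdmTree d} (ψ : ForestIso S S') (R : AdmTree d) :
    S' ≤ imageTree ψ R :=
  Finset.subset_union_left (s₁ := S'.verts)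

/-- The restriction `T ∖∖ R → T ∖∖ R'` of a forest isomorphism `ψ : T ∖∖ S → T ∖∖ S'`,
for `S ⊆ R`. -/
def restrictIso {S S' : AdmTree d} (ψ : ForestIso S S') {R : AdmTree d} (h : S ≤ R) :
    ForestIso R (imageTree ψ R) where
  toFun u := ⟨(ψ ⟨u.1, AdmTree.interior_mono h u.2⟩).1, fun hu =>
    u.2 ((apply_mem_interior_imageTree ψ R _).1 hu)⟩
  invFun v := ⟨(ψ.symm ⟨v.1, AdmTree.interior_mono (le_imageTree ψ R) v.2⟩).1, fun hv => by
    apply v.2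
    have := (apply_mem_interior_imageTree ψ R _).2 hv
    rwa [ψ.apply_symm_apply] at this⟩
  left_inv u := by
    apply Subtype.ext
    simp
  right_inv v := by
    apply Subtype.ext
    simp
  map_rel_iff' := by
    intro u v
    exact ψ.map_rel_iff (a := ⟨u.1, AdmTree.interior_mono h u.2⟩)
      (b := ⟨v.1, AdmTree.interior_mono h v.2⟩)

/-! ## Almost automorphisms and the Neretin group -/

/-- Triples `(ψ, S, S')` with `S`, `S'` admissible subtrees and `ψ : T ∖∖ S → T ∖∖ S'` a forest
isomorphism. -/
structure Triple (d : ℕ) where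
  src : AdmTree d
  tgt : AdmTree d
  iso : ForestIso src tgt

namespace Triple

/-- The triple `(ψ, S, S')` induces the forest isomorphism `χ : T ∖∖ R → T ∖∖ R'`:
`S ⊆ R`, `S' ⊆ R'`, and `χ` is the restriction of `ψ`. -/
def Induces (t : Triple d) {R R' : AdmTree d} (χ : ForestIso R R') : Prop :=
  ∃ h : t.src ≤ R, t.tgt ≤ R' ∧
    ∀ u : Forest R, (χ u).1 = (t.iso ⟨u.1, AdmTree.interior_mono h u.2⟩).1

/-- Two triples are equivalent if they induce a common forest isomorphism. -/
def Rel (t t' : Triple d) : Prop :=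
  ∃ (R R' : AdmTree d) (χ : ForestIso R R'), t.Induces χ ∧ t'.Induces χ

theorem induces_restrict (t : Triple d) {R : AdmTree d} (h : t.src ≤ R) :
    t.Induces (restrictIso t.iso h) :=
  ⟨h, le_imageTree _ _, fun _ => rfl⟩

theorem rel_of_eqOn {t t' : Triple d} (R : AdmTree d) (h : t.src ≤ R) (h' : t'.src ≤ R)
    (H : ∀ (v : Word d) (hv : v ∉ R.interior),
      (t.iso ⟨v, AdmTree.interior_mono h hv⟩).1 = (t'.iso ⟨v, AdmTree.interior_mono h' hv⟩).1) :
    t.Rel t' := by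
  refine ⟨R, _, restrictIso t.iso h, t.induces_restrict h, h', ?_, fun u => H u.1 u.2⟩
  apply AdmTree.le_of_interior
  intro v hv
  by_contra hv'
  obtain ⟨u, hu⟩ := (restrictIso t.iso h).surjective ⟨v, hv'⟩
  have hu' : (t'.iso ⟨u.1, AdmTree.interior_mono h' u.2⟩).1 = v := by
    rw [← H u.1 u.2]
    exact congrArg Subtype.val hu
  exact (t'.iso ⟨u.1, AdmTree.interior_mono h' u.2⟩).2 (hu' ▸ hv)

theorem Rel.eqOn {t t' : Triple d} (h : t.Rel t') :
    ∃ (R : AdmTree d) (h : t.src ≤ R) (h' : t'.src ≤ R), ∀ (v : Word d) (hv : v ∉ R.interior),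
      (t.iso ⟨v, AdmTree.interior_mono h hv⟩).1 =
        (t'.iso ⟨v, AdmTree.interior_mono h' hv⟩).1 := by
  obtain ⟨R, R', χ, ⟨h, -, H⟩, h', -, H'⟩ := h
  exact ⟨R, h, h', fun v hv => (H ⟨v, hv⟩).symm.trans (H' ⟨v, hv⟩)⟩

theorem rel_equivalence : Equivalence (Rel (d := d)) where
  refl t := rel_of_eqOn t.src le_rfl le_rfl (fun _ _ => rfl)
  symm := fun ⟨R, R', χ, h, h'⟩ => ⟨R, R', χ, h', h⟩
  trans := by
    intro t₁ t₂ t₃ h₁₂ h₂₃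
    obtain ⟨R, h₁, h₂, H⟩ := h₁₂.eqOn
    obtain ⟨R', h₂', h₃, H'⟩ := h₂₃.eqOn
    refine rel_of_eqOn (R.union R') (h₁.trans (AdmTree.le_union_left R R'))
      (h₃.trans (AdmTree.le_union_right R R')) (fun v hv => ?_)
    exact (H v (AdmTree.interior_mono (AdmTree.le_union_left R R') hv)).trans
      (H' v (AdmTree.interior_mono (AdmTree.le_union_right R R') hv))

instance setoid (d : ℕ) : Setoid (Triple d) := ⟨Rel, rel_equivalence⟩

/-- The identity triple. -/
def id (d : ℕ) : Triple d := ⟨AdmTree.root d, AdmTree.root d, RelIso.refl _⟩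

/-- The inverse triple. -/
def inv (t : Triple d) : Triple d := ⟨t.tgt, t.src, t.iso.symm⟩

/-- The composition `g ∘ f` of `f : T ∖∖ S₁ → T ∖∖ S₂` and `g : T ∖∖ S₁' → T ∖∖ S₂'`: both are
restricted so that the target forest of `f` and the source forest of `g` become
`T ∖∖ (S₂ ∪ S₁')`. -/
def comp (g f : Triple d) : Triple d where
  src := imageTree f.iso.symm (f.tgt.union g.src)
  tgt := imageTree g.iso (f.tgt.union g.src)
  iso := (restrictIso f.iso.symm (AdmTree.le_union_left f.tgt g.src)).symm.trans
    (restrictIso g.iso (AdmTree.le_union_right f.tgt g.src))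

/-- `t.Maps v w`: the forest isomorphism of `t` is defined at `v` and sends it to `w`. -/
def Maps (t : Triple d) (v w : Word d) : Prop :=
  ∃ h : v ∉ t.src.interior, (t.iso ⟨v, h⟩).1 = w

theorem Maps.unique {t : Triple d} {v w w' : Word d} (h : t.Maps v w) (h' : t.Maps v w') :
    w = w' := by
  obtain ⟨_, rfl⟩ := h
  obtain ⟨_, rfl⟩ := h'
  rfl

theorem rel_iff {t t' : Triple d} :
    t.Rel t' ↔ ∃ R : AdmTree d, ∀ v ∉ R.interior, ∃ w, t.Maps v w ∧ t'.Maps v w := by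
  constructor
  · intro h
    obtain ⟨R, h, h', H⟩ := h.eqOn
    exact ⟨R, fun v hv => ⟨_, ⟨AdmTree.interior_mono h hv, rfl⟩,
      ⟨AdmTree.interior_mono h' hv, (H v hv).symm⟩⟩⟩
  · rintro ⟨R, H⟩
    refine rel_of_eqOn (R.union (t.src.union t'.src))
      ((AdmTree.le_union_left _ _).trans (AdmTree.le_union_right _ _))
      ((AdmTree.le_union_right _ _).trans (AdmTree.le_union_right _ _)) (fun v hv => ?_)
    obtain ⟨w, ⟨h, hw⟩, h', hw'⟩ := H v (AdmTree.interior_mono (AdmTree.le_union_left _ _) hv)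
    exact hw.trans hw'.symm

theorem exists_maps (t : Triple d) (R : AdmTree d) :
    ∃ Q : AdmTree d, ∀ v ∉ Q.interior, ∃ w, t.Maps v w ∧ w ∉ R.interior := by
  refine ⟨imageTree t.iso.symm R, fun v hv => ?_⟩
  have hv' := AdmTree.interior_mono (le_imageTree t.iso.symm R) hv
  refine ⟨_, ⟨hv', rfl⟩, fun hR => hv ?_⟩
  have := (apply_mem_interior_imageTree t.iso.symm R _).2 hR
  rwa [t.iso.symm_apply_apply] at this

theorem Maps.inv {t : Triple d} {v w : Word d} (h : t.Maps v w) : t.inv.Maps w v := by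
  obtain ⟨h, rfl⟩ := h
  refine ⟨(t.iso ⟨v, h⟩).2, ?_⟩
  change (t.iso.symm (t.iso ⟨v, h⟩)).1 = v
  rw [t.iso.symm_apply_apply]

theorem comp_maps (g f : Triple d) {v : Word d} (hv : v ∉ (comp g f).src.interior) :
    ∃ u w, f.Maps v u ∧ g.Maps u w ∧ (comp g f).Maps v w := by
  have hv' : v ∉ f.src.interior :=
    AdmTree.interior_mono (le_imageTree f.iso.symm (f.tgt.union g.src)) hv
  have hu := ((restrictIso f.iso.symm (AdmTree.le_union_left f.tgt g.src)).symm ⟨v, hv⟩).2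
  exact ⟨_, _, ⟨hv', rfl⟩, ⟨AdmTree.interior_mono (AdmTree.le_union_right f.tgt g.src) hu, rfl⟩,
    ⟨hv, rfl⟩⟩

theorem exists_comp_maps (g f : Triple d) (R : AdmTree d) :
    ∃ Q : AdmTree d, ∀ v ∉ Q.interior, ∃ u w,
      f.Maps v u ∧ g.Maps u w ∧ (comp g f).Maps v w ∧ u ∉ R.interior ∧ w ∉ R.interior := by
  obtain ⟨P, hP⟩ := g.exists_maps R
  obtain ⟨Q, hQ⟩ := f.exists_maps (P.union R)
  refine ⟨Q.union (comp g f).src, fun v hv => ?_⟩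
  obtain ⟨u, hu, huP⟩ := hQ v (AdmTree.interior_mono (AdmTree.le_union_left _ _) hv)
  obtain ⟨w, hw, hwR⟩ := hP u (AdmTree.interior_mono (AdmTree.le_union_left _ _) huP)
  obtain ⟨u', w', hu', hw', h⟩ :=
    comp_maps g f (AdmTree.interior_mono (AdmTree.le_union_right _ _) hv)
  obtain rfl := hu.unique hu'
  obtain rfl := hw.unique hw'
  exact ⟨u, w, hu, hw, h, AdmTree.interior_mono (AdmTree.le_union_right _ _) huP, hwR⟩

theorem comp_rel {g g' f f' : Triple d} (hg : g.Rel g') (hf : f.Rel f') :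
    (comp g f).Rel (comp g' f') := by
  obtain ⟨R, hR⟩ := rel_iff.1 hg
  obtain ⟨P, hP⟩ := rel_iff.1 hf
  obtain ⟨Q, hQ⟩ := exists_comp_maps g f R
  obtain ⟨Q', hQ'⟩ := exists_comp_maps g' f' R
  refine rel_iff.2 ⟨P.union (Q.union Q'), fun v hv => ?_⟩
  obtain ⟨u, w, hu, hw, h, huR, -⟩ := hQ v (AdmTree.interior_mono
    ((AdmTree.le_union_left _ _).trans (AdmTree.le_union_right _ _)) hv)
  obtain ⟨u', w', hu', hw', h', -⟩ := hQ' v (AdmTree.interior_mono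
    ((AdmTree.le_union_right _ _).trans (AdmTree.le_union_right _ _)) hv)
  obtain ⟨x, hx, hx'⟩ := hP v (AdmTree.interior_mono (AdmTree.le_union_left _ _) hv)
  obtain rfl := hu.unique hx
  obtain rfl := hu'.unique hx'
  obtain ⟨y, hy, hy'⟩ := hR _ huR
  obtain rfl := hw.unique hy
  obtain rfl := hw'.unique hy'
  exact ⟨_, h, h'⟩

theorem inv_rel {f f' : Triple d} (hf : f.Rel f') : f.inv.Rel f'.inv := by
  obtain ⟨R, hR⟩ := rel_iff.1 hf
  obtain ⟨Q, hQ⟩ := exists_maps f.inv R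
  refine rel_iff.2 ⟨Q, fun w hw => ?_⟩
  obtain ⟨v, hv, hvR⟩ := hQ w hw
  obtain ⟨w', h, h'⟩ := hR v hvR
  obtain rfl := hv.inv.unique h
  exact ⟨v, hv, h'.inv⟩

theorem comp_assoc_rel (f g h : Triple d) : (comp (comp f g) h).Rel (comp f (comp g h)) := by
  obtain ⟨P, hP⟩ := exists_comp_maps f g (AdmTree.root d)
  obtain ⟨Q, hQ⟩ := exists_comp_maps g h P
  obtain ⟨P₁, hP₁⟩ := exists_comp_maps (comp f g) h P
  obtain ⟨P₂, hP₂⟩ := exists_comp_maps f (comp g h) P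
  refine rel_iff.2 ⟨Q.union (P₁.union P₂), fun v hv => ?_⟩
  obtain ⟨a, b, ha, hb, hab, haP, -⟩ := hQ v (AdmTree.interior_mono (AdmTree.le_union_left _ _) hv)
  obtain ⟨a₁, c₁, ha₁, hc₁, h₁, -⟩ := hP₁ v (AdmTree.interior_mono
    ((AdmTree.le_union_left _ _).trans (AdmTree.le_union_right _ _)) hv)
  obtain ⟨b₂, c₂, hb₂, hc₂, h₂, -⟩ := hP₂ v (AdmTree.interior_mono
    ((AdmTree.le_union_right _ _).trans (AdmTree.le_union_right _ _)) hv)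
  obtain ⟨b₃, c₃, hb₃, hc₃, h₃, -⟩ := hP a haP
  obtain rfl := ha.unique ha₁
  obtain rfl := hab.unique hb₂
  obtain rfl := hb.unique hb₃
  obtain rfl := hc₁.unique h₃
  obtain rfl := hc₂.unique hc₃
  exact ⟨_, h₁, h₂⟩

theorem id_maps (v : Word d) : (id d).Maps v v := by
  refine ⟨?_, rfl⟩
  intro h
  obtain ⟨i, hi⟩ := AdmTree.mem_interior.1 h
  simp [id, AdmTree.root] at hi

theorem id_comp_rel (f : Triple d) : (comp (id d) f).Rel f := by
  obtain ⟨P, hP⟩ := exists_comp_maps (id d) f (AdmTree.root d)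
  refine rel_iff.2 ⟨P, fun v hv => ?_⟩
  obtain ⟨u, w, hu, hw, h, -⟩ := hP v hv
  obtain rfl := hw.unique (id_maps u)
  exact ⟨_, h, hu⟩

theorem comp_id_rel (f : Triple d) : (comp f (id d)).Rel f := by
  obtain ⟨P, hP⟩ := exists_comp_maps f (id d) (AdmTree.root d)
  refine rel_iff.2 ⟨P, fun v hv => ?_⟩
  obtain ⟨u, w, hu, hw, h, -⟩ := hP v hv
  obtain rfl := hu.unique (id_maps v)
  exact ⟨_, h, hw⟩

theorem inv_comp_rel (f : Triple d) : (comp f.inv f).Rel (id d) := by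
  obtain ⟨P, hP⟩ := exists_comp_maps f.inv f (AdmTree.root d)
  refine rel_iff.2 ⟨P, fun v hv => ?_⟩
  obtain ⟨u, w, hu, hw, h, -⟩ := hP v hv
  obtain rfl := hw.unique hu.inv
  exact ⟨_, h, id_maps _⟩

end Triple

end NeretinCubes

open NeretinCubes

/-- The Neretin group `N_d = AAut(T_d)` of almost automorphisms of `T_d`: equivalence classes of
triples `(ψ, S, S')`. -/
def Neretin (d : ℕ) : Type := Quotient (Triple.setoid d)

namespace Neretin

variable {d : ℕ}

/-- The almost automorphism defined by a forest isomorphism `T ∖∖ S → T ∖∖ S'`. -/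
def ofIso {S S' : AdmTree d} (ψ : ForestIso S S') : Neretin d :=
  Quotient.mk (Triple.setoid d) ⟨S, S', ψ⟩

/-- The group law is composition: `g * f = g ∘ f`. -/
instance : Group (Neretin d) where
  mul := Quotient.map₂ Triple.comp (fun _ _ hg _ _ hf => Triple.comp_rel hg hf)
  one := Quotient.mk (Triple.setoid d) (Triple.id d)
  inv := Quotient.map Triple.inv (fun _ _ hf => Triple.inv_rel hf)
  mul_assoc := by
    rintro ⟨f⟩ ⟨g⟩ ⟨h⟩
    exact Quotient.sound (Triple.comp_assoc_rel f g h)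
  one_mul := by
    rintro ⟨f⟩
    exact Quotient.sound (Triple.id_comp_rel f)
  mul_one := by
    rintro ⟨f⟩
    exact Quotient.sound (Triple.comp_id_rel f)
  inv_mul_cancel := by
    rintro ⟨f⟩
    exact Quotient.sound (Triple.inv_comp_rel f)

theorem ofIso_symm {S S' : AdmTree d} (ψ : ForestIso S S') : ofIso ψ.symm = (ofIso ψ)⁻¹ := rfl

theorem ofIso_trans {S S' S'' : AdmTree d} (ψ : ForestIso S S') (χ : ForestIso S' S'') :
    ofIso (ψ.trans χ) = ofIso χ * ofIso ψ := by
  apply Quotient.sound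
  obtain ⟨P, hP⟩ := Triple.exists_comp_maps ⟨S', S'', χ⟩ ⟨S, S', ψ⟩ (AdmTree.root d)
  refine Triple.rel_iff.2 ⟨P, fun v hv => ?_⟩
  obtain ⟨u, w, ⟨hu, rfl⟩, ⟨hw, rfl⟩, h, -⟩ := hP v hv
  exact ⟨_, ⟨hu, rfl⟩, h⟩

theorem ofIso_refl (S : AdmTree d) : ofIso (RelIso.refl (forestRel S)) = 1 := by
  apply Quotient.sound
  exact Triple.rel_iff.2 ⟨S, fun v hv => ⟨v, ⟨hv, rfl⟩, Triple.id_maps v⟩⟩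

theorem ofIso_eq {S S' R R' : AdmTree d} (ψ : ForestIso S S') (χ : ForestIso R R') (h : S ≤ R)
    (H : ∀ u : Forest R, (χ u).1 = (ψ ⟨u.1, AdmTree.interior_mono h u.2⟩).1) :
    ofIso χ = ofIso ψ := by
  apply Quotient.sound
  exact Triple.rel_of_eqOn (t := ⟨R, R', χ⟩) (t' := ⟨S, S', ψ⟩) R le_rfl h
    (fun v hv => H ⟨v, hv⟩)

/-- The homomorphism from the automorphism group of the cofinite subforest `T ∖∖ R` to `N_d`. -/
def forestHom (R : AdmTree d) : ForestIso R R →* Neretin d where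
  toFun ψ := ofIso ψ
  map_one' := ofIso_refl R
  map_mul' ψ χ := ofIso_trans χ ψ

/-- The automorphism group `Aut(T ∖∖ R)`, as a subgroup of `N_d`. -/
def autForest (R : AdmTree d) : Subgroup (Neretin d) := (forestHom R).range

end Neretin

namespace NeretinCubes

variable {d : ℕ}

theorem mem_leaves_iff {S : AdmTree d} (u : Forest S) :
    u.1 ∈ S.leaves ↔ ∀ p : Forest S, ¬ forestRel S p u := by
  constructor
  · rintro hu p ⟨i, hi⟩
    refine p.2 (AdmTree.mem_interior.2 ⟨i, ?_⟩)
    rw [← hi]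
    exact (Finset.mem_filter.1 hu).1
  · intro h
    refine Finset.mem_filter.2 ⟨?_, fun i hi => u.2 (AdmTree.mem_interior.2 ⟨i, hi⟩)⟩
    obtain ⟨v, hv⟩ := u
    cases v with
    | nil => exact S.root_mem
    | cons i p =>
      by_cases hp : p ∈ S.interior
      · obtain ⟨j, hj⟩ := AdmTree.mem_interior.1 hp
        exact S.full hj i
      · exact absurd ⟨i, rfl⟩ (h ⟨p, hp⟩)

theorem not_mem_interior_of_mem_leaves {S : AdmTree d} {v : Word d} (h : v ∈ S.leaves) :
    v ∉ S.interior := by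
  intro hv
  obtain ⟨i, hi⟩ := AdmTree.mem_interior.1 hv
  exact (Finset.mem_filter.1 h).2 i hi

theorem ForestIso.mem_leaves {S S' : AdmTree d} (ψ : ForestIso S S') (u : Forest S) :
    (ψ u).1 ∈ S'.leaves ↔ u.1 ∈ S.leaves := by
  rw [mem_leaves_iff, mem_leaves_iff]
  constructor
  · intro h p hp
    exact h (ψ p) (ψ.map_rel_iff.2 hp)
  · intro h p hp
    apply h (ψ.symm p)
    rw [← ψ.map_rel_iff, ψ.apply_symm_apply]
    exact hp

theorem ForestIso.card_leaves {S S' : AdmTree d} (ψ : ForestIso S S') :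
    S.leaves.card = S'.leaves.card := by
  refine Finset.card_bij (fun v hv => (ψ ⟨v, not_mem_interior_of_mem_leaves hv⟩).1) ?_ ?_ ?_
  · intro v hv
    exact (ForestIso.mem_leaves ψ _).2 hv
  · intro v hv w hw h
    exact congrArg Subtype.val (ψ.injective (Subtype.ext h))
  · intro w hw
    refine ⟨(ψ.symm ⟨w, not_mem_interior_of_mem_leaves hw⟩).1, ?_, ?_⟩
    · exact (ForestIso.mem_leaves ψ.symm _).2 hw
    · simp

theorem extend_aux {R : AdmTree d} (κ : ForestIso R R)
    (hκ : ∀ u : Forest R, u.1 ∈ R.leaves → (κ u).1 = u.1) {v : Word d} {i : Fin d} :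
    ∃ j : Fin d, (if h : i :: v ∉ R.interior then (κ ⟨i :: v, h⟩).1 else i :: v) =
      j :: (if h : v ∉ R.interior then (κ ⟨v, h⟩).1 else v) := by
  by_cases hv : v ∈ R.interior
  · refine ⟨i, ?_⟩
    rw [dif_neg (not_not.2 hv)]
    by_cases hi : i :: v ∈ R.interior
    · rw [dif_neg (not_not.2 hi)]
    · rw [dif_pos hi]
      apply hκ ⟨i :: v, hi⟩
      refine Finset.mem_filter.2 ⟨?_, fun j hj => hi (AdmTree.mem_interior.2 ⟨j, hj⟩)⟩
      obtain ⟨k, hk⟩ := AdmTree.mem_interior.1 hv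
      exact R.full hk i
  · have hi : i :: v ∉ R.interior := by
      intro hi
      obtain ⟨k, hk⟩ := AdmTree.mem_interior.1 hi
      exact hv (AdmTree.mem_interior.2 ⟨i, R.parent_mem hk⟩)
    rw [dif_pos hv, dif_pos hi]
    exact κ.map_rel_iff.2 (show forestRel R ⟨v, hv⟩ ⟨i :: v, hi⟩ from ⟨i, rfl⟩)

theorem extend_inv {R : AdmTree d} (κ : ForestIso R R) (v : Word d) :
    (if h : (if h : v ∉ R.interior then (κ ⟨v, h⟩).1 else v) ∉ R.interior then
      (κ.symm ⟨if h : v ∉ R.interior then (κ ⟨v, h⟩).1 else v, h⟩).1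
      else (if h : v ∉ R.interior then (κ ⟨v, h⟩).1 else v)) = v := by
  by_cases hv : v ∈ R.interior
  · simp [hv]
  · have h := (κ ⟨v, hv⟩).2
    simp [hv, h]

theorem not_mem_interior_root (v : Word d) : v ∉ (AdmTree.root d).interior := by
  intro h
  obtain ⟨i, hi⟩ := AdmTree.mem_interior.1 h
  simp [AdmTree.root] at hi

/-- An automorphism of `T ∖∖ R` that fixes the leaves of `R`, extended by the identity to an
automorphism of the tree. -/
def extendIso {R : AdmTree d} (κ : ForestIso R R)
    (hκ : ∀ u : Forest R, u.1 ∈ R.leaves → (κ u).1 = u.1) :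
    ForestIso (AdmTree.root d) (AdmTree.root d) where
  toFun v := ⟨if h : v.1 ∉ R.interior then (κ ⟨v.1, h⟩).1 else v.1, not_mem_interior_root _⟩
  invFun v := ⟨if h : v.1 ∉ R.interior then (κ.symm ⟨v.1, h⟩).1 else v.1,
    not_mem_interior_root _⟩
  left_inv v := Subtype.ext (extend_inv κ v.1)
  right_inv v := Subtype.ext (extend_inv κ.symm v.1)
  map_rel_iff' := by
    have hκ' : ∀ u : Forest R, u.1 ∈ R.leaves → (κ.symm u).1 = u.1 := by
      intro u hu
      have h := congrArg κ.symm (Subtype.ext (hκ u hu))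
      rw [κ.symm_apply_apply] at h
      exact (congrArg Subtype.val h).symm
    rintro ⟨u, hu⟩ ⟨v, hv⟩
    constructor
    · rintro ⟨i, hi⟩
      obtain ⟨j, hj⟩ := extend_aux κ.symm hκ'
        (v := if h : u ∉ R.interior then (κ ⟨u, h⟩).1 else u) (i := i)
      refine ⟨j, ?_⟩
      change (if h : v ∉ R.interior then (κ ⟨v, h⟩).1 else v) = _ at hi
      simp only [Equiv.coe_fn_mk] at hi
      rw [extend_inv κ u] at hj
      simp only [← hi] at hj
      rw [extend_inv κ v] at hj
      exact hj
    · rintro ⟨i, hi⟩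
      change v = i :: u at hi
      subst hi
      exact extend_aux κ hκ

end NeretinCubes

namespace Neretin

variable {d : ℕ}

/-- The pointwise stabiliser of `S` in the subgroup `Aut(T_d)` of `N_d`. -/
def fixator (S : AdmTree d) : Set (Neretin d) :=
  {g | ∃ ψ : ForestIso (AdmTree.root d) (AdmTree.root d), g = ofIso ψ ∧
    ∀ u : Forest (AdmTree.root d), u.1 ∈ S.verts → ψ u = u}

theorem fixator_anti {S R : AdmTree d} (h : S ≤ R) : fixator R ⊆ fixator S := by
  rintro g ⟨ψ, rfl, hψ⟩
  exact ⟨ψ, rfl, fun u hu => hψ u (h hu)⟩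

theorem mem_fixator_of_fix_leaves {R : AdmTree d} (κ : ForestIso R R)
    (hκ : ∀ u : Forest R, u.1 ∈ R.leaves → (κ u).1 = u.1) : ofIso κ ∈ fixator R := by
  refine ⟨extendIso κ hκ, ?_, ?_⟩
  · refine ofIso_eq (extendIso κ hκ) κ (AdmTree.root_le R) (fun u => ?_)
    change _ = if h : u.1 ∉ R.interior then (κ ⟨u.1, h⟩).1 else u.1
    rw [dif_pos u.2]
  · rintro ⟨v, hv⟩ hvR
    apply Subtype.ext
    change (if h : v ∉ R.interior then (κ ⟨v, h⟩).1 else v) = v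
    by_cases h : v ∈ R.interior
    · rw [dif_neg (not_not.2 h)]
    · rw [dif_pos h]
      exact hκ ⟨v, h⟩ (Finset.mem_filter.2 ⟨hvR, fun i hi => h (AdmTree.mem_interior.2 ⟨i, hi⟩)⟩)

theorem exists_fix_leaves {R : AdmTree d} {g : Neretin d} (hg : g ∈ fixator R) :
    ∃ κ : ForestIso R R, g = ofIso κ ∧ ∀ u : Forest R, u.1 ∈ R.leaves → (κ u).1 = u.1 := by
  obtain ⟨ψ, rfl, hψ⟩ := hg
  have hψ' : ∀ u : Forest (AdmTree.root d), u.1 ∈ R.verts → ψ.symm u = u := by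
    intro u hu
    have h := congrArg ψ.symm (hψ u hu)
    rw [ψ.symm_apply_apply] at h
    exact h.symm
  have key : ∀ χ : ForestIso (AdmTree.root d) (AdmTree.root d),
      (∀ u : Forest (AdmTree.root d), u.1 ∈ R.verts → χ.symm u = u) →
      ∀ u : Forest (AdmTree.root d), u.1 ∉ R.interior → (χ u).1 ∉ R.interior := by
    intro χ hχ u hu h
    have hR : (χ u).1 ∈ R.verts := (Finset.mem_filter.1 h).1
    have := hχ (χ u) hR
    rw [χ.symm_apply_apply] at this
    exact hu (this ▸ h)
  refine ⟨{ toFun := fun u => ⟨(ψ ⟨u.1, not_mem_interior_root _⟩).1, key ψ hψ' _ u.2⟩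
            invFun := fun u => ⟨(ψ.symm ⟨u.1, not_mem_interior_root _⟩).1,
              key ψ.symm hψ _ u.2⟩
            left_inv := fun u => Subtype.ext (by simp)
            right_inv := fun u => Subtype.ext (by simp)
            map_rel_iff' := fun {u v} => ψ.map_rel_iff (a := ⟨u.1, not_mem_interior_root _⟩)
              (b := ⟨v.1, not_mem_interior_root _⟩) }, ?_, ?_⟩
  · exact (ofIso_eq ψ _ (AdmTree.root_le R) (fun u => rfl)).symm
  · intro u hu
    have h : ψ ⟨u.1, not_mem_interior_root _⟩ = ⟨u.1, not_mem_interior_root _⟩ :=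
      hψ _ (Finset.mem_filter.1 hu).1
    exact congrArg (fun w => w.1) h

theorem ofIso_restrict {S S' R : AdmTree d} (ψ : ForestIso S S') (h : S ≤ R) :
    ofIso (restrictIso ψ h) = ofIso ψ :=
  ofIso_eq ψ _ h (fun _ => rfl)

theorem exists_restrict (x : Neretin d) (S : AdmTree d) :
    ∃ (A Q : AdmTree d) (ρ : ForestIso A Q), S ≤ A ∧ ofIso ρ = x⁻¹ := by
  induction x using Quotient.inductionOn with
  | h t =>
    exact ⟨_, _, restrictIso t.iso.symm (AdmTree.le_union_left t.tgt S),
      AdmTree.le_union_right _ _, ofIso_restrict _ _⟩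

theorem exists_conj_fixator (x : Neretin d) (S : AdmTree d) :
    ∃ Q : AdmTree d, ∀ k ∈ fixator Q, x * k * x⁻¹ ∈ fixator S := by
  obtain ⟨A, Q, ρ, hA, hρ⟩ := exists_restrict x S
  refine ⟨Q, fun k hk => ?_⟩
  obtain ⟨κ, rfl, hκ⟩ := exists_fix_leaves hk
  have e : x * ofIso κ * x⁻¹ = ofIso ((ρ.trans κ).trans ρ.symm) := by
    rw [ofIso_trans, ofIso_trans, ofIso_symm, hρ, inv_inv, mul_assoc]
  rw [e]
  apply fixator_anti hA
  apply mem_fixator_of_fix_leaves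
  intro u hu
  have h1 : κ (ρ u) = ρ u := Subtype.ext (hκ (ρ u) ((ForestIso.mem_leaves ρ u).2 hu))
  rw [RelIso.trans_apply, RelIso.trans_apply, h1, ρ.symm_apply_apply]

/-- The pointwise stabilisers in `Aut(T_d)` of the admissible subtrees. They form a neighbourhood
basis of the identity of `Aut(T_d)` in its usual topology (the compact-open topology of the action
on the boundary). -/
@[reducible]
def filterBasis (d : ℕ) : GroupFilterBasis (Neretin d) where
  sets := Set.range (fixator (d := d))
  nonempty := ⟨_, AdmTree.root d, rfl⟩
  inter_sets := by
    rintro _ _ ⟨S, rfl⟩ ⟨R, rfl⟩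
    exact ⟨_, ⟨S.union R, rfl⟩, fun g hg =>
      ⟨fixator_anti (AdmTree.le_union_left S R) hg, fixator_anti (AdmTree.le_union_right S R) hg⟩⟩
  one' := by
    rintro _ ⟨S, rfl⟩
    exact ⟨RelIso.refl _, (ofIso_refl _).symm, fun _ _ => rfl⟩
  mul' := by
    rintro _ ⟨S, rfl⟩
    refine ⟨_, ⟨S, rfl⟩, ?_⟩
    rintro _ ⟨_, ⟨ψ, rfl, hψ⟩, _, ⟨χ, rfl, hχ⟩, rfl⟩
    refine ⟨χ.trans ψ, (ofIso_trans χ ψ).symm, fun u hu => ?_⟩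
    rw [RelIso.trans_apply, hχ u hu, hψ u hu]
  inv' := by
    rintro _ ⟨S, rfl⟩
    refine ⟨_, ⟨S, rfl⟩, ?_⟩
    rintro _ ⟨ψ, rfl, hψ⟩
    refine ⟨ψ.symm, (ofIso_symm ψ).symm, fun u hu => ?_⟩
    have h := congrArg ψ.symm (hψ u hu)
    rw [ψ.symm_apply_apply] at h
    exact h.symm
  conj' := by
    rintro x _ ⟨S, rfl⟩
    obtain ⟨Q, hQ⟩ := exists_conj_fixator x S
    exact ⟨_, ⟨Q, rfl⟩, hQ⟩

/-- The topology of `N_d`: the unique group topology for which the inclusion of `Aut(T_d)`, with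
its usual topology, is continuous and open. -/
instance (d : ℕ) : TopologicalSpace (Neretin d) := (filterBasis d).topology

instance (d : ℕ) : IsTopologicalGroup (Neretin d) := (filterBasis d).isTopologicalGroup

end Neretin

/-! ## Abstract cube complexes -/

/-- A family of cubes on a vertex set `V`. The vertices of the standard `n`-cube `[0,1]^n` are the
subsets of `Fin n` (a subset standing for its indicator vector); `IsCube χ` says that `χ` is the
vertex map of (a parametrisation of) an `n`-cube of the family. -/
structure CubeFamily (V : Type*) where
  IsCube : ∀ {n : ℕ}, (Finset (Fin n) → V) → Prop

namespace CubeFamily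

variable {V : Type*}

/-- `F` is (the vertex set of) a face of the cube with vertex map `χ`: the image of the face of
the standard cube in which the coordinates in `J` are free, those in `B` are equal to `1` and the
remaining ones are equal to `0`. -/
def IsFace {n : ℕ} (χ : Finset (Fin n) → V) (F : Set V) : Prop :=
  ∃ B J : Finset (Fin n), Disjoint B J ∧ F = {v | ∃ I ⊆ J, v = χ (B ∪ I)}

/-- The family is a cube complex: all vertices are `0`-cubes, every cube is embedded, faces of
cubes are cubes, and two cubes that meet do so in a common face. -/
structure IsCubeComplex (C : CubeFamily V) : Prop where
  vertex : ∀ v : V, C.IsCube (fun _ : Finset (Fin 0) => v)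
  injective : ∀ {n : ℕ} {χ : Finset (Fin n) → V}, C.IsCube χ → Function.Injective χ
  face : ∀ {n : ℕ} {χ : Finset (Fin n) → V}, C.IsCube χ → ∀ F : Set V, IsFace χ F →
    ∃ (m : ℕ) (χ' : Finset (Fin m) → V), C.IsCube χ' ∧ range χ' = F
  inter : ∀ {n n' : ℕ} {χ : Finset (Fin n) → V} {χ' : Finset (Fin n') → V},
    C.IsCube χ → C.IsCube χ' → (range χ ∩ range χ').Nonempty →
    IsFace χ (range χ ∩ range χ') ∧ IsFace χ' (range χ ∩ range χ')

/-- Every vertex belongs to only finitely many cubes. -/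
def LocallyFinite (C : CubeFamily V) : Prop :=
  ∀ v : V, {F : Set V | v ∈ F ∧
    ∃ (n : ℕ) (χ : Finset (Fin n) → V), C.IsCube χ ∧ range χ = F}.Finite

/-- The link of the vertex `x`, as a set of finite subsets ("simplices") of the set of neighbours
of `x`: for each cube containing `x`, the set of the neighbours of `x` in this cube. -/
def link (C : CubeFamily V) (x : V) : Set (Finset V) :=
  {σ | ∃ (n : ℕ) (χ : Finset (Fin n) → V) (B : Finset (Fin n)), C.IsCube χ ∧ χ B = x ∧
    ∀ y : V, y ∈ σ ↔ ∃ i : Fin n, y = χ (symmDiff B {i})}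

open Classical in
/-- The point with coordinates `p` of the cube with vertex map `χ`, given by its multi-affine
barycentric coordinates with respect to the vertices of the cube. -/
noncomputable def cubePoint {n : ℕ} (χ : Finset (Fin n) → V) (p : Fin n → ℝ) (v : V) : ℝ :=
  ∑ I : Finset (Fin n), if χ I = v then ∏ i : Fin n, (if i ∈ I then p i else 1 - p i) else 0

/-- The geometric realisation: the union of the cubes `[0,1]^n`, glued along their common faces.
A point is given by its barycentric coordinates. -/
def Realization (C : CubeFamily V) : Type _ :=
  {μ : V → ℝ // ∃ (n : ℕ) (χ : Finset (Fin n) → V) (p : Fin n → ℝ),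
    C.IsCube χ ∧ (∀ i, p i ∈ Icc (0 : ℝ) 1) ∧ μ = cubePoint χ p}

/-- The topology of convergence of the barycentric coordinates; for a locally finite cube complex
this is the usual (weak) topology. -/
instance (C : CubeFamily V) : TopologicalSpace C.Realization :=
  instTopologicalSpaceSubtype

/-- CAT(0) cube complexes: simply connected cube complexes all of whose vertex links are flag,
i.e. every finite set of vertices of the link that are pairwise joined by an edge of the link is a
simplex of the link. (The links are simplicial complexes, since distinct cubes meet along common
faces.) -/
structure IsCAT0 (C : CubeFamily V) : Prop where
  isCubeComplex : C.IsCubeComplex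
  simplyConnected : SimplyConnectedSpace C.Realization
  flag : ∀ (x : V) (σ : Finset V),
    (∀ y ∈ σ, {y} ∈ C.link x) →
    (∀ y ∈ σ, ∀ z ∈ σ, y ≠ z → ∃ τ ∈ C.link x, (τ : Set V) = {y, z}) → σ ∈ C.link x

end CubeFamily

/-- Isomorphism of simplicial complexes, given as sets of simplices: a bijection between the
vertices that identifies the simplices. -/
def SimplicialIso {α β : Type*} (K : Set (Finset α)) (L : Set (Finset β)) : Prop :=
  ∃ e : {a : α // {a} ∈ K} ≃ {b : β // {b} ∈ L}, ∀ σ : Finset {a : α // {a} ∈ K},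
    σ.map (Function.Embedding.subtype _) ∈ K ↔
      (σ.map e.toEmbedding).map (Function.Embedding.subtype _) ∈ L

/-- The complex `I(p, q)`: its vertices are the subsets of size `p` of a set with `q` elements, and
its simplices are the finite sets of pairwise disjoint such subsets. -/
def disjointSubsetComplex (p q : ℕ) : Set (Finset (Finset (Fin q))) :=
  {σ | (∀ s ∈ σ, s.card = p) ∧ ∀ s ∈ σ, ∀ t ∈ σ, s ≠ t → Disjoint s t}

/-! ## The cube complex of the Neretin group -/

namespace Neretin

variable {d : ℕ}

/-- `(R, μ) ∼ (S, ν)` if `μ⁻¹ν` is a forest isomorphism `T ∖∖ S → T ∖∖ R`. -/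
def PairRel (x y : AdmTree d × Neretin d) : Prop :=
  ∃ ψ : ForestIso y.1 x.1, x.2⁻¹ * y.2 = ofIso ψ

theorem pairRel_equivalence : Equivalence (PairRel (d := d)) where
  refl x := ⟨RelIso.refl _, by rw [ofIso_refl, inv_mul_cancel]⟩
  symm := by
    rintro x y ⟨ψ, hψ⟩
    exact ⟨ψ.symm, by rw [ofIso_symm, ← hψ, mul_inv_rev, inv_inv]⟩
  trans := by
    rintro x y z ⟨ψ, hψ⟩ ⟨χ, hχ⟩
    exact ⟨χ.trans ψ, by rw [ofIso_trans, ← hψ, ← hχ]; group⟩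

instance pairSetoid (d : ℕ) : Setoid (AdmTree d × Neretin d) := ⟨PairRel, pairRel_equivalence⟩

/-- The vertices of the cube complex. -/
def Vertex (d : ℕ) : Type := Quotient (pairSetoid d)

/-- The vertex `[A, φ]`. -/
def vertex (A : AdmTree d) (φ : Neretin d) : Vertex d := Quotient.mk (pairSetoid d) (A, φ)

/-- The height of `[A, φ]` is the number of leaves of `A`. -/
def height : Vertex d → ℕ :=
  Quotient.lift (fun x : AdmTree d × Neretin d => x.1.leaves.card) (by
    rintro x y ⟨ψ, -⟩
    exact (ForestIso.card_leaves ψ).symm)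

/-- The action `g • [A, φ] = [A, gφ]`. -/
instance : MulAction (Neretin d) (Vertex d) where
  smul g := Quotient.map (fun x => (x.1, g * x.2)) (by
    rintro x y ⟨ψ, hψ⟩
    exact ⟨ψ, by rw [← hψ]; group⟩)
  one_smul := by
    rintro ⟨A, φ⟩
    exact congrArg (vertex A) (one_mul φ)
  mul_smul := by
    rintro g h ⟨A, φ⟩
    exact congrArg (vertex A) (mul_assoc g h φ)

theorem smul_vertex (g : Neretin d) (A : AdmTree d) (φ : Neretin d) :
    g • vertex A φ = vertex A (g * φ) := rfl

/-- The cube complex: for pairwise distinct leaves `a₁, …, aₙ` of `A`, the `2ⁿ` vertices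
`[A ∪ ⋃_{i ∈ I} c(a_i), φ]`, with `I ⊆ {1, …, n}`, span an `n`-cube. -/
def cubeComplex (d : ℕ) : CubeFamily (Vertex d) where
  IsCube {n} χ := ∃ (A : AdmTree d) (φ : Neretin d) (a : Fin n → Word d),
    Function.Injective a ∧ (∀ i, a i ∈ A.leaves) ∧
    ∀ I : Finset (Fin n), χ I = vertex (A.expand (I.image a)) φ

theorem isCube_smul (g : Neretin d) {n : ℕ} {χ : Finset (Fin n) → Vertex d}
    (h : (cubeComplex d).IsCube χ) : (cubeComplex d).IsCube (fun I => g • χ I) := by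
  obtain ⟨A, φ, a, ha, ha', H⟩ := h
  exact ⟨A, g * φ, a, ha, ha', fun I => congrArg (g • ·) (H I)⟩

/-- The action on the geometric realisation: `g` maps a cube to its image, affinely. -/
instance : MulAction (Neretin d) (cubeComplex d).Realization where
  smul g μ := ⟨fun v => μ.1 (g⁻¹ • v), by
    obtain ⟨μ, n, χ, p, hχ, hp, rfl⟩ := μ
    refine ⟨n, fun I => g • χ I, p, isCube_smul g hχ, hp, ?_⟩
    funext v
    have h : ∀ I : Finset (Fin n), χ I = g⁻¹ • v ↔ g • χ I = v := fun I => eq_inv_smul_iff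
    simp only [CubeFamily.cubePoint]
    refine Finset.sum_congr rfl (fun I _ => ?_)
    by_cases hI : χ I = g⁻¹ • v
    · rw [if_pos hI, if_pos ((h I).1 hI)]
    · rw [if_neg hI, if_neg (fun hI' => hI ((h I).2 hI'))]⟩
  one_smul μ := by
    apply Subtype.ext
    funext v
    change μ.1 ((1 : Neretin d)⁻¹ • v) = μ.1 v
    rw [inv_one, one_smul]
  mul_smul g h μ := by
    apply Subtype.ext
    funext v
    change μ.1 ((g * h)⁻¹ • v) = μ.1 (h⁻¹ • g⁻¹ • v)
    rw [mul_inv_rev, mul_smul]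

/-- The descending link of `x`: the simplices of the link of `x` all of whose vertices have smaller
height than `x`. -/
def descendingLink (x : Vertex d) : Set (Finset (Vertex d)) :=
  {σ | σ ∈ (cubeComplex d).link x ∧ ∀ y ∈ σ, height y < height x}

end Neretin

/-!
The whole argument rests on a combinatorial description of the vertices. A *node* is a class of
pairs `(v, φ)`, thought of as the image under `φ` of the subtree below `v`; two pairs give the same
node if `ψ⁻¹φ` carries one subtree isomorphically to the other, which is the relation
`Neretin.Sends`. A vertex `[A, φ]` is determined by the finite set of the nodes of the leaves of `A`
(`nodes_injective`), because almost automorphisms that match leaves glue to forest isomorphisms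
(`exists_eq_ofIso`). Attaching the children of a leaf replaces a node by its `d` children, and a
node is determined by the set of its children (`children_injective`). Conversely any `d` nodes of
a vertex are the children of one node and can be merged (`exists_merge_of_card`), since the leaves
of a tree can be permuted so that they become siblings.

Seen from one of its vertices `x`, a cube is therefore a set of nodes of `x` to be split together
with a set of pairwise disjoint families of `d` nodes of `x` to be merged. The cube complex axioms,
local finiteness, the flag condition and the description of descending links all follow from this.

The stabiliser of `[R, φ]` is a conjugate of `Aut(T ∖∖ R)`, which is open since it contains the
pointwise stabiliser of `R`, and compact since along an ultrafilter the image of each vertex of the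
forest, having finitely many possible values, is eventually constant. Properness of the action
follows from compactness of stabilisers and local finiteness.

The realisation is simply connected because it is contractible. In the chart `φ`, formed by the
vertices `[B, φ]`, a point is a profile `q`: weights in `[0, 1]` on the words that describe a tree
with a partially attached last level, its coordinate at `[B, φ]` being the product of `q v` over
the interior vertices and of `1 - q v` over the leaves `v` of `B`. Every point lies in such a chart,
and two profiles of one point differ by a forest isomorphism above the least vertex with nonzero
coordinate (`exists_forestIso_of_chartPoint_eq`). First the weights of those words below which `φ`
is not a tree isomorphism are raised to `1` (`raise`); the speed depends only on the deficit of a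
word, which is invariant under changes of charts. This ends in the chart of the identity, which is
then contracted to the vertex `[root, 1]` by cutting off the weights by depth (`shrink`).
-/

/-! ### Combinatorics of admissible subtrees -/

namespace NeretinCubes

variable {d : ℕ}

namespace AdmTree

theorem cons_mem_verts {S : AdmTree d} {i : Fin d} {v : Word d} :
    i :: v ∈ S.verts ↔ v ∈ S.interior :=
  ⟨fun h => mem_interior.2 ⟨i, h⟩, fun h => by
    obtain ⟨j, hj⟩ := mem_interior.1 h
    exact S.full hj i⟩

theorem mem_leaves {S : AdmTree d} {v : Word d} :
    v ∈ S.leaves ↔ v ∈ S.verts ∧ v ∉ S.interior := by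
  rw [leaves, Finset.mem_filter, mem_interior, not_exists]

theorem interior_subset_verts (S : AdmTree d) : S.interior ⊆ S.verts :=
  Finset.filter_subset _ _

theorem mem_interior_of_cons {S : AdmTree d} {i : Fin d} {v : Word d} (h : i :: v ∈ S.interior) :
    v ∈ S.interior :=
  cons_mem_verts.1 (S.interior_subset_verts h)

theorem nil_mem_leaves {S : AdmTree d} : [] ∈ S.leaves ↔ [] ∉ S.interior := by
  simp [mem_leaves, S.root_mem]

theorem cons_mem_leaves {S : AdmTree d} {i : Fin d} {v : Word d} :
    i :: v ∈ S.leaves ↔ v ∈ S.interior ∧ i :: v ∉ S.interior := by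
  rw [mem_leaves, cons_mem_verts]

theorem le_iff_interior {S R : AdmTree d} : S ≤ R ↔ S.interior ⊆ R.interior :=
  ⟨fun h v hv => by
    by_contra hR
    exact interior_mono h hR hv, fun h => le_of_interior h⟩

theorem ext_interior {S R : AdmTree d} (h : S.interior = R.interior) : S = R :=
  le_antisymm (le_iff_interior.2 h.subset) (le_iff_interior.2 h.symm.subset)

/-- Induction towards the root: a property of words that holds off the interior of a (finite)
admissible subtree, and at every word all of whose children have it, holds everywhere. -/
theorem upward_induction (R : AdmTree d) {P : Word d → Prop} (h₀ : ∀ v ∉ R.interior, P v)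
    (h₁ : ∀ v, (∀ i : Fin d, P (i :: v)) → P v) (v : Word d) : P v := by
  have key : ∀ (n : ℕ) (v : Word d), R.verts.sup List.length < n + v.length → P v := by
    intro n
    induction n with
    | zero =>
      intro v hv
      refine h₀ v fun h => ?_
      have := Finset.le_sup (f := List.length) (R.interior_subset_verts h)
      omega
    | succ n ih =>
      intro v hv
      refine h₁ v fun i => ih _ ?_
      rw [List.length_cons]
      omega
  exact key (R.verts.sup List.length + 1) v (by omega)

/-- Induction away from the leaves: a property of words that holds at the leaves of `S` and passes
from the vertices of the forest `T ∖∖ S` to their children holds on the whole forest. -/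
theorem forest_induction (S : AdmTree d) {P : Word d → Prop} (h₀ : ∀ v ∈ S.leaves, P v)
    (h₁ : ∀ v, v ∉ S.interior → P v → ∀ i : Fin d, P (i :: v)) (v : Word d)
    (hv : v ∉ S.interior) : P v := by
  induction v with
  | nil => exact h₀ _ (nil_mem_leaves.2 hv)
  | cons i v ih =>
    by_cases h : v ∈ S.interior
    · exact h₀ _ (cons_mem_leaves.2 ⟨h, hv⟩)
    · exact h₁ v h (ih h) i

/-- If `S` is not contained in `R`, then some leaf of `R` is an interior vertex of `S`. -/
theorem exists_leaf_mem_interior {S R : AdmTree d} (h : ¬ S ≤ R) :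
    ∃ v ∈ R.leaves, v ∈ S.interior := by
  by_contra! hS
  refine h (le_iff_interior.2 fun v hv => ?_)
  by_contra hR
  exact R.forest_induction (P := fun v => v ∉ S.interior) hS
    (fun v _ hv i hi => hv (mem_interior_of_cons hi)) v hR hv

/-- The admissible subtree whose interior is a given finite set of words closed under parents. -/
def ofInterior (F : Finset (Word d)) (hF : ∀ (i : Fin d) (v : Word d), i :: v ∈ F → v ∈ F) :
    AdmTree d where
  verts := {[]} ∪ F.biUnion fun v => Finset.univ.image fun i : Fin d => i :: v
  root_mem := by simp
  parent_mem := by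
    intro i v h
    simp only [Finset.mem_union, Finset.mem_singleton, Finset.mem_biUnion, Finset.mem_image,
      Finset.mem_univ, true_and, List.cons.injEq, reduceCtorEq, false_or] at h ⊢
    obtain ⟨w, hw, j, -, rfl⟩ := h
    cases w with
    | nil => exact Or.inl rfl
    | cons k u => exact Or.inr ⟨u, hF _ _ hw, k, rfl⟩
  full := by
    intro i v h j
    simp only [Finset.mem_union, Finset.mem_singleton, Finset.mem_biUnion, Finset.mem_image,
      Finset.mem_univ, true_and, List.cons.injEq, reduceCtorEq, false_or] at h ⊢
    obtain ⟨w, hw, k, -, rfl⟩ := h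
    exact ⟨w, hw, j, rfl, rfl⟩

theorem interior_ofInterior [NeZero d] (F : Finset (Word d))
    (hF : ∀ (i : Fin d) (v : Word d), i :: v ∈ F → v ∈ F) : (ofInterior F hF).interior = F := by
  ext v
  rw [← cons_mem_verts (i := (0 : Fin d))]
  simp [ofInterior]

theorem interior_expand [NeZero d] (A : AdmTree d) (s : Finset (Word d)) (hs : s ⊆ A.leaves) :
    (A.expand s).interior = A.interior ∪ s := by
  ext v
  rw [← cons_mem_verts (i := (0 : Fin d)), Finset.mem_union, ← cons_mem_verts (i := (0 : Fin d))]
  have : v ∈ s → v ∈ A.verts := fun h => (mem_leaves.1 (hs h)).1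
  simp only [expand, Finset.mem_union, Finset.mem_biUnion, Finset.mem_inter, Finset.mem_image,
    Finset.mem_univ, true_and, List.cons.injEq]
  constructor
  · rintro (h | ⟨a, ha, j, -, rfl⟩)
    · exact Or.inl h
    · exact Or.inr ha.2
  · rintro (h | h)
    · exact Or.inl h
    · exact Or.inr ⟨v, ⟨this h, h⟩, 0, rfl, rfl⟩

theorem mem_leaves_expand [NeZero d] {A : AdmTree d} {s : Finset (Word d)} (hs : s ⊆ A.leaves)
    {v : Word d} :
    v ∈ (A.expand s).leaves ↔ (v ∈ A.leaves ∧ v ∉ s) ∨ ∃ a ∈ s, ∃ i : Fin d, v = i :: a := by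
  cases v with
  | nil =>
    rw [nil_mem_leaves, nil_mem_leaves, interior_expand A s hs]
    simp
  | cons i v =>
    rw [cons_mem_leaves, cons_mem_leaves, interior_expand A s hs]
    have h1 : v ∈ s → v ∉ A.interior := fun h => (mem_leaves.1 (hs h)).2
    have h2 : i :: v ∈ s → v ∈ A.interior := fun h => (cons_mem_leaves.1 (hs h)).1
    have h3 : i :: v ∈ A.interior → v ∈ A.interior := mem_interior_of_cons
    simp only [Finset.mem_union, List.cons.injEq]
    constructor
    · rintro ⟨h | h, h'⟩
      · exact Or.inl ⟨⟨h, fun h'' => h' (Or.inl h'')⟩, fun h'' => h' (Or.inr h'')⟩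
      · exact Or.inr ⟨v, h, i, rfl, rfl⟩
    · rintro (⟨⟨h, h'⟩, h''⟩ | ⟨a, ha, j, rfl, rfl⟩)
      · exact ⟨Or.inl h, fun h => h.elim h' h''⟩
      · exact ⟨Or.inr ha, fun h => h.elim (fun h => h1 ha (h3 h)) (fun h => h1 ha (h2 h))⟩

end AdmTree

/-! ### The partial action of almost automorphisms on words -/

namespace Triple

/-- `t.Sends v w`: the almost automorphism given by `t` maps the subtree of all descendants of `v`
isomorphically onto the subtree of all descendants of `w`. This holds where `t` is defined, and it
holds at a word whenever it holds at all of its children, the images being all the children of one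
word. -/
inductive Sends (t : Triple d) : Word d → Word d → Prop
  | of_maps {v w : Word d} : t.Maps v w → Sends t v w
  | of_children {v w : Word d} (σ : Equiv.Perm (Fin d)) :
      (∀ i, Sends t (i :: v) (σ i :: w)) → Sends t v w

theorem Maps.children {t : Triple d} {v w : Word d} (h : t.Maps v w) :
    ∃ σ : Equiv.Perm (Fin d), ∀ i, t.Maps (i :: v) (σ i :: w) := by
  obtain ⟨h, rfl⟩ := h
  have hi : ∀ i : Fin d, i :: v ∉ t.src.interior :=
    fun i h' => h (AdmTree.mem_interior_of_cons h')
  have H : ∀ i : Fin d, ∃ j : Fin d, (t.iso ⟨i :: v, hi i⟩).1 = j :: (t.iso ⟨v, h⟩).1 :=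
    fun i => t.iso.map_rel_iff.2 (show forestRel t.src ⟨v, h⟩ ⟨i :: v, hi i⟩ from ⟨i, rfl⟩)
  choose f hf using H
  have hinj : Function.Injective f := by
    intro i j hij
    have : t.iso ⟨i :: v, hi i⟩ = t.iso ⟨j :: v, hi j⟩ :=
      Subtype.ext (by rw [hf, hf, hij])
    have := congrArg Subtype.val (t.iso.injective this)
    exact (List.cons.inj this).1
  exact ⟨Equiv.ofBijective f (Finite.injective_iff_bijective.1 hinj), fun i => ⟨hi i, hf i⟩⟩

namespace Sends

theorem children {t : Triple d} {v w : Word d} (h : t.Sends v w) :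
    ∃ σ : Equiv.Perm (Fin d), ∀ i, t.Sends (i :: v) (σ i :: w) := by
  cases h with
  | of_maps h =>
    obtain ⟨σ, hσ⟩ := h.children
    exact ⟨σ, fun i => of_maps (hσ i)⟩
  | of_children σ h => exact ⟨σ, h⟩

theorem maps [NeZero d] {t : Triple d} {v w : Word d} (h : t.Sends v w)
    (hv : v ∉ t.src.interior) : t.Maps v w := by
  induction h with
  | of_maps h => exact h
  | @of_children v w σ _ ih =>
    have h0 := ih 0 fun h => hv (AdmTree.mem_interior_of_cons h)
    obtain ⟨τ, hτ⟩ := Maps.children (⟨hv, rfl⟩ : t.Maps v _)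
    have := h0.unique (hτ 0)
    exact ⟨hv, (List.cons.inj this).2.symm⟩

theorem unique [NeZero d] {t : Triple d} {v w w' : Word d} (h : t.Sends v w)
    (h' : t.Sends v w') : w = w' := by
  revert w w'
  refine t.src.upward_induction (P := fun v => ∀ {w w' : Word d}, t.Sends v w → t.Sends v w' →
    w = w') (fun v hv w w' h h' => (h.maps hv).unique (h'.maps hv)) (fun v ih w w' h h' => ?_) v
  obtain ⟨σ, hσ⟩ := h.children
  obtain ⟨τ, hτ⟩ := h'.children
  exact (List.cons.inj (ih 0 (hσ 0) (hτ 0))).2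

theorem of_rel [NeZero d] {t t' : Triple d} (hr : t.Rel t') {v w : Word d} (h : t.Sends v w) :
    t'.Sends v w := by
  obtain ⟨R, hR⟩ := rel_iff.1 hr
  revert w
  refine R.upward_induction (P := fun v => ∀ {w : Word d}, t.Sends v w → t'.Sends v w)
    (fun v hv w h => ?_) (fun v ih w h => ?_) v
  · obtain ⟨x, hx, hx'⟩ := hR v hv
    rw [h.unique (of_maps hx)]
    exact of_maps hx'
  · obtain ⟨σ, hσ⟩ := h.children
    exact of_children σ fun i => ih i (hσ i)

theorem inv {t : Triple d} {v w : Word d} (h : t.Sends v w) : t.inv.Sends w v := by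
  induction h with
  | of_maps h => exact of_maps h.inv
  | of_children σ _ ih =>
    refine of_children σ.symm fun i => ?_
    have := ih (σ.symm i)
    rwa [Equiv.apply_symm_apply] at this

theorem comp [NeZero d] {g f : Triple d} {v u w : Word d} (hf : f.Sends v u) (hg : g.Sends u w) :
    (comp g f).Sends v w := by
  obtain ⟨Q, hQ⟩ := exists_comp_maps g f (AdmTree.root d)
  revert u w
  refine Q.upward_induction (P := fun v => ∀ {u w : Word d}, f.Sends v u → g.Sends u w →
    (Triple.comp g f).Sends v w) (fun v hv u w hf hg => ?_) (fun v ih u w hf hg => ?_) v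
  · obtain ⟨u', w', hu, hw, h, -⟩ := hQ v hv
    obtain rfl := hf.unique (of_maps hu)
    obtain rfl := hg.unique (of_maps hw)
    exact of_maps h
  · obtain ⟨σ, hσ⟩ := hf.children
    obtain ⟨τ, hτ⟩ := hg.children
    exact of_children (σ.trans τ) fun i => ih i (hσ i) (hτ (σ i))

end Sends

end Triple

end NeretinCubes

namespace Neretin

variable {d : ℕ}

/-- The almost automorphism `g` maps the subtree of all descendants of `v` isomorphically onto the
subtree of all descendants of `w`. -/
def Sends (g : Neretin d) (v w : Word d) : Prop :=
  ∃ t : Triple d, Quotient.mk (Triple.setoid d) t = g ∧ t.Sends v w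

namespace Sends

theorem one (v : Word d) : (1 : Neretin d).Sends v v :=
  ⟨Triple.id d, rfl, .of_maps (Triple.id_maps v)⟩

theorem ofIso {S S' : AdmTree d} (θ : ForestIso S S') (v : Forest S) :
    (ofIso θ).Sends v.1 (θ v).1 :=
  ⟨⟨S, S', θ⟩, rfl, .of_maps ⟨v.2, rfl⟩⟩

theorem children {g : Neretin d} {v w : Word d} (h : g.Sends v w) :
    ∃ σ : Equiv.Perm (Fin d), ∀ i, g.Sends (i :: v) (σ i :: w) := by
  obtain ⟨t, ht, h⟩ := h
  obtain ⟨σ, hσ⟩ := h.children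
  exact ⟨σ, fun i => ⟨t, ht, hσ i⟩⟩

theorem inv {g : Neretin d} {v w : Word d} (h : g.Sends v w) : g⁻¹.Sends w v := by
  obtain ⟨t, rfl, h⟩ := h
  exact ⟨t.inv, rfl, h.inv⟩

variable [NeZero d]

theorem of_mk {g : Neretin d} {v w : Word d} (h : g.Sends v w) {t : Triple d}
    (ht : Quotient.mk (Triple.setoid d) t = g) : t.Sends v w := by
  obtain ⟨t', ht', h⟩ := h
  exact h.of_rel (Quotient.exact (ht'.trans ht.symm))

theorem unique {g : Neretin d} {v w w' : Word d} (h : g.Sends v w) (h' : g.Sends v w') :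
    w = w' := by
  obtain ⟨t, ht, h⟩ := h
  exact h.unique (h'.of_mk ht)

theorem of_children {g : Neretin d} {v w : Word d} (σ : Equiv.Perm (Fin d))
    (h : ∀ i, g.Sends (i :: v) (σ i :: w)) : g.Sends v w := by
  obtain ⟨t, ht⟩ := Quotient.exists_rep g
  exact ⟨t, ht, .of_children σ fun i => (h i).of_mk ht⟩

theorem mul {g f : Neretin d} {v u w : Word d} (hf : f.Sends v u) (hg : g.Sends u w) :
    (g * f).Sends v w := by
  obtain ⟨t, rfl, h⟩ := hf
  obtain ⟨t', rfl, h'⟩ := hg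
  exact ⟨Triple.comp t' t, rfl, h.comp h'⟩

theorem injective {g : Neretin d} {v v' w : Word d} (h : g.Sends v w) (h' : g.Sends v' w) :
    v = v' :=
  h.inv.unique h'.inv

end Sends

theorem exists_sends (g : Neretin d) : ∃ R : AdmTree d, ∀ v ∉ R.interior, ∃ w, g.Sends v w := by
  obtain ⟨t, rfl⟩ := Quotient.exists_rep g
  exact ⟨t.src, fun v hv => ⟨_, t, rfl, .of_maps ⟨hv, rfl⟩⟩⟩

variable [NeZero d]

theorem eq_ofIso_of_sends {g : Neretin d} {S S' : AdmTree d} (θ : ForestIso S S')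
    (h : ∀ u : Forest S, g.Sends u.1 (θ u).1) : g = ofIso θ := by
  obtain ⟨t, rfl⟩ := Quotient.exists_rep g
  refine Quotient.sound (Triple.rel_iff.2 ⟨S.union t.src, fun v hv => ?_⟩)
  have hS := AdmTree.interior_mono (AdmTree.le_union_left _ _) hv
  have ht := AdmTree.interior_mono (AdmTree.le_union_right _ _) hv
  exact ⟨_, ((h ⟨v, hS⟩).of_mk rfl).maps ht, hS, rfl⟩

theorem ofIso_injective {S S' : AdmTree d} {θ θ' : ForestIso S S'} (h : ofIso θ = ofIso θ') :
    θ = θ' := by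
  ext v
  have h1 := Sends.ofIso θ v
  rw [h] at h1
  rw [Subtype.ext (h1.unique (Sends.ofIso θ' v))]

/-- An almost automorphism that matches the leaves of `A` with the leaves of `B` is given by a
forest isomorphism `T ∖∖ A → T ∖∖ B`. -/
theorem exists_eq_ofIso {g : Neretin d} {A B : AdmTree d}
    (hA : ∀ a ∈ A.leaves, ∃ b ∈ B.leaves, g.Sends a b)
    (hB : ∀ b ∈ B.leaves, ∃ a ∈ A.leaves, g.Sends a b) :
    ∃ θ : ForestIso A B, g = ofIso θ := by
  have key : ∀ {g : Neretin d} {A B : AdmTree d},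
      (∀ a ∈ A.leaves, ∃ b ∈ B.leaves, g.Sends a b) →
      ∀ v, v ∉ A.interior → ∃ w, w ∉ B.interior ∧ g.Sends v w := by
    intro g A B hA
    refine A.forest_induction (fun v hv => ?_) (fun v _ ih i => ?_)
    · obtain ⟨b, hb, h⟩ := hA v hv
      exact ⟨b, (AdmTree.mem_leaves.1 hb).2, h⟩
    · obtain ⟨w, hw, h⟩ := ih
      obtain ⟨σ, hσ⟩ := h.children
      exact ⟨_, fun h => hw (AdmTree.mem_interior_of_cons h), hσ i⟩
  have h1 : ∀ v : Forest A, ∃ w : Forest B, g.Sends v.1 w.1 := fun v => by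
    obtain ⟨w, hw, h⟩ := key hA v.1 v.2
    exact ⟨⟨w, hw⟩, h⟩
  have h2 : ∀ w : Forest B, ∃ v : Forest A, g.Sends v.1 w.1 := fun w => by
    obtain ⟨v, hv, h⟩ := key (g := g⁻¹) (A := B) (B := A) (fun b hb => by
      obtain ⟨a, ha, h⟩ := hB b hb
      exact ⟨a, ha, h.inv⟩) w.1 w.2
    exact ⟨⟨v, hv⟩, inv_inv g ▸ h.inv⟩
  choose f hf using h1
  choose f' hf' using h2
  have hrel : ∀ {g : Neretin d} {u v u' v' : Word d}, g.Sends u u' → g.Sends v v' →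
      (∃ i : Fin d, v = i :: u) → ∃ i : Fin d, v' = i :: u' := by
    rintro g u _ u' v' hu hv ⟨i, rfl⟩
    obtain ⟨σ, hσ⟩ := hu.children
    exact ⟨σ i, hv.unique (hσ i)⟩
  refine ⟨{ toFun := f
            invFun := f'
            left_inv := fun v => Subtype.ext ((hf' (f v)).injective (hf v))
            right_inv := fun w => Subtype.ext ((hf (f' w)).unique (hf' w))
            map_rel_iff' := fun {u v} => ⟨hrel (hf u).inv (hf v).inv, hrel (hf u) (hf v)⟩ }, ?_⟩
  exact eq_ofIso_of_sends _ hf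

end Neretin

/-! ### Nodes -/

namespace Neretin

variable {d : ℕ}

theorem vertex_eq_vertex {A B : AdmTree d} {φ ψ : Neretin d} :
    vertex A φ = vertex B ψ ↔ ∃ θ : ForestIso A B, ψ⁻¹ * φ = ofIso θ := by
  rw [eq_comm]
  exact Quotient.eq (r := pairSetoid d)

theorem exists_vertex (x : Vertex d) : ∃ A φ, x = vertex A φ := by
  induction x using Quotient.inductionOn with
  | h x => exact ⟨x.1, x.2, rfl⟩

section Nodes

variable [NeZero d]

instance nodeSetoid (d : ℕ) [NeZero d] : Setoid (Word d × Neretin d) where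
  r x y := (y.2⁻¹ * x.2).Sends x.1 y.1
  iseqv :=
    { refl := fun x => by
        rw [inv_mul_cancel]
        exact Sends.one x.1
      symm := fun {x y} h => by
        have := h.inv
        rwa [mul_inv_rev, inv_inv] at this
      trans := fun {x y z} h h' => by
        have := h.mul h'
        rwa [mul_assoc, mul_inv_cancel_left] at this }

/-- Nodes are the classes of pairs `(v, φ)`, where `(v, φ)` and `(w, ψ)` are identified if `ψ⁻¹φ`
maps the subtree below `v` isomorphically onto the subtree below `w`. The node of `(v, φ)` stands
for the image under `φ` of the subtree below `v`: a clopen subset of the boundary of `T_d` together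
with the structure of a rooted tree on it. -/
def Node (d : ℕ) [NeZero d] : Type := Quotient (nodeSetoid d)

/-- The node of `(v, φ)`. -/
def node (v : Word d) (φ : Neretin d) : Node d := Quotient.mk (nodeSetoid d) (v, φ)

noncomputable instance : DecidableEq (Node d) := Classical.decEq _

theorem node_eq_node {v w : Word d} {φ ψ : Neretin d} :
    node v φ = node w ψ ↔ (ψ⁻¹ * φ).Sends v w :=
  Quotient.eq

theorem node_injective (φ : Neretin d) : Function.Injective fun v : Word d => node v φ := by
  intro v w h
  have := node_eq_node.1 h
  rw [inv_mul_cancel] at this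
  exact (Sends.one v).unique this

theorem exists_node (m : Node d) : ∃ v φ, m = node v φ := by
  induction m using Quotient.inductionOn with
  | h x => exact ⟨x.1, x.2, rfl⟩

/-- The set of the children of a node. -/
noncomputable def children : Node d → Finset (Node d) :=
  Quotient.lift (fun x => Finset.univ.image fun i : Fin d => node (i :: x.1) x.2) (by
    rintro ⟨v, φ⟩ ⟨w, ψ⟩ h
    obtain ⟨σ, hσ⟩ := Sends.children h
    have e : ∀ i, node (i :: v) φ = node (σ i :: w) ψ := fun i => node_eq_node.2 (hσ i)
    ext n
    simp only [Finset.mem_image, Finset.mem_univ, true_and, e]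
    exact (σ.surjective.exists (p := fun j => node (j :: w) ψ = n)).symm)

theorem mem_children_node {v : Word d} {φ : Neretin d} {n : Node d} :
    n ∈ children (node v φ) ↔ ∃ i : Fin d, n = node (i :: v) φ := by
  change n ∈ Finset.univ.image (fun i : Fin d => node (i :: v) φ) ↔ _
  simp [eq_comm]

theorem card_children (m : Node d) : (children m).card = d := by
  obtain ⟨v, φ, rfl⟩ := exists_node m
  change (Finset.univ.image (fun i : Fin d => node (i :: v) φ)).card = d
  rw [Finset.card_image_of_injective, Finset.card_univ, Fintype.card_fin]
  intro i j h
  exact (List.cons.inj (node_injective φ h)).1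

theorem children_nonempty (m : Node d) : (children m).Nonempty := by
  rw [← Finset.card_pos, card_children]
  exact Nat.pos_of_neZero d

/-- A node is determined by its children: an almost automorphism that maps the subtrees below the
children of `v` to those below the children of `w` maps the subtree below `v` to that below `w`. -/
theorem children_injective : Function.Injective (children (d := d)) := by
  intro m n h
  obtain ⟨v, φ, rfl⟩ := exists_node m
  obtain ⟨w, ψ, rfl⟩ := exists_node n
  have H : ∀ i : Fin d, ∃ j : Fin d, node (i :: v) φ = node (j :: w) ψ := fun i =>
    mem_children_node.1 (h ▸ mem_children_node.2 ⟨i, rfl⟩)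
  choose f hf using H
  have hinj : Function.Injective f := by
    intro i j hij
    have : node (i :: v) φ = node (j :: v) φ := by rw [hf, hf, hij]
    exact (List.cons.inj (node_injective φ this)).1
  exact node_eq_node.2 (Sends.of_children
    (Equiv.ofBijective f (Finite.injective_iff_bijective.1 hinj)) fun i => node_eq_node.1 (hf i))

/-- The nodes of the leaves of `A`, in the chart `φ`. -/
noncomputable def leafNodes (A : AdmTree d) (φ : Neretin d) : Finset (Node d) :=
  A.leaves.image fun v => node v φ

theorem mem_leafNodes {A : AdmTree d} {φ : Neretin d} {n : Node d} :
    n ∈ leafNodes A φ ↔ ∃ v ∈ A.leaves, n = node v φ := by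
  simp [leafNodes, eq_comm]

theorem node_mem_leafNodes {A : AdmTree d} {φ : Neretin d} {v : Word d} :
    node v φ ∈ leafNodes A φ ↔ v ∈ A.leaves := by
  rw [mem_leafNodes]
  exact ⟨fun ⟨w, hw, h⟩ => node_injective φ h ▸ hw, fun h => ⟨v, h, rfl⟩⟩

theorem vertex_eq_iff_leafNodes {A B : AdmTree d} {φ ψ : Neretin d} :
    vertex A φ = vertex B ψ ↔ leafNodes A φ = leafNodes B ψ := by
  rw [vertex_eq_vertex]
  constructor
  · rintro ⟨θ, hθ⟩
    have e : ∀ u : Forest A, node u.1 φ = node (θ u).1 ψ := fun u =>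
      node_eq_node.2 (hθ ▸ Sends.ofIso θ u)
    ext n
    rw [mem_leafNodes, mem_leafNodes]
    constructor
    · rintro ⟨v, hv, rfl⟩
      exact ⟨_, (ForestIso.mem_leaves θ ⟨v, (AdmTree.mem_leaves.1 hv).2⟩).2 hv, e ⟨v, _⟩⟩
    · rintro ⟨w, hw, rfl⟩
      refine ⟨_, (ForestIso.mem_leaves θ.symm ⟨w, (AdmTree.mem_leaves.1 hw).2⟩).2 hw, ?_⟩
      rw [e, θ.apply_symm_apply]
  · intro h
    apply exists_eq_ofIso
    · intro a ha
      obtain ⟨b, hb, e⟩ := mem_leafNodes.1 (h ▸ node_mem_leafNodes.2 ha)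
      exact ⟨b, hb, node_eq_node.1 e⟩
    · intro b hb
      obtain ⟨a, ha, e⟩ := mem_leafNodes.1 (h ▸ node_mem_leafNodes.2 hb)
      exact ⟨a, ha, node_eq_node.1 e.symm⟩

/-- The set of nodes of a vertex: the vertex `[A, φ]` is encoded by the nodes of the leaves
of `A`. -/
noncomputable def nodes : Vertex d → Finset (Node d) :=
  Quotient.lift (fun x => leafNodes x.1 x.2) fun _ _ h =>
    vertex_eq_iff_leafNodes.1 (Quotient.sound h)

theorem nodes_vertex (A : AdmTree d) (φ : Neretin d) : nodes (vertex A φ) = leafNodes A φ := rfl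

theorem nodes_injective : Function.Injective (nodes (d := d)) := by
  intro x y h
  obtain ⟨A, φ, rfl⟩ := exists_vertex x
  obtain ⟨B, ψ, rfl⟩ := exists_vertex y
  exact vertex_eq_iff_leafNodes.2 h

theorem card_nodes (x : Vertex d) : (nodes x).card = height x := by
  obtain ⟨A, φ, rfl⟩ := exists_vertex x
  exact Finset.card_image_of_injective _ (node_injective φ)

theorem vertex_left_injective (φ : Neretin d) :
    Function.Injective fun A : AdmTree d => vertex A φ := by
  intro A B h
  have hl : A.leaves = B.leaves := by
    ext v
    rw [← node_mem_leafNodes (φ := φ), ← node_mem_leafNodes (φ := φ),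
      vertex_eq_iff_leafNodes.1 h]
  have key : ∀ {A B : AdmTree d}, A.leaves = B.leaves → A ≤ B := by
    intro A B h
    by_contra hAB
    obtain ⟨v, hv, hv'⟩ := AdmTree.exists_leaf_mem_interior hAB
    exact (AdmTree.mem_leaves.1 (h ▸ hv)).2 hv'
  exact le_antisymm (key hl) (key hl.symm)

theorem disjoint_children_nodes {x : Vertex d} {n : Node d} (hn : n ∈ nodes x) :
    Disjoint (children n) (nodes x) := by
  obtain ⟨A, φ, rfl⟩ := exists_vertex x
  obtain ⟨v, hv, rfl⟩ := mem_leafNodes.1 hn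
  rw [Finset.disjoint_left]
  intro m hm hm'
  obtain ⟨i, rfl⟩ := mem_children_node.1 hm
  exact (AdmTree.mem_leaves.1 hv).2 (AdmTree.cons_mem_leaves.1 (node_mem_leafNodes.1 hm')).1

/-- No grandchild of a node of `x` is a node of `x`. -/
theorem disjoint_grandchildren_nodes {x : Vertex d} {n m : Node d} (hn : n ∈ nodes x)
    (hm : m ∈ children n) : Disjoint (children m) (nodes x) := by
  obtain ⟨A, φ, rfl⟩ := exists_vertex x
  obtain ⟨v, hv, rfl⟩ := mem_leafNodes.1 hn
  obtain ⟨i, rfl⟩ := mem_children_node.1 hm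
  rw [Finset.disjoint_left]
  intro k hk hk'
  obtain ⟨j, rfl⟩ := mem_children_node.1 hk
  exact (AdmTree.mem_leaves.1 hv).2 (AdmTree.mem_interior_of_cons
    (AdmTree.cons_mem_leaves.1 (node_mem_leafNodes.1 hk')).1)

theorem disjoint_children_children {x : Vertex d} {n m : Node d} (hn : n ∈ nodes x)
    (hm : m ∈ nodes x) (hnm : n ≠ m) : Disjoint (children n) (children m) := by
  obtain ⟨A, φ, rfl⟩ := exists_vertex x
  obtain ⟨v, hv, rfl⟩ := mem_leafNodes.1 hn
  obtain ⟨w, hw, rfl⟩ := mem_leafNodes.1 hm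
  rw [Finset.disjoint_left]
  intro k hk hk'
  obtain ⟨i, rfl⟩ := mem_children_node.1 hk
  obtain ⟨j, h⟩ := mem_children_node.1 hk'
  exact hnm (by rw [(List.cons.inj (node_injective φ h)).2])

/-- Splitting the nodes of `S`: they are replaced by their children. -/
noncomputable def split (W S : Finset (Node d)) : Finset (Node d) := (W \ S) ∪ S.biUnion children

theorem mem_split {W S : Finset (Node d)} {n : Node d} :
    n ∈ split W S ↔ (n ∈ W ∧ n ∉ S) ∨ ∃ m ∈ S, n ∈ children m := by
  simp [split]

theorem leafNodes_expand (A : AdmTree d) (φ : Neretin d) {s : Finset (Word d)}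
    (hs : s ⊆ A.leaves) :
    leafNodes (A.expand s) φ = split (leafNodes A φ) (s.image fun v => node v φ) := by
  ext n
  simp only [mem_leafNodes, mem_split, AdmTree.mem_leaves_expand hs, Finset.mem_image]
  constructor
  · rintro ⟨v, ⟨hv, hvs⟩ | ⟨a, ha, i, rfl⟩, rfl⟩
    · refine Or.inl ⟨⟨v, hv, rfl⟩, ?_⟩
      rintro ⟨w, hw, h⟩
      exact hvs (node_injective φ h ▸ hw)
    · exact Or.inr ⟨_, ⟨a, ha, rfl⟩, mem_children_node.2 ⟨i, rfl⟩⟩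
  · rintro (⟨⟨v, hv, rfl⟩, h⟩ | ⟨_, ⟨a, ha, rfl⟩, h⟩)
    · exact ⟨v, Or.inl ⟨hv, fun hs => h ⟨v, hs, rfl⟩⟩, rfl⟩
    · obtain ⟨i, rfl⟩ := mem_children_node.1 h
      exact ⟨i :: a, Or.inr ⟨a, ha, i, rfl⟩, rfl⟩

theorem isCube_iff {n : ℕ} {χ : Finset (Fin n) → Vertex d} :
    (cubeComplex d).IsCube χ ↔ ∃ b : Fin n → Node d, Function.Injective b ∧
      (∀ i, b i ∈ nodes (χ ∅)) ∧ ∀ I, nodes (χ I) = split (nodes (χ ∅)) (I.image b) := by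
  constructor
  · rintro ⟨A, φ, a, ha, hA, h⟩
    have hs : ∀ I : Finset (Fin n), I.image a ⊆ A.leaves := fun I v hv => by
      obtain ⟨i, -, rfl⟩ := Finset.mem_image.1 hv
      exact hA i
    have h0 : nodes (χ ∅) = leafNodes A φ := by
      rw [h, nodes_vertex, leafNodes_expand _ _ (hs _)]
      simp [split]
    refine ⟨fun i => node (a i) φ, (node_injective φ).comp ha, fun i => ?_, fun I => ?_⟩
    · rw [h0]
      exact node_mem_leafNodes.2 (hA i)
    · rw [h, nodes_vertex, leafNodes_expand _ _ (hs _), h0, Finset.image_image]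
      rfl
  · rintro ⟨b, hb, hb0, h⟩
    obtain ⟨A, φ, hA⟩ := exists_vertex (χ ∅)
    rw [hA, nodes_vertex] at hb0 h
    choose a ha hab using fun i => mem_leafNodes.1 (hb0 i)
    refine ⟨A, φ, a, fun i j hij => hb (by rw [hab, hab, hij]), ha, fun I => nodes_injective ?_⟩
    rw [h, nodes_vertex, leafNodes_expand, Finset.image_image]
    · congr 1
      refine Finset.image_congr fun i _ => hab i
    · intro v hv
      obtain ⟨i, -, rfl⟩ := Finset.mem_image.1 hv
      exact ha i

theorem exists_nodes_eq_split (x : Vertex d) {S : Finset (Node d)} (hS : S ⊆ nodes x) :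
    ∃ y, nodes y = split (nodes x) S := by
  obtain ⟨A, φ, rfl⟩ := exists_vertex x
  refine ⟨vertex (A.expand (A.leaves.filter fun v => node v φ ∈ S)) φ, ?_⟩
  rw [nodes_vertex, nodes_vertex, leafNodes_expand _ _ (Finset.filter_subset _ _)]
  congr 1
  ext n
  simp only [Finset.mem_image, Finset.mem_filter]
  constructor
  · rintro ⟨v, ⟨-, h⟩, rfl⟩
    exact h
  · intro h
    obtain ⟨v, hv, rfl⟩ := mem_leafNodes.1 (hS h)
    exact ⟨v, ⟨hv, h⟩, rfl⟩

/-- A cube with bottom vertex `x` for each set of nodes of `x`. -/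
theorem exists_isCube (x : Vertex d) {n : ℕ} {b : Fin n → Node d} (hb : Function.Injective b)
    (hx : ∀ i, b i ∈ nodes x) : ∃ χ : Finset (Fin n) → Vertex d, (cubeComplex d).IsCube χ ∧
      ∀ I, nodes (χ I) = split (nodes x) (I.image b) := by
  have H : ∀ I : Finset (Fin n), I.image b ⊆ nodes x := fun I v hv => by
    obtain ⟨i, -, rfl⟩ := Finset.mem_image.1 hv
    exact hx i
  choose χ hχ using fun I => exists_nodes_eq_split x (H I)
  have h0 : nodes (χ ∅) = nodes x := by
    rw [hχ]
    simp [split]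
  exact ⟨χ, isCube_iff.2 ⟨b, hb, by rwa [h0], fun I => by rw [h0, hχ]⟩, hχ⟩

end Nodes

end Neretin

/-! ### Merging nodes -/

namespace NeretinCubes

variable {d : ℕ}

/-- The map of the forest `T ∖∖ A` that permutes the leaves of `A` by `σ` and carries along the
subtrees below them without changing labels. -/
def permuteLeaves (A : AdmTree d) (σ : Word d → Word d) : Word d → Word d
  | [] => if [] ∈ A.leaves then σ [] else []
  | i :: v => if i :: v ∈ A.leaves then σ (i :: v) else i :: permuteLeaves A σ v

theorem permuteLeaves_of_mem {A : AdmTree d} (σ : Word d → Word d) {v : Word d}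
    (hv : v ∈ A.leaves) : permuteLeaves A σ v = σ v := by
  cases v with
  | nil => exact if_pos hv
  | cons i v => exact if_pos hv

theorem permuteLeaves_cons {A : AdmTree d} (σ : Word d → Word d) {v : Word d}
    (hv : v ∉ A.interior) (i : Fin d) :
    permuteLeaves A σ (i :: v) = i :: permuteLeaves A σ v :=
  if_neg fun h => hv (AdmTree.cons_mem_leaves.1 h).1

theorem permuteLeaves_not_mem_interior {A : AdmTree d} {σ : Word d → Word d}
    (hσ : ∀ v ∈ A.leaves, σ v ∈ A.leaves) {v : Word d} (hv : v ∉ A.interior) :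
    permuteLeaves A σ v ∉ A.interior := by
  refine A.forest_induction (P := fun v => permuteLeaves A σ v ∉ A.interior) (fun v hv => ?_)
    (fun v hv ih i => ?_) v hv
  · rw [permuteLeaves_of_mem σ hv]
    exact (AdmTree.mem_leaves.1 (hσ v hv)).2
  · rw [permuteLeaves_cons σ hv]
    exact fun h => ih (AdmTree.mem_interior_of_cons h)

theorem permuteLeaves_leftInverse {A : AdmTree d} {σ τ : Word d → Word d}
    (hσ : ∀ v ∈ A.leaves, σ v ∈ A.leaves) (h : ∀ v ∈ A.leaves, τ (σ v) = v) {v : Word d}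
    (hv : v ∉ A.interior) : permuteLeaves A τ (permuteLeaves A σ v) = v := by
  refine A.forest_induction (P := fun v => permuteLeaves A τ (permuteLeaves A σ v) = v)
    (fun v hv => ?_) (fun v hv ih i => ?_) v hv
  · rw [permuteLeaves_of_mem σ hv, permuteLeaves_of_mem τ (hσ v hv), h v hv]
  · rw [permuteLeaves_cons σ hv,
      permuteLeaves_cons τ (permuteLeaves_not_mem_interior hσ hv), ih]

theorem exists_forestIso_of_perm (A : AdmTree d) (σ : Equiv.Perm {v : Word d // v ∈ A.leaves}) :
    ∃ θ : ForestIso A A, ∀ (v : Word d) (hv : v ∈ A.leaves),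
      (θ ⟨v, (AdmTree.mem_leaves.1 hv).2⟩).1 = (σ ⟨v, hv⟩).1 := by
  let s : Equiv.Perm {v : Word d // v ∈ A.leaves} → Word d → Word d :=
    fun σ v => if h : v ∈ A.leaves then (σ ⟨v, h⟩).1 else v
  have hs : ∀ σ v, v ∈ A.leaves → s σ v ∈ A.leaves := by
    intro σ v hv
    simp [s, hv]
  have hinv : ∀ σ τ : Equiv.Perm {v : Word d // v ∈ A.leaves}, (∀ v, τ (σ v) = v) →
      ∀ v ∈ A.leaves, s τ (s σ v) = v := by
    intro σ τ h v hv
    simp [s, hv, h]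
  have hrel : ∀ (σ : Equiv.Perm {v : Word d // v ∈ A.leaves}) {u v : Word d},
      u ∉ A.interior → (∃ i : Fin d, v = i :: u) →
      ∃ i : Fin d, permuteLeaves A (s σ) v = i :: permuteLeaves A (s σ) u := by
    rintro σ u _ hu ⟨i, rfl⟩
    exact ⟨i, permuteLeaves_cons _ hu i⟩
  have hli : ∀ {v : Word d}, v ∉ A.interior →
      permuteLeaves A (s σ.symm) (permuteLeaves A (s σ) v) = v := fun hv =>
    permuteLeaves_leftInverse (hs σ) (hinv σ σ.symm fun v => σ.symm_apply_apply v) hv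
  refine ⟨{ toFun := fun v => ⟨permuteLeaves A (s σ) v.1,
              permuteLeaves_not_mem_interior (hs σ) v.2⟩
            invFun := fun v => ⟨permuteLeaves A (s σ.symm) v.1,
              permuteLeaves_not_mem_interior (hs σ.symm) v.2⟩
            left_inv := fun v => Subtype.ext (hli v.2)
            right_inv := fun v => Subtype.ext (permuteLeaves_leftInverse (hs σ.symm)
              (hinv σ.symm σ fun v => σ.apply_symm_apply v) v.2)
            map_rel_iff' := fun {u v} => ⟨fun h => ?_, hrel σ u.2⟩ }, fun v hv => ?_⟩
  · have := hrel σ.symm (permuteLeaves_not_mem_interior (hs σ) u.2) h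
    rwa [Equiv.coe_fn_mk, hli u.2, hli v.2] at this
  · change permuteLeaves A (s σ) v = _
    rw [permuteLeaves_of_mem _ hv]
    simp [s, hv]

namespace AdmTree

theorem nil_mem_interior_of_mem {A : AdmTree d} {v : Word d} (h : v ∈ A.interior) :
    [] ∈ A.interior := by
  induction v with
  | nil => exact h
  | cons i v ih => exact ih (mem_interior_of_cons h)

theorem nil_mem_interior_of_one_lt {A : AdmTree d} (h : 1 < A.leaves.card) : [] ∈ A.interior := by
  obtain ⟨v, hv, hne⟩ := Finset.exists_mem_ne h []
  cases v with
  | nil => exact absurd rfl hne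
  | cons i v => exact nil_mem_interior_of_mem (cons_mem_leaves.1 hv).1

/-- An admissible subtree with at least two leaves has an interior vertex all of whose children
are leaves. -/
theorem exists_eq_expand_singleton [NeZero d] {A : AdmTree d} (h : 1 < A.leaves.card) :
    ∃ (B : AdmTree d) (b : Word d), b ∈ B.leaves ∧ A = B.expand {b} := by
  obtain ⟨b, hb, hmax⟩ := A.interior.exists_max_image List.length
    ⟨[], nil_mem_interior_of_one_lt h⟩
  have hF : ∀ (i : Fin d) (v : Word d), i :: v ∈ A.interior.erase b → v ∈ A.interior.erase b := by
    intro i v hv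
    have hv' := (Finset.mem_erase.1 hv).2
    refine Finset.mem_erase.2 ⟨?_, mem_interior_of_cons hv'⟩
    rintro rfl
    have := hmax _ hv'
    simp at this
  have hB := interior_ofInterior (A.interior.erase b) hF
  have hbB : b ∈ (ofInterior (A.interior.erase b) hF).leaves := by
    cases b with
    | nil =>
      rw [nil_mem_leaves, hB]
      simp
    | cons i b =>
      rw [cons_mem_leaves, hB]
      refine ⟨Finset.mem_erase.2 ⟨fun h => ?_, mem_interior_of_cons hb⟩, by simp⟩
      simpa using congrArg List.length h
  refine ⟨_, b, hbB, ext_interior ?_⟩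
  rw [interior_expand _ _ (Finset.singleton_subset_iff.2 hbB), hB, Finset.union_comm]
  exact (Finset.insert_erase hb).symm

end AdmTree

end NeretinCubes

namespace Neretin

variable {d : ℕ} [NeZero d]

/-- Merging the families of children of the nodes of `S`: the reverse of splitting. -/
noncomputable def merge (W S : Finset (Node d)) : Finset (Node d) := (W \ S.biUnion children) ∪ S

theorem mem_merge {W S : Finset (Node d)} {n : Node d} :
    n ∈ merge W S ↔ (n ∈ W ∧ ∀ m ∈ S, n ∉ children m) ∨ n ∈ S := by
  simp [merge]

theorem merge_split {y : Vertex d} {S : Finset (Node d)} (hS : S ⊆ nodes y) :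
    merge (split (nodes y) S) S = nodes y := by
  ext n
  rw [mem_merge, mem_split]
  constructor
  · rintro (⟨h | ⟨m, hm, hn⟩, h'⟩ | h)
    · exact h.1
    · exact absurd hn (h' m hm)
    · exact hS h
  · intro h
    by_cases hn : n ∈ S
    · exact Or.inr hn
    · exact Or.inl ⟨Or.inl ⟨h, hn⟩, fun m hm hnm =>
        Finset.disjoint_left.1 (disjoint_children_nodes (hS hm)) hnm h⟩

theorem not_mem_nodes_of_children_subset {x : Vertex d} {m : Node d}
    (hm : children m ⊆ nodes x) : m ∉ nodes x := by
  intro h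
  obtain ⟨n, hn⟩ := children_nonempty m
  exact Finset.disjoint_left.1 (disjoint_children_nodes h) hn (hm hn)

theorem not_mem_children_of_children_subset {x : Vertex d} {n m : Node d} (hn : n ∈ nodes x)
    (hm : children m ⊆ nodes x) : m ∉ children n := by
  intro h
  obtain ⟨k, hk⟩ := children_nonempty m
  exact Finset.disjoint_left.1 (disjoint_grandchildren_nodes hn h) hk (hm hk)

/-- Any `d` nodes of a vertex are the children of a node, and merging them gives a vertex: after
a permutation of the leaves they are the children of one interior vertex of the tree. -/
theorem exists_merge_of_card (hd : 2 ≤ d) (x : Vertex d) {T : Finset (Node d)}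
    (hT : T ⊆ nodes x) (hc : T.card = d) :
    ∃ (m : Node d) (y : Vertex d), children m = T ∧ m ∈ nodes y ∧
      nodes x = split (nodes y) {m} := by
  obtain ⟨A, φ, rfl⟩ := exists_vertex x
  have hA : 1 < A.leaves.card := by
    have := Finset.card_le_card hT
    rw [nodes_vertex, leafNodes, Finset.card_image_of_injective _ (node_injective φ)] at this
    omega
  obtain ⟨B, b, hb, hAB⟩ := AdmTree.exists_eq_expand_singleton hA
  -- Permute the leaves of `A` so that the sibling leaves `i :: b` are moved to those of `T`.
  have hbA : ∀ i : Fin d, i :: b ∈ A.leaves := fun i => by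
    rw [hAB]
    exact (AdmTree.mem_leaves_expand (Finset.singleton_subset_iff.2 hb)).2
      (Or.inr ⟨b, Finset.mem_singleton_self b, i, rfl⟩)
  have ht : ∀ n : T, ∃ v : {v : Word d // v ∈ A.leaves}, node v.1 φ = n.1 := fun n => by
    obtain ⟨v, hv, h⟩ := mem_leafNodes.1 (hT n.2)
    exact ⟨⟨v, hv⟩, h.symm⟩
  choose t ht using ht
  have tinj : Function.Injective t := fun n m h => Subtype.ext (by rw [← ht, ← ht, h])
  let k : Fin d → {v : Word d // v ∈ A.leaves} := fun i => ⟨i :: b, hbA i⟩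
  have kinj : Function.Injective k := fun i j h => (List.cons.inj (congrArg Subtype.val h)).1
  let e : Fin d ≃ T := (Finset.equivFinOfCardEq hc).symm
  let f : {v // v ∈ Set.range k} ≃ {v // v ∈ Set.range t} :=
    ((Equiv.ofInjective k kinj).symm.trans e).trans (Equiv.ofInjective t tinj)
  classical
  have hf : ∀ i, f.extendSubtype (k i) = t (e i) := fun i => by
    rw [Equiv.extendSubtype_apply_of_mem _ _ ⟨i, rfl⟩]
    simp only [f, Equiv.trans_apply]
    rw [Equiv.ofInjective_symm_apply]
    rfl
  obtain ⟨θ, hθ⟩ := exists_forestIso_of_perm A f.extendSubtype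
  have hchild : ∀ i : Fin d, node (i :: b) (φ * ofIso θ) = (e i).1 := fun i => by
    rw [← ht (e i), ← hf i, ← hθ _ (hbA i)]
    refine node_eq_node.2 ?_
    rw [inv_mul_cancel_left]
    exact Sends.ofIso θ ⟨i :: b, (AdmTree.mem_leaves.1 (hbA i)).2⟩
  refine ⟨node b (φ * ofIso θ), vertex B (φ * ofIso θ), ?_, node_mem_leafNodes.2 hb, ?_⟩
  · refine Finset.eq_of_subset_of_card_le (fun n hn => ?_) (by rw [hc, card_children])
    obtain ⟨i, rfl⟩ := mem_children_node.1 hn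
    rw [hchild]
    exact (e i).2
  · have h1 : vertex A φ = vertex A (φ * ofIso θ) := by
      refine (vertex_eq_vertex.2 ⟨θ, ?_⟩).symm
      rw [inv_mul_cancel_left]
    rw [h1]
    generalize φ * ofIso θ = ψ
    rw [hAB, nodes_vertex, nodes_vertex,
      leafNodes_expand _ _ (Finset.singleton_subset_iff.2 hb), Finset.image_singleton]

theorem exists_nodes_eq_merge (hd : 2 ≤ d) (x : Vertex d) (D : Finset (Node d))
    (hD : ∀ m ∈ D, children m ⊆ nodes x)
    (hdisj : ∀ m ∈ D, ∀ n ∈ D, m ≠ n → Disjoint (children m) (children n)) :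
    ∃ y, nodes y = merge (nodes x) D ∧ nodes x = split (nodes y) D := by
  induction D using Finset.induction_on with
  | empty => exact ⟨x, by simp [merge], by simp [split]⟩
  | insert m D hm ih =>
    obtain ⟨y, hy, hxy⟩ := ih (fun n hn => hD n (Finset.mem_insert_of_mem hn))
      (fun n hn k hk => hdisj n (Finset.mem_insert_of_mem hn) k (Finset.mem_insert_of_mem hk))
    have hmx := hD m (Finset.mem_insert_self m D)
    have hmn : ∀ k ∈ children m, ∀ n ∈ D, k ∉ children n := fun k hk n hn hk' =>
      Finset.disjoint_left.1 (hdisj m (Finset.mem_insert_self m D) n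
        (Finset.mem_insert_of_mem hn) fun h => hm (h ▸ hn)) hk hk'
    have hmy : children m ⊆ nodes y := by
      intro k hk
      rw [hy, mem_merge]
      exact Or.inl ⟨hmx hk, hmn k hk⟩
    obtain ⟨m', z, hm', hmz, hz⟩ := exists_merge_of_card hd y hmy (card_children m)
    obtain rfl := children_injective hm'
    have hz' : nodes z = merge (nodes y) {m'} := by
      rw [hz, merge_split (Finset.singleton_subset_iff.2 hmz)]
    have hz'' : nodes z = merge (nodes x) (insert m' D) := by
      rw [hz', hy]
      ext n
      have hnD : n ∈ D → n ∉ children m' := fun hn hnm =>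
        not_mem_nodes_of_children_subset (hD n (Finset.mem_insert_of_mem hn)) (hmx hnm)
      simp only [mem_merge, Finset.mem_insert, Finset.mem_singleton, forall_eq_or_imp, forall_eq]
      tauto
    refine ⟨z, hz'', ?_⟩
    rw [hz'']
    ext n
    simp only [mem_merge, mem_split, Finset.mem_insert]
    have h1 : n ∈ nodes x → n ∉ D ∧ n ≠ m' := fun h =>
      ⟨fun hn => not_mem_nodes_of_children_subset (hD n (Finset.mem_insert_of_mem hn)) h,
        fun hn => not_mem_nodes_of_children_subset hmx (hn ▸ h)⟩
    constructor
    · intro h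
      by_cases hn : ∃ k, (k = m' ∨ k ∈ D) ∧ n ∈ children k
      · exact Or.inr hn
      · push Not at hn
        have := h1 h
        exact Or.inl ⟨Or.inl ⟨h, hn⟩, by tauto⟩
    · rintro (⟨⟨h, -⟩ | h, h'⟩ | ⟨k, hk, h⟩)
      · exact h
      · exact absurd h h'
      · exact hD k (Finset.mem_insert.2 hk) h

end Neretin

/-! ### Cubes and links in terms of nodes -/

namespace Neretin

variable {d : ℕ} [NeZero d]

/-- The cube with vertex map `χ` is obtained from its bottom vertex by splitting the nodes `b i`. -/
structure SplitsAlong {n : ℕ} (χ : Finset (Fin n) → Vertex d) (b : Fin n → Node d) : Prop where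
  injective : Function.Injective b
  mem : ∀ i, b i ∈ nodes (χ ∅)
  nodes_eq : ∀ I, nodes (χ I) = split (nodes (χ ∅)) (I.image b)

theorem exists_splitsAlong {n : ℕ} {χ : Finset (Fin n) → Vertex d}
    (h : (cubeComplex d).IsCube χ) : ∃ b, SplitsAlong χ b := by
  obtain ⟨b, h1, h2, h3⟩ := isCube_iff.1 h
  exact ⟨b, h1, h2, h3⟩

namespace SplitsAlong

variable {n : ℕ} {χ : Finset (Fin n) → Vertex d} {b : Fin n → Node d}

theorem mem_nodes (h : SplitsAlong χ b) {I : Finset (Fin n)} {k : Node d} :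
    k ∈ nodes (χ I) ↔ (k ∈ nodes (χ ∅) ∧ ∀ i ∈ I, k ≠ b i) ∨ ∃ i ∈ I, k ∈ children (b i) := by
  rw [h.nodes_eq, mem_split]
  simp [eq_comm]

theorem not_mem_of_mem_children (h : SplitsAlong χ b) {i : Fin n} {k : Node d}
    (hk : k ∈ children (b i)) : k ∉ nodes (χ ∅) :=
  Finset.disjoint_left.1 (disjoint_children_nodes (h.mem i)) hk

theorem eq_of_mem_children (h : SplitsAlong χ b) {i j : Fin n} {k : Node d}
    (hi : k ∈ children (b i)) (hj : k ∈ children (b j)) : i = j := by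
  by_contra hij
  exact Finset.disjoint_left.1 (disjoint_children_children (h.mem i) (h.mem j)
    fun e => hij (h.injective e)) hi hj

theorem not_mem_children (h : SplitsAlong χ b) (i j : Fin n) : b i ∉ children (b j) :=
  fun hk => h.not_mem_of_mem_children hk (h.mem i)

theorem mem_nodes_of_not_mem (h : SplitsAlong χ b) {B : Finset (Fin n)} {i : Fin n} (hi : i ∉ B) :
    b i ∈ nodes (χ B) :=
  h.mem_nodes.2 (Or.inl ⟨h.mem i, fun _ hj e => hi (h.injective e ▸ hj)⟩)

theorem not_mem_nodes_of_mem (h : SplitsAlong χ b) {B : Finset (Fin n)} {i : Fin n} (hi : i ∈ B) :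
    b i ∉ nodes (χ B) := by
  rw [h.mem_nodes]
  rintro (⟨-, h'⟩ | ⟨j, -, h'⟩)
  · exact h' i hi rfl
  · exact h.not_mem_children i j h'

theorem children_subset_of_mem (h : SplitsAlong χ b) {B : Finset (Fin n)} {i : Fin n}
    (hi : i ∈ B) : children (b i) ⊆ nodes (χ B) :=
  fun _ hk => h.mem_nodes.2 (Or.inr ⟨i, hi, hk⟩)

theorem disjoint_children (h : SplitsAlong χ b) {i j : Fin n} (hij : i ≠ j) :
    Disjoint (children (b i)) (children (b j)) :=
  Finset.disjoint_left.2 fun _ hi hj => hij (h.eq_of_mem_children hi hj)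

/-- The vertices of a cube, as seen from one of its vertices `χ B`. -/
theorem mem_nodes_iff (h : SplitsAlong χ b) (B I : Finset (Fin n)) {k : Node d} :
    k ∈ nodes (χ I) ↔ (k ∈ nodes (χ B) ∧ (∀ i ∈ I \ B, k ≠ b i) ∧
      ∀ i ∈ B \ I, k ∉ children (b i)) ∨ (∃ i ∈ I \ B, k ∈ children (b i)) ∨
      ∃ i ∈ B \ I, k = b i := by
  simp only [h.mem_nodes (I := I), h.mem_nodes (I := B), Finset.mem_sdiff]
  constructor
  · rintro (⟨hk, hI⟩ | ⟨i, hi, hk⟩)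
    · by_cases hB : ∃ i ∈ B, k = b i
      · obtain ⟨i, hi, rfl⟩ := hB
        exact Or.inr (Or.inr ⟨i, ⟨hi, fun hi' => hI i hi' rfl⟩, rfl⟩)
      · push Not at hB
        exact Or.inl ⟨Or.inl ⟨hk, hB⟩, fun i hi => hI i hi.1,
          fun i _ hki => h.not_mem_of_mem_children hki hk⟩
    · by_cases hB : i ∈ B
      · refine Or.inl ⟨Or.inr ⟨i, hB, hk⟩, ?_, ?_⟩
        · rintro j - rfl
          exact h.not_mem_children j i hk
        · rintro j ⟨-, hj⟩ hkj
          exact hj (h.eq_of_mem_children hk hkj ▸ hi)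
      · exact Or.inr (Or.inl ⟨i, ⟨hi, hB⟩, hk⟩)
  · rintro (⟨⟨hk, hB⟩ | ⟨i, hi, hk⟩, h1, h2⟩ | ⟨i, hi, hk⟩ | ⟨i, hi, rfl⟩)
    · refine Or.inl ⟨hk, fun i hi hki => ?_⟩
      exact h1 i ⟨hi, fun hiB => hB i hiB hki⟩ hki
    · refine Or.inr ⟨i, ?_, hk⟩
      by_contra hI
      exact h2 i ⟨hi, hI⟩ hk
    · exact Or.inr ⟨i, hi.1, hk⟩
    · refine Or.inl ⟨h.mem i, fun j hj hij => hi.2 (h.injective hij ▸ hj)⟩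

theorem nodes_insert (h : SplitsAlong χ b) {B : Finset (Fin n)} {i : Fin n} (hi : i ∉ B) :
    nodes (χ (symmDiff B {i})) = split (nodes (χ B)) {b i} := by
  have h1 : symmDiff B {i} \ B = {i} := by
    ext j
    have : j = i → j ∉ B := by rintro rfl; exact hi
    simp only [Finset.mem_sdiff, Finset.mem_symmDiff, Finset.mem_singleton]
    tauto
  have h2 : B \ symmDiff B {i} = ∅ := by
    ext j
    have : j = i → j ∉ B := by rintro rfl; exact hi
    simp only [Finset.mem_sdiff, Finset.mem_symmDiff, Finset.mem_singleton, Finset.notMem_empty]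
    tauto
  ext k
  rw [h.mem_nodes_iff B, mem_split, h1, h2]
  simp

theorem nodes_erase (h : SplitsAlong χ b) {B : Finset (Fin n)} {i : Fin n} (hi : i ∈ B) :
    nodes (χ (symmDiff B {i})) = merge (nodes (χ B)) {b i} := by
  have h1 : symmDiff B {i} \ B = ∅ := by
    ext j
    have : j = i → j ∈ B := by rintro rfl; exact hi
    simp only [Finset.mem_sdiff, Finset.mem_symmDiff, Finset.mem_singleton, Finset.notMem_empty]
    tauto
  have h2 : B \ symmDiff B {i} = {i} := by
    ext j
    have : j = i → j ∈ B := by rintro rfl; exact hi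
    simp only [Finset.mem_sdiff, Finset.mem_symmDiff, Finset.mem_singleton]
    tauto
  ext k
  rw [h.mem_nodes_iff B, mem_merge, h1, h2]
  simp

end SplitsAlong

/-- The result of splitting the nodes in `P` and merging the families of children of the nodes in
`Q`. The vertices of a cube through `x` arise in this way from the nodes `W` of `x`. -/
noncomputable def move (W P Q : Finset (Node d)) : Finset (Node d) :=
  ((W \ P) \ Q.biUnion children) ∪ (P.biUnion children ∪ Q)

theorem mem_move {W P Q : Finset (Node d)} {k : Node d} :
    k ∈ move W P Q ↔ (k ∈ W ∧ k ∉ P ∧ ∀ m ∈ Q, k ∉ children m) ∨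
      (∃ m ∈ P, k ∈ children m) ∨ k ∈ Q := by
  simp [move, and_assoc]

theorem SplitsAlong.nodes_eq_move {n : ℕ} {χ : Finset (Fin n) → Vertex d} {b : Fin n → Node d}
    (h : SplitsAlong χ b) (B I : Finset (Fin n)) :
    nodes (χ I) = move (nodes (χ B)) ((I \ B).image b) ((B \ I).image b) := by
  ext k
  rw [h.mem_nodes_iff B I, mem_move]
  simp only [Finset.mem_image, not_exists, not_and, exists_exists_and_eq_and, forall_exists_index,
    and_imp, forall_apply_eq_imp_iff₂, eq_comm (a := k), ne_eq]

/-- A move between two vertices determines the nodes that are split and those that arise by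
merging. -/
theorem move_injective {x : Vertex d} {P P' Q Q' : Finset (Node d)} (hP : P ⊆ nodes x)
    (hP' : P' ⊆ nodes x) (hQ : ∀ m ∈ Q, children m ⊆ nodes x)
    (hQ' : ∀ m ∈ Q', children m ⊆ nodes x) (hPQ : ∀ m ∈ Q, Disjoint (children m) P)
    (hPQ' : ∀ m ∈ Q', Disjoint (children m) P')
    (h : move (nodes x) P Q = move (nodes x) P' Q') : P = P' ∧ Q = Q' := by
  have key : ∀ {P P' Q Q' : Finset (Node d)}, P' ⊆ nodes x → (∀ m ∈ Q, children m ⊆ nodes x) →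
      move (nodes x) P Q = move (nodes x) P' Q' → Q ⊆ Q' := by
    intro P P' Q Q' hP' hQ h m hm
    have h1 : m ∈ move (nodes x) P' Q' := h ▸ mem_move.2 (Or.inr (Or.inr hm))
    rcases mem_move.1 h1 with h1 | ⟨k, hk, h1⟩ | h1
    · exact absurd h1.1 (not_mem_nodes_of_children_subset (hQ m hm))
    · exact absurd h1 (not_mem_children_of_children_subset (hP' hk) (hQ m hm))
    · exact h1
  obtain rfl : Q = Q' := (key hP' hQ h).antisymm (key hP hQ' h.symm)
  have key' : ∀ {P P' : Finset (Node d)}, P ⊆ nodes x → P' ⊆ nodes x →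
      (∀ m ∈ Q, Disjoint (children m) P) →
      move (nodes x) P Q = move (nodes x) P' Q → P ⊆ P' := by
    intro P P' hP hP' hPQ h k hk
    by_contra hk'
    have h1 : k ∈ move (nodes x) P' Q := mem_move.2 (Or.inl ⟨hP hk, hk', fun m hm hkm =>
      Finset.disjoint_left.1 (hPQ m hm) hkm hk⟩)
    rw [← h] at h1
    rcases mem_move.1 h1 with h1 | ⟨m, hm, h1⟩ | h1
    · exact h1.2.1 hk
    · exact Finset.disjoint_left.1 (disjoint_children_nodes (hP hm)) h1 (hP hk)
    · exact not_mem_nodes_of_children_subset (hQ k h1) (hP hk)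
  exact ⟨(key' hP hP' hPQ h).antisymm (key' hP' hP hPQ' h.symm), rfl⟩

namespace SplitsAlong

variable {n : ℕ} {χ : Finset (Fin n) → Vertex d} {b : Fin n → Node d}

theorem image_subset_nodes (h : SplitsAlong χ b) (B I : Finset (Fin n)) :
    (I \ B).image b ⊆ nodes (χ B) := by
  intro k hk
  obtain ⟨i, hi, rfl⟩ := Finset.mem_image.1 hk
  exact h.mem_nodes_of_not_mem (Finset.mem_sdiff.1 hi).2

theorem children_subset_nodes (h : SplitsAlong χ b) (B I : Finset (Fin n)) :
    ∀ m ∈ (B \ I).image b, children m ⊆ nodes (χ B) := by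
  intro k hk
  obtain ⟨i, hi, rfl⟩ := Finset.mem_image.1 hk
  exact h.children_subset_of_mem (Finset.mem_sdiff.1 hi).1

theorem disjoint_children_image (h : SplitsAlong χ b) (I J : Finset (Fin n)) :
    ∀ m ∈ I.image b, Disjoint (children m) (J.image b) := by
  intro k hk
  obtain ⟨i, -, rfl⟩ := Finset.mem_image.1 hk
  rw [Finset.disjoint_right]
  intro m hm
  obtain ⟨j, -, rfl⟩ := Finset.mem_image.1 hm
  exact h.not_mem_children j i

theorem vertexMap_injective (h : SplitsAlong χ b) : Function.Injective χ := by
  intro I J hIJ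
  have key : ∀ {I J : Finset (Fin n)}, χ I = χ J → I ⊆ J := by
    intro I J hIJ i hi
    by_contra hJ
    exact h.not_mem_nodes_of_mem hi (hIJ ▸ h.mem_nodes_of_not_mem hJ)
  exact (key hIJ).antisymm (key hIJ.symm)

end SplitsAlong

/-- Two cubes with a common vertex meet in a face: seen from that vertex, the common vertices are
those reached by splitting and merging nodes that both cubes split or merge. -/
theorem isFace_inter {n n' : ℕ} {χ : Finset (Fin n) → Vertex d} {χ' : Finset (Fin n') → Vertex d}
    (h : (cubeComplex d).IsCube χ) (h' : (cubeComplex d).IsCube χ')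
    (hx : (range χ ∩ range χ').Nonempty) :
    CubeFamily.IsFace χ (range χ ∩ range χ') := by
  obtain ⟨b, hb⟩ := exists_splitsAlong h
  obtain ⟨b', hb'⟩ := exists_splitsAlong h'
  obtain ⟨x, ⟨B, rfl⟩, B', hB⟩ := hx
  classical
  let J : Finset (Fin n) := Finset.univ.filter fun i =>
    (i ∈ B ∧ ∃ j ∈ B', b' j = b i) ∨ (i ∉ B ∧ ∃ j, j ∉ B' ∧ b' j = b i)
  have hJ : ∀ i, i ∈ J ↔ (i ∈ B ∧ ∃ j ∈ B', b' j = b i) ∨ (i ∉ B ∧ ∃ j, j ∉ B' ∧ b' j = b i) :=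
    fun i => by simp [J]
  have key : ∀ I, χ I ∈ range χ' ↔ symmDiff I B ⊆ J := by
    intro I
    constructor
    · rintro ⟨I', hI'⟩
      have e := hb.nodes_eq_move B I
      rw [← hI', hb'.nodes_eq_move B' I', hB] at e
      obtain ⟨e1, e2⟩ := move_injective (by rw [← hB]; exact hb'.image_subset_nodes B' I')
        (hb.image_subset_nodes B I) (by rw [← hB]; exact hb'.children_subset_nodes B' I')
        (hb.children_subset_nodes B I) (hb'.disjoint_children_image _ _)
        (hb.disjoint_children_image _ _) e
      intro i hi
      rw [hJ]
      rcases Finset.mem_symmDiff.1 hi with ⟨hi, hiB⟩ | ⟨hiB, hi⟩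
      · have := Finset.mem_image_of_mem b (Finset.mem_sdiff.2 ⟨hi, hiB⟩)
        rw [← e1] at this
        obtain ⟨j, hj, hji⟩ := Finset.mem_image.1 this
        exact Or.inr ⟨hiB, j, (Finset.mem_sdiff.1 hj).2, hji⟩
      · have := Finset.mem_image_of_mem b (Finset.mem_sdiff.2 ⟨hiB, hi⟩)
        rw [← e2] at this
        obtain ⟨j, hj, hji⟩ := Finset.mem_image.1 this
        exact Or.inl ⟨hiB, j, (Finset.mem_sdiff.1 hj).1, hji⟩
    · intro hI
      let I' : Finset (Fin n') := Finset.univ.filter fun j =>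
        (j ∈ B' ∧ ¬ ∃ i ∈ B \ I, b' j = b i) ∨ (j ∉ B' ∧ ∃ i ∈ I \ B, b' j = b i)
      have hI' : ∀ j, j ∈ I' ↔
          (j ∈ B' ∧ ¬ ∃ i ∈ B \ I, b' j = b i) ∨ (j ∉ B' ∧ ∃ i ∈ I \ B, b' j = b i) :=
        fun i => by simp [I']
      refine ⟨I', nodes_injective ?_⟩
      rw [hb.nodes_eq_move B I, hb'.nodes_eq_move B' I', hB]
      congr 1
      · ext k
        simp only [Finset.mem_image, Finset.mem_sdiff, hI']
        constructor
        · rintro ⟨j, ⟨⟨hj, -⟩ | ⟨-, i, hi, hji⟩, hj'⟩, rfl⟩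
          · exact absurd hj hj'
          · exact ⟨i, hi, hji.symm⟩
        · rintro ⟨i, hi, rfl⟩
          rcases (hJ i).1 (hI (Finset.mem_symmDiff.2 (Or.inl hi))) with h1 | ⟨-, j, hj, hji⟩
          · exact absurd h1.1 hi.2
          · exact ⟨j, ⟨Or.inr ⟨hj, i, hi, hji⟩, hj⟩, hji⟩
      · ext k
        simp only [Finset.mem_image, Finset.mem_sdiff, hI']
        constructor
        · rintro ⟨j, ⟨hj, hj'⟩, rfl⟩
          have : ∃ i ∈ B \ I, b' j = b i := by
            by_contra hc
            exact hj' (Or.inl ⟨hj, by simpa using hc⟩)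
          obtain ⟨i, hi, hji⟩ := this
          exact ⟨i, Finset.mem_sdiff.1 hi, hji.symm⟩
        · rintro ⟨i, hi, rfl⟩
          rcases (hJ i).1 (hI (Finset.mem_symmDiff.2 (Or.inr hi))) with ⟨-, j, hj, hji⟩ | h1
          · refine ⟨j, ⟨hj, ?_⟩, hji⟩
            rintro (⟨-, hc⟩ | ⟨hc, -⟩)
            · exact hc ⟨i, hi, hji⟩
            · exact hc hj
          · exact absurd hi.1 h1.1
  refine ⟨B \ J, J, Finset.sdiff_disjoint, ?_⟩
  ext v
  constructor
  · rintro ⟨⟨I, rfl⟩, hv⟩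
    have hI := (key I).1 hv
    refine ⟨I ∩ J, Finset.inter_subset_right, congrArg χ ?_⟩
    ext i
    have := @hI i
    simp only [Finset.mem_symmDiff] at this
    simp only [Finset.mem_union, Finset.mem_sdiff, Finset.mem_inter]
    tauto
  · rintro ⟨I, hI, rfl⟩
    refine ⟨⟨_, rfl⟩, (key _).2 ?_⟩
    intro i hi
    have := @hI i
    simp only [Finset.mem_symmDiff, Finset.mem_union, Finset.mem_sdiff] at hi
    tauto

theorem isCubeComplex : (cubeComplex d).IsCubeComplex where
  vertex v := isCube_iff.2 ⟨Fin.elim0, fun i => i.elim0, fun i => i.elim0, fun I => by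
    rw [Finset.eq_empty_of_isEmpty I]
    simp [split]⟩
  injective h := by
    obtain ⟨b, hb⟩ := exists_splitsAlong h
    exact hb.vertexMap_injective
  face := by
    rintro n χ h F ⟨B, J, hBJ, rfl⟩
    obtain ⟨b, hb⟩ := exists_splitsAlong h
    let e : Fin J.card ≃ J := J.equivFin.symm
    have he : Function.Injective fun i => (e i).1 := Subtype.val_injective.comp e.injective
    have hJB : ∀ i : Fin J.card, (e i).1 ∉ B := fun i => Finset.disjoint_right.1 hBJ (e i).2
    refine ⟨J.card, fun I => χ (B ∪ I.image fun i => (e i).1),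
      isCube_iff.2 ⟨fun i => b (e i).1, hb.injective.comp he, fun i => ?_, fun I => ?_⟩, ?_⟩
    · simpa using hb.mem_nodes_of_not_mem (hJB i)
    · rw [hb.nodes_eq_move B]
      have h1 : (B ∪ I.image fun i => (e i).1) \ B = I.image fun i => (e i).1 := by
        ext j
        simp only [Finset.mem_sdiff, Finset.mem_union, Finset.mem_image]
        constructor
        · tauto
        · rintro ⟨i, hi, rfl⟩
          exact ⟨Or.inr ⟨i, hi, rfl⟩, hJB i⟩
      have h2 : B \ (B ∪ I.image fun i => (e i).1) = ∅ := by
        rw [Finset.sdiff_eq_empty_iff_subset]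
        exact Finset.subset_union_left
      rw [h1, h2, Finset.image_image]
      simp [move, split, Function.comp_def]
    · ext v
      constructor
      · rintro ⟨I, rfl⟩
        refine ⟨_, fun j hj => ?_, rfl⟩
        obtain ⟨i, -, rfl⟩ := Finset.mem_image.1 hj
        exact (e i).2
      · rintro ⟨I, hI, rfl⟩
        refine ⟨Finset.univ.filter fun i => (e i).1 ∈ I, ?_⟩
        change χ _ = χ _
        congr 2
        ext j
        simp only [Finset.mem_image, Finset.mem_filter, Finset.mem_univ, true_and]
        constructor
        · rintro ⟨i, hi, rfl⟩
          exact hi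
        · intro hj
          exact ⟨e.symm ⟨j, hI hj⟩, by simpa using hj, by simp⟩
  inter h h' hx := ⟨isFace_inter h h' hx, by
    rw [inter_comm] at hx ⊢
    exact isFace_inter h' h hx⟩

/-- A cube through `x` is determined by the set of nodes of `x` it splits and the set of families
of nodes of `x` it merges. -/
theorem locallyFinite : (cubeComplex d).LocallyFinite := by
  intro x
  have hfin : {m : Node d | children m ⊆ nodes x}.Finite :=
    Set.Finite.preimage (f := children) children_injective.injOn
      ((nodes x).powerset.finite_toSet.subset fun s hs => Finset.mem_powerset.2 hs)
  let G : Finset (Node d) × Finset (Node d) → Set (Vertex d) := fun PQ =>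
    {y | ∃ P ⊆ PQ.1, ∃ Q ⊆ PQ.2, nodes y = move (nodes x) P Q}
  refine (((nodes x).powerset ×ˢ hfin.toFinset.powerset).finite_toSet.image G).subset ?_
  rintro F ⟨hx, n, χ, hχ, rfl⟩
  obtain ⟨b, hb⟩ := exists_splitsAlong hχ
  obtain ⟨B, rfl⟩ := hx
  refine ⟨((Finset.univ \ B).image b, B.image b), ?_, ?_⟩
  · rw [Finset.mem_coe, Finset.mem_product, Finset.mem_powerset, Finset.mem_powerset]
    refine ⟨hb.image_subset_nodes B _, fun m hm => ?_⟩
    rw [Set.Finite.mem_toFinset]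
    obtain ⟨i, hi, rfl⟩ := Finset.mem_image.1 hm
    exact hb.children_subset_of_mem hi
  · ext y
    constructor
    · rintro ⟨P, hP, Q, hQ, hy⟩
      refine ⟨Finset.univ.filter fun i => (i ∈ B ∧ b i ∉ Q) ∨ (i ∉ B ∧ b i ∈ P),
        nodes_injective ?_⟩
      rw [hb.nodes_eq_move B, hy]
      congr 1
      · ext k
        simp only [Finset.mem_image, Finset.mem_sdiff, Finset.mem_filter, Finset.mem_univ,
          true_and]
        constructor
        · rintro ⟨i, ⟨hi, hiB⟩, rfl⟩
          tauto
        · intro hk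
          obtain ⟨i, hi, rfl⟩ := Finset.mem_image.1 (hP hk)
          have := (Finset.mem_sdiff.1 hi).2
          exact ⟨i, ⟨Or.inr ⟨this, hk⟩, this⟩, rfl⟩
      · ext k
        simp only [Finset.mem_image, Finset.mem_sdiff, Finset.mem_filter, Finset.mem_univ,
          true_and]
        constructor
        · rintro ⟨i, ⟨hi, hiB⟩, rfl⟩
          tauto
        · intro hk
          obtain ⟨i, hi, rfl⟩ := Finset.mem_image.1 (hQ hk)
          exact ⟨i, ⟨hi, by tauto⟩, rfl⟩
    · rintro ⟨I, rfl⟩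
      exact ⟨_, Finset.image_subset_image (Finset.sdiff_subset_sdiff (Finset.subset_univ _)
        le_rfl), _, Finset.image_subset_image Finset.sdiff_subset, hb.nodes_eq_move B I⟩

/-! ### Links -/

theorem mem_link_iff (hd : 2 ≤ d) {x : Vertex d} {σ : Finset (Vertex d)} :
    σ ∈ (cubeComplex d).link x ↔ ∃ U D : Finset (Node d), U ⊆ nodes x ∧
      (∀ m ∈ D, children m ⊆ nodes x) ∧
      (∀ m ∈ D, ∀ n ∈ D, m ≠ n → Disjoint (children m) (children n)) ∧
      (∀ m ∈ D, Disjoint (children m) U) ∧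
      ∀ y, y ∈ σ ↔ (∃ u ∈ U, nodes y = split (nodes x) {u}) ∨
        ∃ m ∈ D, nodes y = merge (nodes x) {m} := by
  constructor
  · rintro ⟨n, χ, B, hχ, rfl, hσ⟩
    obtain ⟨b, hb⟩ := exists_splitsAlong hχ
    refine ⟨(Finset.univ \ B).image b, B.image b, hb.image_subset_nodes B _, fun m hm => ?_,
      fun m hm m' hm' hmm' => ?_, hb.disjoint_children_image _ _, fun y => ?_⟩
    · obtain ⟨i, hi, rfl⟩ := Finset.mem_image.1 hm
      exact hb.children_subset_of_mem hi
    · obtain ⟨i, hi, rfl⟩ := Finset.mem_image.1 hm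
      obtain ⟨j, hj, rfl⟩ := Finset.mem_image.1 hm'
      exact hb.disjoint_children fun h => hmm' (by rw [h])
    · rw [hσ]
      constructor
      · rintro ⟨i, rfl⟩
        by_cases hi : i ∈ B
        · exact Or.inr ⟨b i, Finset.mem_image_of_mem b hi, hb.nodes_erase hi⟩
        · exact Or.inl ⟨b i, Finset.mem_image_of_mem b (by simpa using hi), hb.nodes_insert hi⟩
      · rintro (⟨u, hu, hy⟩ | ⟨m, hm, hy⟩)
        · obtain ⟨i, hi, rfl⟩ := Finset.mem_image.1 hu
          exact ⟨i, nodes_injective (hy.trans (hb.nodes_insert (Finset.mem_sdiff.1 hi).2).symm)⟩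
        · obtain ⟨i, hi, rfl⟩ := Finset.mem_image.1 hm
          exact ⟨i, nodes_injective (hy.trans (hb.nodes_erase hi).symm)⟩
  · rintro ⟨U, D, hU, hD, hDD, hDU, hσ⟩
    obtain ⟨w, hw, hxw⟩ := exists_nodes_eq_merge hd x D hD hDD
    let e : Fin (D ∪ U).card ≃ (D ∪ U : Finset (Node d)) := (D ∪ U).equivFin.symm
    let b : Fin (D ∪ U).card → Node d := fun i => (e i).1
    have hbinj : Function.Injective b := Subtype.val_injective.comp e.injective
    have hbmem : ∀ i, b i ∈ nodes w := by
      intro i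
      rw [hw, mem_merge]
      rcases Finset.mem_union.1 (e i).2 with h | h
      · exact Or.inr h
      · exact Or.inl ⟨hU h, fun m hm hk => Finset.disjoint_left.1 (hDU m hm) hk h⟩
    obtain ⟨χ, hχ, hχn⟩ := exists_isCube w hbinj hbmem
    have h0 : χ ∅ = w := nodes_injective (by rw [hχn]; simp [split])
    have hb : SplitsAlong χ b := ⟨hbinj, by rwa [h0], by rwa [h0]⟩
    have hsurj : ∀ m ∈ D ∪ U, ∃ i, b i = m := fun m hm => ⟨e.symm ⟨m, hm⟩, by simp [b]⟩
    let B : Finset (Fin (D ∪ U).card) := Finset.univ.filter fun i => b i ∈ D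
    have hB : ∀ i, i ∈ B ↔ b i ∈ D := fun i => by simp [B]
    have hBD : B.image b = D := by
      ext m
      rw [Finset.mem_image]
      constructor
      · rintro ⟨i, hi, rfl⟩
        exact (hB i).1 hi
      · intro hm
        obtain ⟨i, rfl⟩ := hsurj m (Finset.mem_union_left _ hm)
        exact ⟨i, (hB i).2 hm, rfl⟩
    have hx : χ B = x := nodes_injective (by rw [hχn, hBD, hxw])
    refine ⟨_, χ, B, hχ, hx, fun y => ?_⟩
    rw [hσ, ← hx]
    constructor
    · rintro (⟨u, hu, hy⟩ | ⟨m, hm, hy⟩)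
      · obtain ⟨i, rfl⟩ := hsurj u (Finset.mem_union_right _ hu)
        have hi : i ∉ B := fun hi =>
          not_mem_nodes_of_children_subset (hD _ ((hB i).1 hi)) (hU hu)
        exact ⟨i, nodes_injective (hy.trans (hb.nodes_insert hi).symm)⟩
      · obtain ⟨i, rfl⟩ := hsurj m (Finset.mem_union_left _ hm)
        exact ⟨i, nodes_injective (hy.trans (hb.nodes_erase ((hB i).2 hm)).symm)⟩
    · rintro ⟨i, rfl⟩
      by_cases hi : i ∈ B
      · exact Or.inr ⟨b i, (hB i).1 hi, hb.nodes_erase hi⟩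
      · refine Or.inl ⟨b i, ?_, hb.nodes_insert hi⟩
        rcases Finset.mem_union.1 (e i).2 with h | h
        · exact absurd ((hB i).2 h) hi
        · exact h

theorem sdiff_split_singleton {x : Vertex d} {u : Node d} (hu : u ∈ nodes x) :
    nodes x \ split (nodes x) {u} = {u} := by
  ext k
  have h1 : k ∈ nodes x → k ∉ children u := fun hk hk' =>
    Finset.disjoint_left.1 (disjoint_children_nodes hu) hk' hk
  simp only [Finset.mem_sdiff, mem_split, Finset.mem_singleton, exists_eq_left]
  constructor
  · tauto
  · rintro rfl
    tauto

theorem sdiff_merge_singleton {x : Vertex d} {m : Node d} (hm : children m ⊆ nodes x) :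
    nodes x \ merge (nodes x) {m} = children m := by
  ext k
  have h1 : k ∈ children m → k ∈ nodes x ∧ k ≠ m := fun hk => ⟨hm hk, fun h =>
    not_mem_nodes_of_children_subset hm (h ▸ hm hk)⟩
  simp only [Finset.mem_sdiff, mem_merge, Finset.mem_singleton, forall_eq]
  tauto

theorem split_singleton_injective {x : Vertex d} {u u' : Node d} (hu : u ∈ nodes x)
    (hu' : u' ∈ nodes x) (h : split (nodes x) {u} = split (nodes x) {u'}) : u = u' := by
  have := sdiff_split_singleton hu
  rw [h, sdiff_split_singleton hu'] at this
  exact (Finset.singleton_injective this).symm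

theorem merge_singleton_injective {x : Vertex d} {m m' : Node d} (hm : children m ⊆ nodes x)
    (hm' : children m' ⊆ nodes x) (h : merge (nodes x) {m} = merge (nodes x) {m'}) : m = m' := by
  have := sdiff_merge_singleton hm
  rw [h, sdiff_merge_singleton hm'] at this
  exact (children_injective this).symm

theorem split_ne_merge (hd : 2 ≤ d) {x : Vertex d} {u m : Node d} (hu : u ∈ nodes x)
    (hm : children m ⊆ nodes x) : split (nodes x) {u} ≠ merge (nodes x) {m} := by
  intro h
  have := sdiff_split_singleton hu
  rw [h, sdiff_merge_singleton hm] at this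
  have := congrArg Finset.card this
  rw [card_children, Finset.card_singleton] at this
  omega

/-- A simplex of the link is a set of splittings and mergings of pairwise disjoint sets of nodes,
so pairwise compatibility suffices. -/
theorem link_flag (hd : 2 ≤ d) (x : Vertex d) (σ : Finset (Vertex d))
    (h₁ : ∀ y ∈ σ, {y} ∈ (cubeComplex d).link x)
    (h₂ : ∀ y ∈ σ, ∀ z ∈ σ, y ≠ z → ∃ τ ∈ (cubeComplex d).link x, (τ : Set (Vertex d)) = {y, z}) :
    σ ∈ (cubeComplex d).link x := by
  classical
  let U : Finset (Node d) := (nodes x).filter fun u => ∃ y ∈ σ, nodes y = split (nodes x) {u}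
  let D : Finset (Node d) := (σ.biUnion nodes).filter fun m => children m ⊆ nodes x ∧
    ∃ y ∈ σ, nodes y = merge (nodes x) {m}
  have hU : ∀ u, u ∈ U ↔ u ∈ nodes x ∧ ∃ y ∈ σ, nodes y = split (nodes x) {u} :=
    fun u => Finset.mem_filter
  have hD : ∀ m, m ∈ D ↔ children m ⊆ nodes x ∧ ∃ y ∈ σ, nodes y = merge (nodes x) {m} := by
    intro m
    rw [Finset.mem_filter, Finset.mem_biUnion, and_iff_right_iff_imp]
    rintro ⟨-, y, hy, h⟩
    refine ⟨y, hy, ?_⟩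
    rw [h, mem_merge]
    simp
  refine (mem_link_iff hd).2 ⟨U, D, Finset.filter_subset _ _, fun m hm => ((hD m).1 hm).1, ?_, ?_,
    fun y => ⟨fun hy => ?_, ?_⟩⟩
  · intro m hm n hn hmn
    obtain ⟨hmx, y, hy, hym⟩ := (hD m).1 hm
    obtain ⟨hnx, z, hz, hzn⟩ := (hD n).1 hn
    have hyz : y ≠ z := by
      rintro rfl
      exact hmn (merge_singleton_injective hmx hnx (hym.symm.trans hzn))
    obtain ⟨τ, hτ, hτyz⟩ := h₂ y hy z hz hyz
    obtain ⟨U', D', hU', hD', hDD', -, hτ'⟩ := (mem_link_iff hd).1 hτ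
    have key : ∀ {k y}, y ∈ τ → children k ⊆ nodes x → nodes y = merge (nodes x) {k} → k ∈ D' := by
      intro k y hy hk hyk
      rcases (hτ' y).1 hy with ⟨u, hu, h⟩ | ⟨m, hm, h⟩
      · exact absurd (h.symm.trans hyk) (split_ne_merge hd (hU' hu) hk)
      · rwa [merge_singleton_injective hk (hD' m hm) (hyk.symm.trans h)]
    have hyτ : y ∈ τ := by rw [← Finset.mem_coe, hτyz]; simp
    have hzτ : z ∈ τ := by rw [← Finset.mem_coe, hτyz]; simp
    exact hDD' m (key hyτ hmx hym) n (key hzτ hnx hzn) hmn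
  · intro m hm
    rw [Finset.disjoint_right]
    intro u hu
    obtain ⟨hmx, y, hy, hym⟩ := (hD m).1 hm
    obtain ⟨hux, z, hz, hzu⟩ := (hU u).1 hu
    have hyz : y ≠ z := by
      rintro rfl
      exact split_ne_merge hd hux hmx (hzu.symm.trans hym)
    obtain ⟨τ, hτ, hτyz⟩ := h₂ y hy z hz hyz
    obtain ⟨U', D', hU', hD', -, hDU', hτ'⟩ := (mem_link_iff hd).1 hτ
    have hyτ : y ∈ τ := by rw [← Finset.mem_coe, hτyz]; simp
    have hzτ : z ∈ τ := by rw [← Finset.mem_coe, hτyz]; simp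
    have hm' : m ∈ D' := by
      rcases (hτ' y).1 hyτ with ⟨u, hu, h⟩ | ⟨k, hk, h⟩
      · exact absurd (h.symm.trans hym) (split_ne_merge hd (hU' hu) hmx)
      · rwa [merge_singleton_injective hmx (hD' k hk) (hym.symm.trans h)]
    have hu' : u ∈ U' := by
      rcases (hτ' z).1 hzτ with ⟨k, hk, h⟩ | ⟨k, hk, h⟩
      · rwa [split_singleton_injective hux (hU' hk) (hzu.symm.trans h)]
      · exact absurd (hzu.symm.trans h) (split_ne_merge hd hux (hD' k hk))
    exact Finset.disjoint_right.1 (hDU' m hm') hu'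
  · obtain ⟨U', D', hU', hD', -, -, hy'⟩ := (mem_link_iff hd).1 (h₁ y hy)
    rcases (hy' y).1 (Finset.mem_singleton_self y) with ⟨u, hu, h⟩ | ⟨m, hm, h⟩
    · exact Or.inl ⟨u, (hU u).2 ⟨hU' hu, y, hy, h⟩, h⟩
    · exact Or.inr ⟨m, (hD m).2 ⟨hD' m hm, y, hy, h⟩, h⟩
  · rintro (⟨u, hu, h⟩ | ⟨m, hm, h⟩)
    · obtain ⟨-, z, hz, hzu⟩ := (hU u).1 hu
      rwa [nodes_injective (h.trans hzu.symm)]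
    · obtain ⟨-, z, hz, hzm⟩ := (hD m).1 hm
      rwa [nodes_injective (h.trans hzm.symm)]

theorem card_split_singleton {x : Vertex d} {u : Node d} (hu : u ∈ nodes x) :
    (split (nodes x) {u}).card + 1 = (nodes x).card + d := by
  rw [split, Finset.singleton_biUnion, Finset.card_union_of_disjoint, card_children,
    Finset.card_sdiff_of_subset (Finset.singleton_subset_iff.2 hu), Finset.card_singleton]
  · have := Finset.card_pos.2 ⟨u, hu⟩
    omega
  · exact (disjoint_children_nodes hu).symm.mono_left Finset.sdiff_subset

theorem card_merge_singleton {x : Vertex d} {m : Node d} (hm : children m ⊆ nodes x) :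
    (merge (nodes x) {m}).card + d = (nodes x).card + 1 := by
  rw [merge, Finset.singleton_biUnion, Finset.card_union_of_disjoint,
    Finset.card_sdiff_of_subset hm, Finset.card_singleton, card_children]
  · have := Finset.card_le_card hm
    rw [card_children] at this
    omega
  · rw [Finset.disjoint_singleton_right]
    exact fun h => not_mem_nodes_of_children_subset hm (Finset.mem_sdiff.1 h).1

theorem mem_descendingLink_iff (hd : 2 ≤ d) {x : Vertex d} {σ : Finset (Vertex d)} :
    σ ∈ descendingLink x ↔ ∃ D : Finset (Node d), (∀ m ∈ D, children m ⊆ nodes x) ∧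
      (∀ m ∈ D, ∀ n ∈ D, m ≠ n → Disjoint (children m) (children n)) ∧
      ∀ y, y ∈ σ ↔ ∃ m ∈ D, nodes y = merge (nodes x) {m} := by
  constructor
  · rintro ⟨hσ, hh⟩
    obtain ⟨U, D, hU, hD, hDD, -, h⟩ := (mem_link_iff hd).1 hσ
    refine ⟨D, hD, hDD, fun y => ⟨fun hy => ?_, fun hy => (h y).2 (Or.inr hy)⟩⟩
    rcases (h y).1 hy with ⟨u, hu, hyu⟩ | h'
    · have h1 := hh y hy
      rw [← card_nodes, ← card_nodes, hyu] at h1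
      have := card_split_singleton (hU hu)
      omega
    · exact h'
  · rintro ⟨D, hD, hDD, h⟩
    refine ⟨(mem_link_iff hd).2 ⟨∅, D, by simp, hD, hDD, by simp, fun y => by simp [h]⟩, ?_⟩
    intro y hy
    obtain ⟨m, hm, hym⟩ := (h y).1 hy
    rw [← card_nodes, ← card_nodes, hym]
    have := card_merge_singleton (hD m hm)
    omega

theorem singleton_mem_descendingLink_iff (hd : 2 ≤ d) {x y : Vertex d} :
    {y} ∈ descendingLink x ↔ ∃ m, children m ⊆ nodes x ∧ nodes y = merge (nodes x) {m} := by
  rw [mem_descendingLink_iff hd]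
  constructor
  · rintro ⟨D, hD, -, h⟩
    obtain ⟨m, hm, hy⟩ := (h y).1 (Finset.mem_singleton_self y)
    exact ⟨m, hD m hm, hy⟩
  · rintro ⟨m, hm, hy⟩
    refine ⟨{m}, by simpa using hm, by simp, fun z => ?_⟩
    rw [Finset.mem_singleton]
    constructor
    · rintro rfl
      exact ⟨m, Finset.mem_singleton_self m, hy⟩
    · rintro ⟨m', hm', hz⟩
      rw [Finset.mem_singleton.1 hm', ← hy] at hz
      exact nodes_injective hz

/-- A descending neighbour of `x` corresponds to the set of the `d` nodes of `x` that are
merged. -/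
theorem simplicialIso_descendingLink (hd : 2 ≤ d) (x : Vertex d) :
    SimplicialIso (descendingLink x) (disjointSubsetComplex d (height x)) := by
  let e : nodes x ≃ Fin (height x) := (nodes x).equivFinOfCardEq (card_nodes x)
  let E : Finset (Node d) → Finset (Fin (height x)) := fun s =>
    Finset.univ.filter fun i => (e.symm i).1 ∈ s
  have hE : ∀ s i, i ∈ E s ↔ (e.symm i).1 ∈ s := fun s i => by simp [E]
  have hEmap : ∀ s, s ⊆ nodes x → (E s).map (e.symm.toEmbedding.trans
      (Function.Embedding.subtype _)) = s := by
    intro s hs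
    ext k
    simp only [Finset.mem_map, hE]
    constructor
    · rintro ⟨i, hi, rfl⟩
      exact hi
    · intro hk
      exact ⟨e ⟨k, hs hk⟩, by simpa using hk, by simp⟩
  have hEinj : ∀ {s t}, s ⊆ nodes x → t ⊆ nodes x → E s = E t → s = t := by
    intro s t hs ht h
    rw [← hEmap s hs, h, hEmap t ht]
  have hEdisj : ∀ {s t}, s ⊆ nodes x → (Disjoint (E s) (E t) ↔ Disjoint s t) := by
    intro s t hs
    rw [Finset.disjoint_left, Finset.disjoint_left]
    constructor
    · intro h k hk hk'
      exact h (a := e ⟨k, hs hk⟩) ((hE _ _).2 (by simpa using hk)) ((hE _ _).2 (by simpa using hk'))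
    · intro h i hi hi'
      exact h ((hE _ _).1 hi) ((hE _ _).1 hi')
  have hcard : ∀ m, children m ⊆ nodes x → (E (children m)).card = d := by
    intro m hm
    have := congrArg Finset.card (hEmap _ hm)
    rwa [Finset.card_map, card_children] at this
  have hL : ∀ T : Finset (Fin (height x)),
      {T} ∈ disjointSubsetComplex d (height x) ↔ T.card = d := fun T => by
    simp [disjointSubsetComplex]
  choose m hm hym using fun y : {y : Vertex d // {y} ∈ descendingLink x} =>
    (singleton_mem_descendingLink_iff hd).1 y.2
  have minj : Function.Injective m := fun y z h =>
    Subtype.ext (nodes_injective (by rw [hym, hym, h]))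
  let F : {y : Vertex d // {y} ∈ descendingLink x} →
      {T : Finset (Fin (height x)) // {T} ∈ disjointSubsetComplex d (height x)} := fun y =>
    ⟨E (children (m y)), (hL _).2 (hcard _ (hm y))⟩
  have hF : Function.Bijective F := by
    constructor
    · intro y z h
      exact minj (children_injective (hEinj (hm y) (hm z) (congrArg Subtype.val h)))
    · rintro ⟨T, hT⟩
      have hTs : T.map (e.symm.toEmbedding.trans (Function.Embedding.subtype _)) ⊆ nodes x := by
        intro k hk
        obtain ⟨i, -, rfl⟩ := Finset.mem_map.1 hk
        exact (e.symm i).2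
      obtain ⟨k, y, hk, hky, hxy⟩ := exists_merge_of_card hd x hTs
        (by rw [Finset.card_map]; exact (hL T).1 hT)
      have hkx : children k ⊆ nodes x := hk ▸ hTs
      have hy : nodes y = merge (nodes x) {k} := by
        rw [hxy, merge_split (Finset.singleton_subset_iff.2 hky)]
      refine ⟨⟨y, (singleton_mem_descendingLink_iff hd).2 ⟨k, hkx, hy⟩⟩, Subtype.ext ?_⟩
      have : m ⟨y, (singleton_mem_descendingLink_iff hd).2 ⟨k, hkx, hy⟩⟩ = k :=
        merge_singleton_injective (hm _) hkx ((hym _).symm.trans hy)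
      change E (children (m _)) = T
      rw [this, hk]
      ext i
      simp [hE]
  refine ⟨Equiv.ofBijective F hF, fun σ => ?_⟩
  have hK : σ.map (Function.Embedding.subtype _) ∈ descendingLink x ↔
      ∀ y ∈ σ, ∀ z ∈ σ, y ≠ z → Disjoint (children (m y)) (children (m z)) := by
    rw [mem_descendingLink_iff hd]
    constructor
    · rintro ⟨D, hD, hDD, h⟩ y hy z hz hyz
      have key : ∀ y ∈ σ, m y ∈ D := by
        intro y hy
        obtain ⟨k, hk, hyk⟩ := (h y.1).1 (Finset.mem_map_of_mem _ hy)
        rwa [merge_singleton_injective (hm y) (hD k hk) ((hym y).symm.trans hyk)]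
      exact hDD _ (key y hy) _ (key z hz) (minj.ne hyz)
    · intro h
      refine ⟨σ.image m, fun k hk => ?_, fun k hk k' hk' hkk' => ?_, fun y => ?_⟩
      · obtain ⟨y, -, rfl⟩ := Finset.mem_image.1 hk
        exact hm y
      · obtain ⟨y, hy, rfl⟩ := Finset.mem_image.1 hk
        obtain ⟨z, hz, rfl⟩ := Finset.mem_image.1 hk'
        exact h y hy z hz fun e => hkk' (by rw [e])
      · rw [Finset.mem_map]
        constructor
        · rintro ⟨z, hz, rfl⟩
          exact ⟨m z, Finset.mem_image_of_mem m hz, hym z⟩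
        · rintro ⟨k, hk, hy⟩
          obtain ⟨z, hz, rfl⟩ := Finset.mem_image.1 hk
          exact ⟨z, hz, nodes_injective ((hym z).trans hy.symm)⟩
  rw [hK]
  constructor
  · intro h
    refine ⟨fun s hs => ?_, fun s hs t ht hst => ?_⟩
    · obtain ⟨T, -, rfl⟩ := Finset.mem_map.1 hs
      exact (hL _).1 T.2
    · rw [Finset.map_map] at hs ht
      obtain ⟨y, hy, rfl⟩ := Finset.mem_map.1 hs
      obtain ⟨z, hz, rfl⟩ := Finset.mem_map.1 ht
      exact (hEdisj (hm y)).2 (h y hy z hz fun e => hst (by rw [e]))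
  · rintro ⟨-, h⟩ y hy z hz hyz
    refine (hEdisj (hm y)).1 (h _ ?_ _ ?_ fun e => ?_)
    · exact Finset.mem_map_of_mem _ (Finset.mem_map_of_mem _ hy)
    · exact Finset.mem_map_of_mem _ (Finset.mem_map_of_mem _ hz)
    · exact hyz (hF.1 (Subtype.ext e))

end Neretin

/-! ### Stabilisers -/

namespace Neretin

open Topology Filter

variable {d : ℕ}

theorem stabilizer_vertex (R : AdmTree d) (φ : Neretin d) :
    MulAction.stabilizer (Neretin d) (vertex R φ) =
      (autForest R).map (MulAut.conj φ).toMonoidHom := by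
  ext g
  rw [MulAction.mem_stabilizer_iff, smul_vertex, vertex_eq_vertex, Subgroup.mem_map]
  constructor
  · rintro ⟨θ, hθ⟩
    refine ⟨ofIso θ, ⟨θ, rfl⟩, ?_⟩
    rw [← hθ]
    simp [mul_assoc]
  · rintro ⟨_, ⟨θ, rfl⟩, rfl⟩
    refine ⟨θ, ?_⟩
    simp [mul_assoc, forestHom]

theorem isOpen_autForest (R : AdmTree d) : IsOpen (autForest R : Set (Neretin d)) := by
  refine Subgroup.isOpen_of_mem_nhds _ (g := 1) ?_
  refine ((filterBasis d).nhds_one_hasBasis).mem_iff.2 ⟨_, ⟨R, rfl⟩, fun g hg => ?_⟩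
  obtain ⟨κ, rfl, -⟩ := exists_fix_leaves hg
  exact ⟨κ, rfl⟩

theorem stabilizer_eq_image (R : AdmTree d) (φ : Neretin d) :
    (MulAction.stabilizer (Neretin d) (vertex R φ) : Set (Neretin d)) =
      ((Homeomorph.mulLeft φ).trans (Homeomorph.mulRight φ⁻¹)) '' (autForest R) := by
  rw [stabilizer_vertex, Subgroup.coe_map]
  rfl

theorem isOpen_stabilizer (x : Vertex d) :
    IsOpen (MulAction.stabilizer (Neretin d) x : Set (Neretin d)) := by
  obtain ⟨R, φ, rfl⟩ := exists_vertex x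
  rw [stabilizer_eq_image]
  exact (Homeomorph.isOpenMap _) _ (isOpen_autForest R)

theorem setOf_smul_eq (g : Neretin d) (x : Vertex d) :
    {h : Neretin d | h • x = g • x} =
      Homeomorph.mulLeft g '' (MulAction.stabilizer (Neretin d) x) := by
  ext h
  constructor
  · intro (hh : h • x = g • x)
    refine ⟨g⁻¹ * h, ?_, mul_inv_cancel_left g h⟩
    rw [SetLike.mem_coe, MulAction.mem_stabilizer_iff, mul_smul, hh, inv_smul_smul]
  · rintro ⟨k, hk, rfl⟩
    change (g * k) • x = g • x
    rw [mul_smul, MulAction.mem_stabilizer_iff.1 hk]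

theorem exists_leaf_sends {R : AdmTree d} {g : Neretin d} (hg : g ∈ autForest R) {v : Word d}
    (hv : v ∈ R.leaves) : ∃ w ∈ R.leaves, g.Sends v w := by
  obtain ⟨θ, rfl⟩ := hg
  exact ⟨_, (ForestIso.mem_leaves θ ⟨v, (AdmTree.mem_leaves.1 hv).2⟩).2 hv,
    Sends.ofIso θ ⟨v, (AdmTree.mem_leaves.1 hv).2⟩⟩

/-- Along an ultrafilter on `Aut(T ∖∖ R)` the image of each vertex of the forest is eventually
constant, since it takes only finitely many values. -/
theorem exists_eventually_sends {R : AdmTree d} (f : Ultrafilter (Neretin d))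
    (hf : ∀ᶠ g in f, g ∈ autForest R) {v : Word d} (hv : v ∉ R.interior) :
    ∃ w, w ∉ R.interior ∧ ∀ᶠ g : Neretin d in f, g.Sends v w := by
  refine R.forest_induction (P := fun v => ∃ w, w ∉ R.interior ∧ ∀ᶠ g : Neretin d in f, g.Sends v w)
    (fun v hv => ?_) (fun v _ ih i => ?_) v hv
  · obtain ⟨w, hw, h⟩ := (Ultrafilter.eventually_exists_mem_iff R.leaves.finite_toSet).1
      (hf.mono fun g hg => exists_leaf_sends hg hv)
    exact ⟨w, (AdmTree.mem_leaves.1 hw).2, h⟩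
  · obtain ⟨w, hw, h⟩ := ih
    obtain ⟨j, -, h⟩ := (Ultrafilter.eventually_exists_mem_iff (P := fun j g => g.Sends (i :: v)
      (j :: w)) (Set.finite_univ (α := Fin d))).1 (h.mono fun g hg => by
        obtain ⟨σ, hσ⟩ := hg.children
        exact ⟨σ i, mem_univ _, hσ i⟩)
    exact ⟨j :: w, fun hj => hw (AdmTree.mem_interior_of_cons hj), h⟩

theorem eventually_smul_eq (g : Neretin d) (x : Vertex d) : ∀ᶠ h in 𝓝 g, h • x = g • x := by
  refine IsOpen.mem_nhds (s := {h : Neretin d | h • x = g • x}) ?_ rfl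
  rw [setOf_smul_eq]
  exact (Homeomorph.isOpenMap _) _ (isOpen_stabilizer x)

theorem isClopen_setStabilizer {F : Set (Vertex d)} (hF : F.Finite) :
    IsClopen {g : Neretin d | (fun v => g • v) '' F = F} := by
  have key : ∀ g : Neretin d, ∀ᶠ h in 𝓝 g, (fun v => h • v) '' F = (fun v => g • v) '' F := by
    intro g
    have : ∀ᶠ h in 𝓝 g, ∀ v ∈ F, h • v = g • v :=
      (eventually_all_finite hF).2 fun v _ => eventually_smul_eq g v
    exact this.mono fun h hh => Set.image_congr hh
  constructor
  · rw [← isOpen_compl_iff, isOpen_iff_mem_nhds]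
    intro g hg
    filter_upwards [key g] with h hh
    exact fun h' => hg (hh.symm.trans h')
  · rw [isOpen_iff_mem_nhds]
    intro g hg
    filter_upwards [key g] with h hh
    exact hh.trans hg

variable [NeZero d]

theorem forestHom_injective (R : AdmTree d) : Function.Injective (forestHom R) :=
  fun _ _ h => ofIso_injective h

theorem Sends.rel {g : Neretin d} {u v u' v' : Word d} (hu : g.Sends u u') (hv : g.Sends v v')
    (h : ∃ i : Fin d, v = i :: u) : ∃ i : Fin d, v' = i :: u' := by
  obtain ⟨i, rfl⟩ := h
  obtain ⟨σ, hσ⟩ := hu.children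
  exact ⟨σ i, hv.unique (hσ i)⟩

theorem isCompact_autForest (R : AdmTree d) : IsCompact (autForest R : Set (Neretin d)) := by
  rw [isCompact_iff_ultrafilter_le_nhds]
  intro f hf
  have hf' : ∀ᶠ g in f, g ∈ autForest R := le_principal_iff.1 hf
  have hfi : ∀ᶠ g in (f.map fun g => g⁻¹ : Ultrafilter (Neretin d)), g ∈ autForest R :=
    hf'.mono fun g hg => inv_mem hg
  have h1 : ∀ v : Forest R, ∃ w : Forest R, ∀ᶠ g : Neretin d in f, g.Sends v.1 w.1 := fun v => by
    obtain ⟨w, hw, h⟩ := exists_eventually_sends f hf' v.2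
    exact ⟨⟨w, hw⟩, h⟩
  have h2 : ∀ w : Forest R, ∃ v : Forest R, ∀ᶠ g : Neretin d in f, g.Sends v.1 w.1 := fun w => by
    obtain ⟨v, hv, h⟩ := exists_eventually_sends _ hfi w.2
    refine ⟨⟨v, hv⟩, ?_⟩
    have h' : ∀ᶠ g : Neretin d in f, (g⁻¹).Sends w.1 v := h
    exact h'.mono fun g hg => inv_inv g ▸ hg.inv
  choose s hs using h1
  choose t ht using h2
  let θ : ForestIso R R :=
    { toFun := s
      invFun := t
      left_inv := fun v => by
        obtain ⟨g, hg, hg'⟩ := ((hs v).and (ht (s v))).exists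
        exact Subtype.ext (hg'.injective hg)
      right_inv := fun w => by
        obtain ⟨g, hg, hg'⟩ := ((ht w).and (hs (t w))).exists
        exact Subtype.ext (hg'.unique hg)
      map_rel_iff' := fun {u v} => by
        obtain ⟨g, hu, hv⟩ := ((hs u).and (hs v)).exists
        exact ⟨hu.inv.rel hv.inv, hu.rel hv⟩ }
  refine ⟨ofIso θ, ⟨θ, rfl⟩, ?_⟩
  refine ((filterBasis d).nhds_hasBasis (ofIso θ)).ge_iff.2 ?_
  rintro _ ⟨S, rfl⟩
  have hQ : ∀ᶠ g in f, ∀ a ∈ (R.union S).leaves, ((ofIso θ)⁻¹ * g).Sends a a := by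
    rw [Finset.eventually_all]
    intro a ha
    have ha' : a ∉ R.interior :=
      AdmTree.interior_mono (AdmTree.le_union_left _ _) (AdmTree.mem_leaves.1 ha).2
    exact (hs ⟨a, ha'⟩).mono fun g hg => hg.mul (Sends.ofIso θ ⟨a, ha'⟩).inv
  filter_upwards [hQ] with g hg
  obtain ⟨κ, hκ⟩ := exists_eq_ofIso (fun a ha => ⟨a, ha, hg a ha⟩) (fun a ha => ⟨a, ha, hg a ha⟩)
  refine ⟨(ofIso θ)⁻¹ * g, fixator_anti (AdmTree.le_union_right R S) ?_, mul_inv_cancel_left _ _⟩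
  rw [hκ]
  refine mem_fixator_of_fix_leaves κ fun u hu => ?_
  have h1 := Sends.ofIso κ u
  rw [← hκ] at h1
  exact h1.unique (hg u.1 hu)

theorem isCompact_stabilizer (x : Vertex d) :
    IsCompact (MulAction.stabilizer (Neretin d) x : Set (Neretin d)) := by
  obtain ⟨R, φ, rfl⟩ := exists_vertex x
  rw [stabilizer_eq_image]
  exact (isCompact_autForest R).image (Homeomorph.continuous _)

theorem isCompact_setOf_smul_eq (x y : Vertex d) : IsCompact {h : Neretin d | h • x = y} := by
  by_cases hy : ∃ g : Neretin d, g • x = y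
  · obtain ⟨g, rfl⟩ := hy
    rw [setOf_smul_eq]
    exact (isCompact_stabilizer x).image (Homeomorph.continuous _)
  · convert isCompact_empty
    exact Set.eq_empty_of_forall_notMem fun g hg => hy ⟨g, hg⟩

theorem isCompact_setStabilizer {F : Set (Vertex d)} (hF : F.Finite) (hne : F.Nonempty) :
    IsCompact {g : Neretin d | (fun v => g • v) '' F = F} := by
  obtain ⟨x, hx⟩ := hne
  refine (hF.isCompact_biUnion fun y _ => isCompact_setOf_smul_eq x y).of_isClosed_subset
    (isClopen_setStabilizer hF).1 fun g hg => ?_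
  exact mem_biUnion (x := g • x) (hg ▸ mem_image_of_mem _ hx) rfl

end Neretin

/-! ### The geometric realisation of a locally finite cube complex -/

namespace CubeFamily

open Topology Filter

variable {V : Type*} {C : CubeFamily V}

theorem mem_range_of_cubePoint_ne_zero {n : ℕ} {χ : Finset (Fin n) → V} {p : Fin n → ℝ} {v : V}
    (h : cubePoint χ p v ≠ 0) : v ∈ range χ := by
  by_contra hv
  exact h (Finset.sum_eq_zero fun I _ => if_neg fun hI => hv ⟨I, hI⟩)

theorem exists_cubePoint_pos {n : ℕ} (χ : Finset (Fin n) → V) {p : Fin n → ℝ}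
    (hp : ∀ i, p i ∈ Icc (0 : ℝ) 1) : ∃ v, 0 < cubePoint χ p v := by
  have hnn : ∀ I : Finset (Fin n), 0 ≤ ∏ i, (if i ∈ I then p i else 1 - p i) := fun I =>
    Finset.prod_nonneg fun i _ => by
      split_ifs
      · exact (hp i).1
      · exact sub_nonneg.2 (hp i).2
  -- The product is positive for the set of the coordinates that do not vanish.
  let I : Finset (Fin n) := Finset.univ.filter fun i => 0 < p i
  have hI : 0 < ∏ i, (if i ∈ I then p i else 1 - p i) := by
    refine Finset.prod_pos fun i _ => ?_
    by_cases h : 0 < p i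
    · rwa [if_pos (by simpa [I] using h)]
    · rw [if_neg (by simpa [I] using h)]
      linarith
  refine ⟨χ I, lt_of_lt_of_le ?_ (Finset.single_le_sum (fun J _ => ?_) (Finset.mem_univ I))⟩
  · simpa using hI
  · split_ifs
    · exact hnn J
    · exact le_rfl

theorem Realization.exists_pos (μ : C.Realization) : ∃ v, 0 < μ.1 v := by
  obtain ⟨μ, n, χ, p, -, hp, rfl⟩ := μ
  exact exists_cubePoint_pos χ hp

/-- The characteristic map `[0,1]^n → |C|` of a cube. -/
noncomputable def cubeMap {n : ℕ} {χ : Finset (Fin n) → V} (hχ : C.IsCube χ)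
    (p : Fin n → unitInterval) :
    C.Realization :=
  ⟨cubePoint χ fun i => p i, n, χ, _, hχ, fun i => (p i).2, rfl⟩

theorem continuous_cubePoint {n : ℕ} (χ : Finset (Fin n) → V) :
    Continuous fun p : Fin n → unitInterval => cubePoint χ fun i => (p i : ℝ) := by
  refine continuous_pi fun v => continuous_finsetSum _ fun J _ => ?_
  split_ifs
  · refine continuous_finsetProd _ fun i _ => ?_
    split_ifs
    · fun_prop
    · fun_prop
  · exact continuous_const

theorem continuous_cubeMap {n : ℕ} {χ : Finset (Fin n) → V} (hχ : C.IsCube χ) :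
    Continuous (cubeMap hχ) :=
  (continuous_cubePoint χ).subtype_mk _

instance : T2Space C.Realization := by
  unfold Realization
  infer_instance

theorem continuous_coord (v : V) : Continuous fun μ : C.Realization => μ.1 v :=
  (continuous_apply v).comp continuous_subtype_val

theorem finite_cubes (hC : C.IsCubeComplex) (hfin : C.LocallyFinite) (v : V) :
    {c : Σ n : ℕ, Finset (Fin n) → V | C.IsCube c.2 ∧ v ∈ range c.2}.Finite := by
  have key : ∀ F : Set V, {c : Σ n : ℕ, Finset (Fin n) → V |
      Function.Injective c.2 ∧ range c.2 = F}.Finite := by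
    intro F
    by_cases hF : F.Finite
    · refine ((Set.finite_le_nat F.ncard).biUnion fun n _ =>
        (Set.Finite.pi' fun _ : Finset (Fin n) => hF).image (Sigma.mk n)).subset ?_
      rintro ⟨n, χ⟩ ⟨hinj, hr⟩
      refine mem_biUnion (x := n) ?_ ⟨χ, fun I => hr ▸ mem_range_self I, rfl⟩
      have : F.ncard = 2 ^ n := by
        rw [← hr, ← Set.image_univ, Set.ncard_image_of_injective _ hinj, Set.ncard_univ,
          Nat.card_eq_fintype_card, Fintype.card_finset, Fintype.card_fin]
      change n ≤ F.ncard
      rw [this]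
      exact Nat.lt_two_pow_self.le
    · convert Set.finite_empty
      refine Set.eq_empty_of_forall_notMem ?_
      rintro ⟨n, χ⟩ ⟨-, hr⟩
      exact hF (hr ▸ Set.finite_range χ)
  refine ((hfin v).biUnion fun F _ => key F).subset ?_
  rintro ⟨n, χ⟩ ⟨hχ, hv⟩
  exact mem_biUnion (x := range χ) ⟨hv, n, χ, hχ, rfl⟩ ⟨hC.injective hχ, rfl⟩

theorem exists_cubeMap_eq {v : V} {μ : C.Realization} (hμ : μ.1 v ≠ 0) :
    ∃ c : Σ n : ℕ, Finset (Fin n) → V, (C.IsCube c.2 ∧ v ∈ range c.2) ∧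
      ∃ hc : C.IsCube c.2, μ ∈ range (cubeMap hc) := by
  obtain ⟨μ, n, χ, p, hχ, hp, rfl⟩ := μ
  exact ⟨⟨n, χ⟩, ⟨hχ, mem_range_of_cubePoint_ne_zero hμ⟩, hχ, fun i => ⟨p i, hp i⟩, rfl⟩

/-- A map on a locally finite cube complex is continuous if it is so on every cube. -/
theorem continuous_of_cubes (hC : C.IsCubeComplex) (hfin : C.LocallyFinite) {X Y : Type*}
    [TopologicalSpace X] [TopologicalSpace Y] (f : X × C.Realization → Y)
    (h : ∀ (n : ℕ) (χ : Finset (Fin n) → V) (hχ : C.IsCube χ),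
      Continuous fun z : X × (Fin n → unitInterval) => f (z.1, cubeMap hχ z.2)) : Continuous f := by
  rw [continuous_iff_ultrafilter]
  rintro ⟨x, μ⟩ 𝒰 h𝒰
  have hx : Tendsto Prod.fst (𝒰 : Filter (X × C.Realization)) (𝓝 x) :=
    (continuous_fst.tendsto (x, μ)).mono_left h𝒰
  have hμ : Tendsto Prod.snd (𝒰 : Filter (X × C.Realization)) (𝓝 μ) :=
    (continuous_snd.tendsto (x, μ)).mono_left h𝒰
  obtain ⟨v, hv⟩ := μ.exists_pos
  have h1 : ∀ᶠ z in (𝒰 : Filter (X × C.Realization)), 0 < z.2.1 v :=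
    (((continuous_coord v).tendsto μ).comp hμ).eventually (lt_mem_nhds hv)
  -- An ultrafilter near `μ` lives on one of the finitely many cubes that contain `v`.
  obtain ⟨⟨n, χ⟩, -, hc⟩ := (Ultrafilter.eventually_exists_mem_iff (finite_cubes hC hfin v)).1
    (h1.mono fun z hz => exists_cubeMap_eq hz.ne')
  obtain ⟨-, hχ, -⟩ := hc.exists
  classical
  let P : X × C.Realization → (Fin n → unitInterval) := fun z =>
    if h : z.2 ∈ range (cubeMap hχ) then h.choose else fun _ => 0
  have hP : ∀ᶠ z in (𝒰 : Filter (X × C.Realization)), cubeMap hχ (P z) = z.2 := by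
    filter_upwards [hc] with z hz
    obtain ⟨_, hz⟩ := hz
    change cubeMap hχ (if h : z.2 ∈ range (cubeMap hχ) then h.choose else fun _ => 0) = z.2
    rw [dif_pos hz]
    exact hz.choose_spec
  obtain ⟨p, -, hp⟩ := isCompact_univ.ultrafilter_le_nhds (𝒰.map P) (by simp)
  have hp' : Tendsto P 𝒰 (𝓝 p) := hp
  have hμp : cubeMap hχ p = μ := by
    refine tendsto_nhds_unique_of_eventuallyEq
      (((continuous_cubeMap hχ).tendsto p).comp hp') hμ hP
  have := ((h n χ hχ).tendsto (x, p)).comp (hx.prodMk_nhds hp')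
  rw [hμp] at this
  refine this.congr' ?_
  filter_upwards [hP] with z hz
  simp only [Function.comp_apply, hz]

theorem locallyCompactSpace (hC : C.IsCubeComplex) (hfin : C.LocallyFinite) :
    LocallyCompactSpace C.Realization := by
  have : WeaklyLocallyCompactSpace C.Realization := by
    refine ⟨fun μ => ?_⟩
    obtain ⟨v, hv⟩ := μ.exists_pos
    let s := {c : Σ n : ℕ, Finset (Fin n) → V | C.IsCube c.2 ∧ v ∈ range c.2}
    have hs : IsCompact (⋃ c ∈ s, {ν : C.Realization | ∃ hc : C.IsCube c.2,
        ν ∈ range (cubeMap hc)}) := by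
      refine (finite_cubes hC hfin v).isCompact_biUnion fun c hc => ?_
      convert isCompact_range (continuous_cubeMap hc.1)
      ext ν
      exact ⟨fun ⟨_, h⟩ => h, fun h => ⟨hc.1, h⟩⟩
    refine ⟨_, hs, mem_of_superset (((continuous_coord v).tendsto μ) (lt_mem_nhds hv)) ?_⟩
    intro ν hν
    obtain ⟨c, hc, h⟩ := exists_cubeMap_eq (ne_of_gt hν)
    exact mem_biUnion hc h
  infer_instance

end CubeFamily

/-! ### Properness of the action -/

namespace Neretin

open Topology Filter CubeFamily

variable {d : ℕ}

theorem smul_coord (g : Neretin d) (μ : (cubeComplex d).Realization) (v : Vertex d) :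
    (g • μ).1 v = μ.1 (g⁻¹ • v) := rfl

theorem continuousSMul : ContinuousSMul (Neretin d) (cubeComplex d).Realization := by
  refine ⟨Continuous.subtype_mk (continuous_pi fun v => ?_) _⟩
  rw [continuous_iff_continuousAt]
  rintro ⟨g, μ⟩
  have h1 : ∀ᶠ z : Neretin d × (cubeComplex d).Realization in 𝓝 (g, μ),
      z.2.1 (g⁻¹ • v) = (z.1 • z.2).1 v := by
    have := (continuous_inv.comp continuous_fst).tendsto (g, μ) |>.eventually
      (eventually_smul_eq g⁻¹ v)
    filter_upwards [this] with z hz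
    rw [smul_coord, ← hz]
    rfl
  exact ((continuous_coord (g⁻¹ • v)).comp continuous_snd).continuousAt.congr h1

variable [NeZero d]

/-- The action is proper: if `μ` and `g • μ` converge, then `g` eventually maps some vertex into
a finite set, so stays in finitely many cosets of a compact stabiliser. -/
theorem properSMul : ProperSMul (Neretin d) (cubeComplex d).Realization := by
  rw [properSMul_iff_continuousSMul_ultrafilter_tendsto_t2]
  refine ⟨continuousSMul, fun 𝒰 x₁ x₂ h => ?_⟩
  have h₁ : Tendsto (fun z : Neretin d × (cubeComplex d).Realization => z.1 • z.2) 𝒰 (𝓝 x₁) :=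
    (continuous_fst.tendsto (x₁, x₂)).comp h
  have h₂ : Tendsto (fun z : Neretin d × (cubeComplex d).Realization => z.2) 𝒰 (𝓝 x₂) :=
    (continuous_snd.tendsto (x₁, x₂)).comp h
  obtain ⟨w, hw⟩ := x₁.exists_pos
  obtain ⟨v, hv⟩ := x₂.exists_pos
  have e₁ : ∀ᶠ z in (𝒰 : Filter (Neretin d × (cubeComplex d).Realization)), 0 < (z.1 • z.2).1 w :=
    (((continuous_coord w).tendsto x₁).comp h₁).eventually (lt_mem_nhds hw)
  have e₂ : ∀ᶠ z in (𝒰 : Filter (Neretin d × (cubeComplex d).Realization)), 0 < z.2.1 v :=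
    (((continuous_coord v).tendsto x₂).comp h₂).eventually (lt_mem_nhds hv)
  have hfin : (⋃ c ∈ {c : Σ n : ℕ, Finset (Fin n) → Vertex d |
      (cubeComplex d).IsCube c.2 ∧ w ∈ range c.2}, range c.2).Finite :=
    (finite_cubes isCubeComplex locallyFinite w).biUnion fun c _ => Set.finite_range _
  obtain ⟨u, -, hu⟩ := (Ultrafilter.eventually_exists_mem_iff
    (P := fun u (z : Neretin d × (cubeComplex d).Realization) => z.1 • v = u) hfin).1 (by
      filter_upwards [e₁, e₂] with z hz₁ hz₂
      refine ⟨z.1 • v, ?_, rfl⟩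
      obtain ⟨c, hc, hc', p, hp⟩ := exists_cubeMap_eq hz₁.ne'
      refine mem_biUnion hc (mem_range_of_cubePoint_ne_zero (p := fun i => p i) ?_)
      change (cubeMap hc' p).1 (z.1 • v) ≠ 0
      rw [hp, smul_coord, inv_smul_smul]
      exact hz₂.ne')
  obtain ⟨g, -, hg⟩ := (isCompact_setOf_smul_eq v u).ultrafilter_le_nhds (𝒰.map Prod.fst)
    (le_principal_iff.2 hu)
  exact ⟨g, hg⟩

end Neretin

/-! ### Charts of the geometric realisation -/

namespace NeretinCubes

variable {d : ℕ}

/-- Weights on the words that describe a point of the realisation: a finite tree whose last level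
may be reached only partially. The weight of `v` says how far the children of `v` have been
attached; it can be nonzero only if all proper ancestors of `v` have weight `1`. -/
structure IsProfile (q : Word d → ℝ) : Prop where
  nonneg : ∀ v, 0 ≤ q v
  le_one : ∀ v, q v ≤ 1
  finite : {v | q v ≠ 0}.Finite
  parent : ∀ (i : Fin d) (v : Word d), q (i :: v) ≠ 0 → q v = 1

/-- The barycentric coordinate at the tree `B` of the point given by the profile `q`: the
probability that the random tree, in which the children of each reached `v` are attached
independently with probability `q v`, is `B`. -/
def treeWeight (q : Word d → ℝ) (B : AdmTree d) : ℝ :=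
  (∏ v ∈ B.interior, q v) * ∏ v ∈ B.leaves, (1 - q v)

theorem le_of_treeWeight_ne_zero {q : Word d → ℝ} {A B : AdmTree d} (hA : ∀ v ∈ A.interior, q v = 1)
    (h : treeWeight q B ≠ 0) : A ≤ B := by
  by_contra hAB
  obtain ⟨v, hv, hvA⟩ := AdmTree.exists_leaf_mem_interior hAB
  exact h (mul_eq_zero_of_right _ (Finset.prod_eq_zero hv (by rw [hA v hvA, sub_self])))

namespace IsProfile

variable {q : Word d → ℝ}

/-- The admissible subtree of a profile, with the vertices of weight `1` as its interior. -/
noncomputable def base (hq : IsProfile q) : AdmTree d :=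
  AdmTree.ofInterior (hq.finite.toFinset.filter fun v => q v = 1) (by
    intro i v h
    simp only [Finset.mem_filter, Set.Finite.mem_toFinset, mem_ofPred_eq] at h ⊢
    have := hq.parent i v h.1
    exact ⟨by rw [this]; exact one_ne_zero, this⟩)

theorem mem_interior_base [NeZero d] (hq : IsProfile q) {v : Word d} :
    v ∈ hq.base.interior ↔ q v = 1 := by
  rw [base, AdmTree.interior_ofInterior, Finset.mem_filter, Set.Finite.mem_toFinset]
  exact ⟨fun h => h.2, fun h => ⟨by rw [mem_ofPred_eq, h]; exact one_ne_zero, h⟩⟩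

theorem eq_zero_of_not_mem [NeZero d] (hq : IsProfile q) {v : Word d} (h : v ∉ hq.base.interior)
    (h' : v ∉ hq.base.leaves) : q v = 0 := by
  cases v with
  | nil => exact absurd (AdmTree.nil_mem_leaves.2 h) h'
  | cons i v =>
    by_contra h0
    exact h' (AdmTree.cons_mem_leaves.2 ⟨hq.mem_interior_base.2 (hq.parent i v h0), h⟩)

end IsProfile

/-- The profile of a point in the cube spanned by the leaves `a i` of `A`. -/
noncomputable def cubeProfile (A : AdmTree d) {n : ℕ} (a : Fin n → Word d) (p : Fin n → ℝ)
    (v : Word d) : ℝ :=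
  if v ∈ A.interior then 1 else ∑ i, if a i = v then p i else 0

section CubeProfile

variable {A : AdmTree d} {n : ℕ} {a : Fin n → Word d} {p : Fin n → ℝ}

theorem cubeProfile_apply (ha : Function.Injective a) (hA : ∀ i, a i ∈ A.leaves) (i : Fin n) :
    cubeProfile A a p (a i) = p i := by
  rw [cubeProfile, if_neg (AdmTree.mem_leaves.1 (hA i)).2, Finset.sum_eq_single i]
  · rw [if_pos rfl]
  · exact fun j _ hj => if_neg fun h => hj (ha h)
  · exact fun h => absurd (Finset.mem_univ i) h

theorem cubeProfile_of_mem {v : Word d} (hv : v ∈ A.interior) : cubeProfile A a p v = 1 :=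
  if_pos hv

theorem cubeProfile_of_not_mem {v : Word d} (hv : v ∉ A.interior) (h : ∀ i, a i ≠ v) :
    cubeProfile A a p v = 0 := by
  rw [cubeProfile, if_neg hv]
  exact Finset.sum_eq_zero fun i _ => if_neg (h i)

theorem isProfile_cubeProfile (ha : Function.Injective a) (hA : ∀ i, a i ∈ A.leaves)
    (hp : ∀ i, p i ∈ Icc (0 : ℝ) 1) : IsProfile (cubeProfile A a p) := by
  have key : ∀ v, cubeProfile A a p v ∈ Icc (0 : ℝ) 1 := by
    intro v
    by_cases hv : v ∈ A.interior
    · rw [cubeProfile_of_mem hv]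
      simp
    · by_cases h : ∃ i, a i = v
      · obtain ⟨i, rfl⟩ := h
        rw [cubeProfile_apply ha hA]
        exact hp i
      · rw [cubeProfile_of_not_mem hv (by simpa using h)]
        simp
  have hne : ∀ v, cubeProfile A a p v ≠ 0 → v ∈ A.verts := by
    intro v h
    by_contra hv
    refine h (cubeProfile_of_not_mem (fun h => hv (A.interior_subset_verts h)) ?_)
    rintro i rfl
    exact hv (AdmTree.mem_leaves.1 (hA i)).1
  exact ⟨fun v => (key v).1, fun v => (key v).2, A.verts.finite_toSet.subset hne,
    fun i v h => cubeProfile_of_mem (AdmTree.cons_mem_verts.1 (hne _ h))⟩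

theorem treeWeight_cubeProfile [NeZero d] (ha : Function.Injective a)
    (hA : ∀ i, a i ∈ A.leaves) (I : Finset (Fin n)) :
    treeWeight (cubeProfile A a p) (A.expand (I.image a)) =
      ∏ i, (if i ∈ I then p i else 1 - p i) := by
  have hs : ∀ I : Finset (Fin n), I.image a ⊆ A.leaves := fun I v hv => by
    obtain ⟨i, -, rfl⟩ := Finset.mem_image.1 hv
    exact hA i
  have h1 : ∏ v ∈ (A.expand (I.image a)).interior, cubeProfile A a p v = ∏ i ∈ I, p i := by
    rw [AdmTree.interior_expand _ _ (hs I), Finset.prod_union, Finset.prod_image ha.injOn,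
      Finset.prod_eq_one fun v hv => cubeProfile_of_mem hv, one_mul]
    · exact Finset.prod_congr rfl fun i _ => cubeProfile_apply ha hA i
    · exact Finset.disjoint_right.2 fun v hv => (AdmTree.mem_leaves.1 (hs I hv)).2
  have h2 : ∏ v ∈ (A.expand (I.image a)).leaves, (1 - cubeProfile A a p v) =
      ∏ i ∈ Finset.univ \ I, (1 - p i) := by
    rw [← Finset.prod_subset (s₁ := (Finset.univ \ I).image a), Finset.prod_image ha.injOn]
    · exact Finset.prod_congr rfl fun i _ => by rw [cubeProfile_apply ha hA]
    · intro v hv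
      obtain ⟨i, hi, rfl⟩ := Finset.mem_image.1 hv
      refine (AdmTree.mem_leaves_expand (hs I)).2 (Or.inl ⟨hA i, fun h => ?_⟩)
      obtain ⟨j, hj, hji⟩ := Finset.mem_image.1 h
      exact (Finset.mem_sdiff.1 hi).2 (ha hji ▸ hj)
    · intro v hv hv'
      have hvi := (AdmTree.mem_leaves.1 hv).2
      rw [AdmTree.interior_expand _ _ (hs I), Finset.mem_union, not_or] at hvi
      rw [cubeProfile_of_not_mem hvi.1, sub_zero]
      rintro i rfl
      by_cases hi : i ∈ I
      · exact hvi.2 (Finset.mem_image_of_mem a hi)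
      · exact hv' (Finset.mem_image_of_mem a (by simpa using hi))
  rw [treeWeight, h1, h2, ← Finset.prod_sdiff (Finset.subset_univ I), mul_comm]
  congr 1
  · exact Finset.prod_congr rfl fun i hi => (if_neg (Finset.mem_sdiff.1 hi).2).symm
  · exact Finset.prod_congr rfl fun i hi => (if_pos hi).symm

theorem exists_eq_expand [NeZero d] (hA : ∀ i, a i ∈ A.leaves) {B : AdmTree d}
    (h : treeWeight (cubeProfile A a p) B ≠ 0) :
    ∃ I : Finset (Fin n), A.expand (I.image a) = B := by
  have hAB : A ≤ B := le_of_treeWeight_ne_zero (fun v hv => cubeProfile_of_mem hv) h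
  refine ⟨Finset.univ.filter fun i => a i ∈ B.interior, AdmTree.ext_interior ?_⟩
  rw [AdmTree.interior_expand]
  · ext v
    simp only [Finset.mem_union, Finset.mem_image, Finset.mem_filter, Finset.mem_univ, true_and]
    constructor
    · rintro (hv | ⟨i, hi, rfl⟩)
      · exact AdmTree.le_iff_interior.1 hAB hv
      · exact hi
    · intro hv
      by_contra hc
      push Not at hc
      refine h (mul_eq_zero_of_left (Finset.prod_eq_zero hv ?_) _)
      exact cubeProfile_of_not_mem hc.1 fun i hi => hc.2 i (hi ▸ hv) hi
  · intro v hv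
    obtain ⟨i, -, rfl⟩ := Finset.mem_image.1 hv
    exact hA i

theorem continuous_cubeProfile {n : ℕ} (A : AdmTree d) (a : Fin n → Word d) (v : Word d) :
    Continuous fun p : Fin n → unitInterval => cubeProfile A a (fun i => (p i : ℝ)) v := by
  unfold cubeProfile
  split_ifs
  · exact continuous_const
  · refine continuous_finsetSum _ fun i _ => ?_
    split_ifs
    · fun_prop
    · exact continuous_const

end CubeProfile

theorem IsProfile.eq_cubeProfile [NeZero d] {q : Word d → ℝ} (hq : IsProfile q) {n : ℕ}
    {a : Fin n → Word d} (ha : Function.Injective a) (hA : ∀ v, v ∈ hq.base.leaves ↔ ∃ i, a i = v) :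
    q = cubeProfile hq.base a fun i => q (a i) := by
  funext v
  by_cases hv : v ∈ hq.base.interior
  · rw [cubeProfile_of_mem hv, hq.mem_interior_base.1 hv]
  · by_cases hl : v ∈ hq.base.leaves
    · obtain ⟨i, rfl⟩ := (hA v).1 hl
      rw [cubeProfile_apply ha fun i => (hA _).2 ⟨i, rfl⟩]
    · rw [hq.eq_zero_of_not_mem hv hl, cubeProfile_of_not_mem hv]
      exact fun i hi => hl ((hA v).2 ⟨i, hi⟩)

theorem exists_enumeration (S : AdmTree d) : ∃ a : Fin S.leaves.card → Word d,
    Function.Injective a ∧ ∀ v, v ∈ S.leaves ↔ ∃ i, a i = v :=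
  ⟨fun i => (S.leaves.equivFin.symm i).1,
    Subtype.val_injective.comp S.leaves.equivFin.symm.injective, fun v =>
    ⟨fun hv => ⟨S.leaves.equivFin ⟨v, hv⟩, by simp⟩, by
      rintro ⟨i, rfl⟩
      exact (S.leaves.equivFin.symm i).2⟩⟩

/-- A forest isomorphism that matches two profiles matches the weights of trees. -/
theorem treeWeight_imageTree {A A' : AdmTree d} (θ : ForestIso A A') {q q' : Word d → ℝ}
    (hA : ∀ v ∈ A.interior, q v = 1) (hA' : ∀ v ∈ A'.interior, q' v = 1)
    (hθ : ∀ u, q' (θ u).1 = q u.1) {B : AdmTree d} (hB : A ≤ B) :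
    treeWeight q' (imageTree θ B) = treeWeight q B := by
  have hprod : ∀ (A : AdmTree d) (s : Finset (Word d)) (f : Word d → ℝ),
      (∀ v ∈ s, v ∈ A.interior → f v = 1) →
      ∏ v ∈ s, f v = ∏ u ∈ s.subtype fun v => v ∉ A.interior, f u.1 := by
    intro A s f h
    rw [Finset.prod_subtype_eq_prod_filter]
    exact (Finset.prod_filter_of_ne (p := fun v => v ∉ A.interior)
      fun v hv hne hvA => hne (h v hv hvA)).symm
  have hleaf : ∀ {A B : AdmTree d}, A ≤ B → ∀ v ∈ B.leaves, v ∉ A.interior := fun h v hv =>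
    AdmTree.interior_mono h (AdmTree.mem_leaves.1 hv).2
  have hB' := le_imageTree θ B
  rw [treeWeight, treeWeight, hprod A' _ q' fun v _ => hA' v, hprod A _ q fun v _ => hA v,
    hprod A' _ (fun v => 1 - q' v) fun v hv hv' => absurd hv' (hleaf hB' v hv),
    hprod A _ (fun v => 1 - q v) fun v hv hv' => absurd hv' (hleaf hB v hv)]
  congr 1
  · refine (Finset.prod_equiv θ.toEquiv (fun u => ?_) fun u _ => (hθ u).symm).symm
    rw [Finset.mem_subtype, Finset.mem_subtype]
    exact (apply_mem_interior_imageTree θ B u).symm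
  · refine (Finset.prod_equiv θ.toEquiv (fun u => ?_) fun u _ => ?_).symm
    · rw [Finset.mem_subtype, Finset.mem_subtype]
      have key : ∀ hu : u.1 ∉ B.interior, (θ u).1 ∈ (imageTree θ B).leaves ↔ u.1 ∈ B.leaves :=
        fun hu => ForestIso.mem_leaves (restrictIso θ hB) ⟨u.1, hu⟩
      constructor
      · intro h
        exact (key (AdmTree.mem_leaves.1 h).2).2 h
      · intro h
        refine (key fun hu => ?_).1 h
        exact (AdmTree.mem_leaves.1 h).2 ((apply_mem_interior_imageTree θ B u).2 hu)
    · rw [← hθ u]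
      rfl

end NeretinCubes

namespace Neretin

open CubeFamily

variable {d : ℕ}

open Classical in
/-- The point with profile `q` in the chart `φ`, which consists of the cubes with vertices of the
form `[B, φ]`. -/
noncomputable def chartPoint (φ : Neretin d) (q : Word d → ℝ) (x : Vertex d) : ℝ :=
  if h : ∃ B, x = vertex B φ then treeWeight q h.choose else 0

theorem exists_of_chartPoint_ne_zero {φ : Neretin d} {q : Word d → ℝ} {x : Vertex d}
    (h : chartPoint φ q x ≠ 0) : ∃ B, x = vertex B φ := by
  by_contra hx
  exact h (dif_neg hx)

variable [NeZero d]

theorem chartPoint_vertex (φ : Neretin d) (q : Word d → ℝ) (B : AdmTree d) :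
    chartPoint φ q (vertex B φ) = treeWeight q B := by
  have h : ∃ B', vertex B φ = vertex B' φ := ⟨B, rfl⟩
  rw [chartPoint, dif_pos h, ← vertex_left_injective φ h.choose_spec]

theorem cubePoint_eq_chartPoint {A : AdmTree d} {φ : Neretin d} {n : ℕ} {a : Fin n → Word d}
    (ha : Function.Injective a) (hA : ∀ i, a i ∈ A.leaves) {χ : Finset (Fin n) → Vertex d}
    (hχ : ∀ I, χ I = vertex (A.expand (I.image a)) φ) (p : Fin n → ℝ) :
    cubePoint χ p = chartPoint φ (cubeProfile A a p) := by
  have hinj : Function.Injective χ := isCubeComplex.injective ⟨A, φ, a, ha, hA, hχ⟩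
  funext x
  by_cases hx : ∃ I, χ I = x
  · obtain ⟨I, rfl⟩ := hx
    rw [hχ I, chartPoint_vertex, treeWeight_cubeProfile ha hA, ← hχ I, cubePoint,
      Finset.sum_eq_single I]
    · rw [if_pos rfl]
    · exact fun J _ hJ => if_neg fun h => hJ (hinj h)
    · exact fun h => absurd (Finset.mem_univ I) h
  · have h1 : cubePoint χ p x = 0 := by
      by_contra h
      exact hx (mem_range_of_cubePoint_ne_zero h)
    rw [h1]
    by_contra h
    obtain ⟨B, rfl⟩ := exists_of_chartPoint_ne_zero (Ne.symm h)
    rw [chartPoint_vertex] at h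
    obtain ⟨I, rfl⟩ := exists_eq_expand hA (Ne.symm h)
    exact hx ⟨I, hχ I⟩

/-- The point of the realisation with profile `q` in the chart `φ`. -/
noncomputable def chart (φ : Neretin d) {q : Word d → ℝ} (hq : IsProfile q) :
    (cubeComplex d).Realization :=
  ⟨chartPoint φ q, by
    obtain ⟨a, ha, hA⟩ := exists_enumeration hq.base
    have hA' : ∀ i, a i ∈ hq.base.leaves := fun i => (hA _).2 ⟨i, rfl⟩
    refine ⟨_, fun I => vertex (hq.base.expand (I.image a)) φ, fun i => q (a i),
      ⟨hq.base, φ, a, ha, hA', fun _ => rfl⟩, fun i => ⟨hq.nonneg _, hq.le_one _⟩, ?_⟩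
    rw [cubePoint_eq_chartPoint ha hA' fun _ => rfl, ← hq.eq_cubeProfile ha hA]⟩

theorem exists_chart (μ : (cubeComplex d).Realization) :
    ∃ (φ : Neretin d) (q : Word d → ℝ), IsProfile q ∧ μ.1 = chartPoint φ q := by
  obtain ⟨μ, n, χ, p, ⟨A, φ, a, ha, hA, hχ⟩, hp, rfl⟩ := μ
  exact ⟨φ, cubeProfile A a p, isProfile_cubeProfile ha hA hp,
    cubePoint_eq_chartPoint ha hA hχ p⟩

/-- Change of charts. -/
theorem chartPoint_eq_of_forestIso {φ ψ : Neretin d} {A A' : AdmTree d} (θ : ForestIso A A')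
    (hφψ : ψ⁻¹ * φ = ofIso θ) {q q' : Word d → ℝ} (hA : ∀ v ∈ A.interior, q v = 1)
    (hA' : ∀ v ∈ A'.interior, q' v = 1) (hθ : ∀ u, q' (θ u).1 = q u.1) :
    chartPoint φ q = chartPoint ψ q' := by
  have key : ∀ {φ ψ : Neretin d} {A A' : AdmTree d} (θ : ForestIso A A') (_ : ψ⁻¹ * φ = ofIso θ)
      {q q' : Word d → ℝ} (_ : ∀ v ∈ A.interior, q v = 1) (_ : ∀ v ∈ A'.interior, q' v = 1)
      (_ : ∀ u, q' (θ u).1 = q u.1) (x : Vertex d), chartPoint φ q x ≠ 0 →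
      chartPoint φ q x = chartPoint ψ q' x := by
    intro φ ψ A A' θ hφψ q q' hA hA' hθ x hx
    obtain ⟨B, rfl⟩ := exists_of_chartPoint_ne_zero hx
    rw [chartPoint_vertex] at hx ⊢
    have hAB := le_of_treeWeight_ne_zero hA hx
    have e : vertex B φ = vertex (imageTree θ B) ψ :=
      vertex_eq_vertex.2 ⟨restrictIso θ hAB, by rw [ofIso_restrict, hφψ]⟩
    rw [e, chartPoint_vertex, treeWeight_imageTree θ hA hA' hθ hAB]
  funext x
  by_cases h : chartPoint φ q x = 0
  · by_contra h'
    refine h' (key θ.symm ?_ hA' hA (fun u => ?_) x (fun h'' => h' (h.trans h''.symm))).symm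
    · rw [ofIso_symm, ← hφψ, mul_inv_rev, inv_inv]
    · rw [← hθ, θ.apply_symm_apply]
  · exact key θ hφψ hA hA' hθ x h

theorem chartPoint_base_ne_zero (φ : Neretin d) {q : Word d → ℝ} (hq : IsProfile q) :
    chartPoint φ q (vertex hq.base φ) ≠ 0 := by
  rw [chartPoint_vertex, treeWeight]
  refine mul_ne_zero (Finset.prod_ne_zero_iff.2 fun v hv => ?_)
    (Finset.prod_ne_zero_iff.2 fun v hv => ?_)
  · rw [hq.mem_interior_base.1 hv]
    exact one_ne_zero
  · exact sub_ne_zero.2 fun h => (AdmTree.mem_leaves.1 hv).2 (hq.mem_interior_base.2 h.symm)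

/-- The weight of a leaf `v` of the base can be read off the coordinates at the base and at the
tree in which the children of `v` have been attached. -/
theorem chartPoint_expand_singleton (φ : Neretin d) {q : Word d → ℝ} (hq : IsProfile q)
    {v : Word d} (hv : v ∈ hq.base.leaves) :
    chartPoint φ q (vertex (hq.base.expand {v}) φ) * (1 - q v) =
      chartPoint φ q (vertex hq.base φ) * q v := by
  obtain ⟨a, ha, hA⟩ := exists_enumeration hq.base
  have hA' : ∀ i, a i ∈ hq.base.leaves := fun i => (hA _).2 ⟨i, rfl⟩
  have h : ∀ I : Finset (Fin _), treeWeight q (hq.base.expand (I.image a)) =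
      ∏ i, (if i ∈ I then q (a i) else 1 - q (a i)) := fun I => by
    rw [← treeWeight_cubeProfile ha hA', ← hq.eq_cubeProfile ha hA]
  obtain ⟨i, rfl⟩ := (hA v).1 hv
  have h0 := h ∅
  have h1 := h {i}
  have e : hq.base.expand ∅ = hq.base :=
    AdmTree.ext_interior (by rw [AdmTree.interior_expand _ _ (by simp), Finset.union_empty])
  rw [Finset.image_empty, e] at h0
  rw [Finset.image_singleton] at h1
  rw [chartPoint_vertex, chartPoint_vertex, h0, h1, ← Finset.mul_prod_erase _ _ (Finset.mem_univ i),
    ← Finset.mul_prod_erase _ (fun j => if j ∈ ∅ then _ else _) (Finset.mem_univ i)]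
  have e2 : ∏ j ∈ Finset.univ.erase i, (if j ∈ ({i} : Finset (Fin _)) then q (a j)
      else 1 - q (a j)) = ∏ j ∈ Finset.univ.erase i, (if j ∈ (∅ : Finset (Fin _)) then q (a j)
      else 1 - q (a j)) :=
    Finset.prod_congr rfl fun j hj => by simp [Finset.ne_of_mem_erase hj]
  rw [e2]
  simp only [Finset.mem_singleton_self, if_true, Finset.notMem_empty, if_false]
  ring

/-- If two profiles in two charts give the same point, then they are related by the change of
charts: the base is the least vertex with a nonzero coordinate. -/
theorem exists_forestIso_of_chartPoint_eq {φ ψ : Neretin d} {q q' : Word d → ℝ}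
    (hq : IsProfile q) (hq' : IsProfile q') (h : chartPoint φ q = chartPoint ψ q') :
    ∃ θ : ForestIso hq.base hq'.base, ψ⁻¹ * φ = ofIso θ ∧ ∀ u, q' (θ u).1 = q u.1 := by
  have key : ∀ {φ ψ : Neretin d} {q q' : Word d → ℝ} (hq : IsProfile q) (hq' : IsProfile q'),
      chartPoint φ q = chartPoint ψ q' → ∃ B : AdmTree d, hq'.base ≤ B ∧
        ∃ θ : ForestIso hq.base B, ψ⁻¹ * φ = ofIso θ := by
    intro φ ψ q q' hq hq' h
    have h0 := chartPoint_base_ne_zero φ hq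
    rw [h] at h0
    obtain ⟨B, hB⟩ := exists_of_chartPoint_ne_zero h0
    rw [hB, chartPoint_vertex] at h0
    exact ⟨B, le_of_treeWeight_ne_zero (fun v hv => hq'.mem_interior_base.1 hv) h0,
      vertex_eq_vertex.1 hB⟩
  obtain ⟨B, hB, θ, hθ⟩ := key hq hq' h
  obtain ⟨B', hB', η, hη⟩ := key hq' hq h.symm
  obtain rfl : hq'.base = B := by
    refine le_antisymm hB (AdmTree.le_iff_interior.2 fun v hvB => ?_)
    by_contra hv
    -- `v` is the image under `ψ⁻¹φ` of a vertex `u` of the forest on which `θ` is defined.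
    have h1 := (Sends.ofIso η ⟨v, hv⟩).inv
    rw [← hη, mul_inv_rev, inv_inv] at h1
    have h2 := Sends.ofIso θ ⟨_, AdmTree.interior_mono hB' (η ⟨v, hv⟩).2⟩
    rw [← hθ] at h2
    exact (θ ⟨_, AdmTree.interior_mono hB' (η ⟨v, hv⟩).2⟩).2 (h2.unique h1 ▸ hvB)
  refine ⟨θ, hθ, fun u => ?_⟩
  by_cases hu : u.1 ∈ hq.base.leaves
  · have hu' := (ForestIso.mem_leaves θ u).2 hu
    have e1 : vertex hq.base φ = vertex hq'.base ψ := vertex_eq_vertex.2 ⟨θ, hθ⟩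
    have e2 : vertex (hq.base.expand {u.1}) φ = vertex (hq'.base.expand {(θ u).1}) ψ := by
      rw [vertex_eq_iff_leafNodes, leafNodes_expand _ _ (Finset.singleton_subset_iff.2 hu),
        leafNodes_expand _ _ (Finset.singleton_subset_iff.2 hu'), Finset.image_singleton,
        Finset.image_singleton, vertex_eq_iff_leafNodes.1 e1]
      congr 2
      exact node_eq_node.2 (hθ ▸ Sends.ofIso θ u)
    have h1 := chartPoint_expand_singleton φ hq hu
    have h2 := chartPoint_expand_singleton ψ hq' hu'
    rw [← e1, ← e2, ← h] at h2
    have h3 := chartPoint_base_ne_zero φ hq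
    set c := chartPoint φ q (vertex hq.base φ)
    set m := chartPoint φ q (vertex (hq.base.expand {u.1}) φ)
    have hne : c + m ≠ 0 := by
      intro h0
      have : c = 0 := by linear_combination -h1 + (1 - q u.1) * h0
      exact h3 this
    refine mul_left_cancel₀ hne ?_
    linear_combination h1 - h2
  · rw [hq.eq_zero_of_not_mem u.2 hu,
      hq'.eq_zero_of_not_mem (θ u).2 fun h => hu ((ForestIso.mem_leaves θ u).1 h)]

theorem eq_of_chartPoint_eq {φ : Neretin d} {q q' : Word d → ℝ} (hq : IsProfile q)
    (hq' : IsProfile q') (h : chartPoint φ q = chartPoint φ q') : q = q' := by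
  obtain ⟨θ, hθ, hqq⟩ := exists_forestIso_of_chartPoint_eq hq hq' h
  rw [inv_mul_cancel] at hθ
  have hid : ∀ u, (θ u).1 = u.1 := fun u =>
    (hθ ▸ Sends.ofIso θ u : (1 : Neretin d).Sends u.1 (θ u).1).unique (Sends.one u.1)
  funext v
  by_cases hv : v ∈ hq.base.interior
  · rw [hq.mem_interior_base.1 hv, eq_comm, ← hq'.mem_interior_base]
    by_contra hv'
    have h1 := hid (θ.symm ⟨v, hv'⟩)
    rw [θ.apply_symm_apply] at h1
    exact (θ.symm ⟨v, hv'⟩).2 (h1 ▸ hv)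
  · rw [← hqq ⟨v, hv⟩, hid]

theorem continuous_chartPoint {Z : Type*} [TopologicalSpace Z] (φ : Neretin d)
    {q : Z → Word d → ℝ} (hq : ∀ v, Continuous fun z => q z v) :
    Continuous fun z => chartPoint φ (q z) := by
  refine continuous_pi fun x => ?_
  by_cases hx : ∃ B, x = vertex B φ
  · obtain ⟨B, rfl⟩ := hx
    simp only [chartPoint_vertex, treeWeight]
    exact (continuous_finsetProd _ fun v _ => hq v).mul
      (continuous_finsetProd _ fun v _ => continuous_const.sub (hq v))
  · simp only [chartPoint, dif_neg hx]
    exact continuous_const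

end Neretin

/-! ### Contractibility of the geometric realisation -/

namespace NeretinCubes

variable {d : ℕ}

/-- The sum of the deficits `1 - q u` over `v` and all its ancestors `u`. -/
def deficit (q : Word d → ℝ) : Word d → ℝ
  | [] => 1 - q []
  | i :: v => deficit q v + (1 - q (i :: v))

namespace IsProfile

variable {q : Word d → ℝ}

theorem deficit_nonneg (hq : IsProfile q) (v : Word d) : 0 ≤ deficit q v := by
  induction v with
  | nil => exact sub_nonneg.2 (hq.le_one _)
  | cons i v ih => exact add_nonneg ih (sub_nonneg.2 (hq.le_one _))

theorem deficit_eq_zero (hq : IsProfile q) {v : Word d} (hv : q v = 1) : deficit q v = 0 := by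
  induction v with
  | nil => rw [deficit, hv, sub_self]
  | cons i v ih =>
    rw [deficit, ih (hq.parent i v (by rw [hv]; exact one_ne_zero)), hv, sub_self, add_zero]

theorem deficit_of_mem_leaves [NeZero d] (hq : IsProfile q) {v : Word d}
    (hv : v ∈ hq.base.leaves) : deficit q v = 1 - q v := by
  cases v with
  | nil => rfl
  | cons i v =>
    rw [deficit, hq.deficit_eq_zero (hq.mem_interior_base.1 (AdmTree.cons_mem_leaves.1 hv).1),
      zero_add]

end IsProfile

/-- The new weight at time `s` of a word of deficit `D`. For `s < 1` it is the truncation of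
`1 + s / (1 - s) - D` to `[0, 1]`, and for `s = 1` it is `1`; it is written with a denominator that
does not vanish for any `s` in `[0, 1]`. -/
noncomputable def raiseFun (s D : ℝ) : ℝ :=
  max (s + (1 - s) * (1 - D)) 0 / max (max (s + (1 - s) * (1 - D)) 0) (1 - s)

theorem raiseFun_den_pos {s : ℝ} (hs : s ≤ 1) (D : ℝ) :
    0 < max (max (s + (1 - s) * (1 - D)) 0) (1 - s) := by
  rcases hs.lt_or_eq with hs | rfl
  · exact lt_max_of_lt_right (sub_pos.2 hs)
  · norm_num

theorem raiseFun_mem_Icc (s D : ℝ) : raiseFun s D ∈ Icc (0 : ℝ) 1 :=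
  ⟨div_nonneg (le_max_right _ _) (le_max_of_le_left (le_max_right _ _)),
    div_le_one_of_le₀ (le_max_left _ _) (le_max_of_le_left (le_max_right _ _))⟩

theorem raiseFun_eq_one {s D : ℝ} (hs : s ≤ 1) (h : 1 - s ≤ s + (1 - s) * (1 - D)) :
    raiseFun s D = 1 := by
  have h1 := raiseFun_den_pos hs D
  have h2 : max (max (s + (1 - s) * (1 - D)) 0) (1 - s) = max (s + (1 - s) * (1 - D)) 0 :=
    max_eq_left (le_max_of_le_left h)
  rw [raiseFun, h2, div_self]
  rw [h2] at h1
  exact h1.ne'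

theorem raiseFun_zero_right {s : ℝ} (hs : s ∈ Icc (0 : ℝ) 1) : raiseFun s 0 = 1 :=
  raiseFun_eq_one hs.2 (by linarith [hs.1])

theorem raiseFun_one_left (D : ℝ) : raiseFun 1 D = 1 :=
  raiseFun_eq_one le_rfl (by norm_num)

theorem raiseFun_zero_left {D : ℝ} (hD : 0 ≤ D) : raiseFun 0 D = max (1 - D) 0 := by
  have : max (max (1 - D) 0) (1 : ℝ) = 1 := max_eq_right (max_le (by linarith) zero_le_one)
  rw [raiseFun, zero_add, sub_zero, one_mul, this, div_one]

theorem raiseFun_eq_one_of_ne_zero {s D : ℝ} (hs : s ≤ 1) (h : raiseFun s (D + 1) ≠ 0) :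
    raiseFun s D = 1 := by
  refine raiseFun_eq_one hs ?_
  by_contra! h'
  refine h ?_
  rw [raiseFun, max_eq_right (by linarith), zero_div]

/-- Raising the weights of the words in the interior of `S`, until at time `s = 1` they are all
equal to `1`. -/
noncomputable def raise (S : AdmTree d) (s : ℝ) (q : Word d → ℝ) (v : Word d) : ℝ :=
  if v ∈ S.interior then raiseFun s (deficit q v) else q v

theorem raise_of_eq_one {q : Word d → ℝ} (hq : IsProfile q) (S : AdmTree d) {s : ℝ}
    (hs : s ∈ Icc (0 : ℝ) 1) {v : Word d} (hv : q v = 1) : raise S s q v = 1 := by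
  unfold raise
  split_ifs
  · rw [hq.deficit_eq_zero hv, raiseFun_zero_right hs]
  · exact hv

theorem IsProfile.raise {q : Word d → ℝ} (hq : IsProfile q) (S : AdmTree d) {s : ℝ}
    (hs : s ∈ Icc (0 : ℝ) 1) : IsProfile (raise S s q) where
  nonneg v := by
    unfold NeretinCubes.raise
    split_ifs
    · exact (raiseFun_mem_Icc _ _).1
    · exact hq.nonneg v
  le_one v := by
    unfold NeretinCubes.raise
    split_ifs
    · exact (raiseFun_mem_Icc _ _).2
    · exact hq.le_one v
  finite := by
    refine (S.interior.finite_toSet.union hq.finite).subset fun v hv => ?_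
    by_cases h : v ∈ S.interior
    · exact Or.inl h
    · refine Or.inr ?_
      have hv' : NeretinCubes.raise S s q v ≠ 0 := hv
      rwa [NeretinCubes.raise, if_neg h] at hv'
  parent i v h := by
    by_cases h1 : i :: v ∈ S.interior
    · by_cases h2 : q (i :: v) = 0
      · rw [NeretinCubes.raise, if_pos h1, deficit, h2, sub_zero] at h
        rw [NeretinCubes.raise, if_pos (AdmTree.mem_interior_of_cons h1)]
        exact raiseFun_eq_one_of_ne_zero hs.2 h
      · exact raise_of_eq_one hq S hs (hq.parent i v h2)
    · rw [NeretinCubes.raise, if_neg h1] at h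
      exact raise_of_eq_one hq S hs (hq.parent i v h)

theorem raise_zero {q : Word d → ℝ} (hq : IsProfile q) (S : AdmTree d) : raise S 0 q = q := by
  funext v
  unfold raise
  split_ifs with h
  · rw [raiseFun_zero_left (hq.deficit_nonneg v)]
    cases v with
    | nil =>
      rw [deficit, sub_sub_cancel]
      exact max_eq_left (hq.nonneg _)
    | cons i v =>
      by_cases h0 : q (i :: v) = 0
      · by_cases hv : q v = 1
        · rw [deficit, hq.deficit_eq_zero hv, h0]
          norm_num
        · rw [deficit, h0]
          refine max_eq_right ?_
          linarith [hq.deficit_nonneg v]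
      · rw [deficit, hq.deficit_eq_zero (hq.parent i v h0), zero_add, sub_sub_cancel]
        exact max_eq_left (hq.nonneg _)
  · rfl

theorem raise_one {q : Word d → ℝ} {S : AdmTree d} {v : Word d} (hv : v ∈ S.interior) :
    raise S 1 q v = 1 := by
  rw [raise, if_pos hv, raiseFun_one_left]

theorem deficit_forestIso [NeZero d] {q q' : Word d → ℝ} (hq : IsProfile q) (hq' : IsProfile q')
    (θ : ForestIso hq.base hq'.base) (hθ : ∀ u, q' (θ u).1 = q u.1) (u : Forest hq.base) :
    deficit q' (θ u).1 = deficit q u.1 := by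
  obtain ⟨u, hu⟩ := u
  have := hq.base.forest_induction
    (P := fun v => ∀ hv : v ∉ hq.base.interior, deficit q' (θ ⟨v, hv⟩).1 = deficit q v) ?_ ?_ u hu
  · exact this hu
  · intro v hv hv'
    rw [hq.deficit_of_mem_leaves hv, hq'.deficit_of_mem_leaves ((ForestIso.mem_leaves θ _).2 hv),
      hθ]
  · intro v hv ih i hi
    obtain ⟨j, hj⟩ := θ.map_rel_iff.2
      (show forestRel hq.base ⟨v, hv⟩ ⟨i :: v, hi⟩ from ⟨i, rfl⟩)
    have h1 := hθ ⟨i :: v, hi⟩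
    rw [hj] at h1
    rw [hj, deficit, deficit, ih hv, h1]

theorem continuous_deficit {Z : Type*} [TopologicalSpace Z] {q : Z → Word d → ℝ}
    (hq : ∀ v, Continuous fun z => q z v) (v : Word d) :
    Continuous fun z => deficit (q z) v := by
  induction v with
  | nil => exact continuous_const.sub (hq _)
  | cons i v ih => exact ih.add (continuous_const.sub (hq _))

theorem continuous_raise {Z : Type*} [TopologicalSpace Z] (S : AdmTree d) {s : Z → ℝ}
    (hs : Continuous s) (hs1 : ∀ z, s z ≤ 1) {q : Z → Word d → ℝ}
    (hq : ∀ v, Continuous fun z => q z v) (v : Word d) :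
    Continuous fun z => raise S (s z) (q z) v := by
  unfold raise
  split_ifs
  · have hD := continuous_deficit hq v
    unfold raiseFun
    refine Continuous.div₀ (by fun_prop) (by fun_prop) fun z => ?_
    exact (raiseFun_den_pos (hs1 z) _).ne'
  · exact hq v

theorem isProfile_zero : IsProfile (0 : Word d → ℝ) where
  nonneg _ := le_rfl
  le_one _ := zero_le_one
  finite := by simp
  parent _ _ h := absurd rfl h

/-- Cutting off the weights of a profile by depth: at time `s` between `2 ^ (-n-1)` and `2 ^ (-n)`
the weights of the words of length `n` are scaled down to `0`. -/
noncomputable def shrink (s : ℝ) (q : Word d → ℝ) (v : Word d) : ℝ :=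
  q v * max 0 (min 1 (2 - s * 2 ^ (v.length + 1)))

theorem IsProfile.shrink {q : Word d → ℝ} (hq : IsProfile q) (s : ℝ) :
    IsProfile (shrink s q) where
  nonneg v := mul_nonneg (hq.nonneg v) (le_max_left _ _)
  le_one v := mul_le_one₀ (hq.le_one v) (le_max_left _ _) (max_le zero_le_one (min_le_left _ _))
  finite := hq.finite.subset fun v hv hv' => hv (by rw [NeretinCubes.shrink, hv', zero_mul])
  parent i v h := by
    have h1 : q (i :: v) ≠ 0 := left_ne_zero_of_mul h
    have h2 := right_ne_zero_of_mul h
    have h3 : 0 < 2 - s * 2 ^ ((i :: v).length + 1) := by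
      by_contra! h'
      exact h2 (max_eq_left ((min_le_right _ _).trans h'))
    rw [List.length_cons, pow_succ] at h3
    have h4 : (1 : ℝ) ≤ 2 - s * 2 ^ (v.length + 1) := by linarith
    rw [NeretinCubes.shrink, hq.parent i v h1, min_eq_left h4, one_mul]
    exact max_eq_right zero_le_one

theorem shrink_zero (q : Word d → ℝ) : shrink 0 q = q := by
  funext v
  simp [shrink]

theorem shrink_one (q : Word d → ℝ) : shrink 1 q = 0 := by
  funext v
  have h : (2 : ℝ) - 1 * 2 ^ (v.length + 1) ≤ 0 := by
    have : (1 : ℝ) ≤ 2 ^ v.length := one_le_pow₀ (by norm_num)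
    rw [pow_succ]
    linarith
  rw [shrink, max_eq_left ((min_le_right _ _).trans h), mul_zero]
  rfl

theorem continuous_shrink {Z : Type*} [TopologicalSpace Z] {s : Z → ℝ} (hs : Continuous s)
    {q : Z → Word d → ℝ} (hq : ∀ v, Continuous fun z => q z v) (v : Word d) :
    Continuous fun z => shrink (s z) (q z) v := by
  have := hq v
  unfold shrink
  fun_prop

end NeretinCubes

namespace Neretin

open CubeFamily

variable {d : ℕ}

theorem not_sends_of_cons {φ : Neretin d} {i : Fin d} {v : Word d}
    (h : ¬ ∃ w, φ.Sends (i :: v) w) : ¬ ∃ w, φ.Sends v w := by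
  rintro ⟨w, hw⟩
  obtain ⟨σ, hσ⟩ := hw.children
  exact h ⟨_, hσ i⟩

theorem finite_not_sends (φ : Neretin d) : {v : Word d | ¬ ∃ w, φ.Sends v w}.Finite := by
  obtain ⟨R, hR⟩ := exists_sends φ
  refine R.interior.finite_toSet.subset fun v hv => ?_
  by_contra h
  exact hv (hR v h)

/-- The least admissible subtree `A` such that `φ` is given by a forest isomorphism defined on
`T ∖∖ A`: its interior consists of the words below which `φ` is not a tree isomorphism. -/
noncomputable def singularTree (φ : Neretin d) : AdmTree d :=
  AdmTree.ofInterior (finite_not_sends φ).toFinset fun i v h => by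
    rw [Set.Finite.mem_toFinset] at h ⊢
    exact not_sends_of_cons h

variable [NeZero d]

theorem mem_interior_singularTree {φ : Neretin d} {v : Word d} :
    v ∈ (singularTree φ).interior ↔ ¬ ∃ w, φ.Sends v w := by
  rw [singularTree, AdmTree.interior_ofInterior, Set.Finite.mem_toFinset]
  rfl

theorem exists_forestIso_singularTree (φ : Neretin d) :
    ∃ θ : ForestIso (singularTree φ) (singularTree φ⁻¹), φ = ofIso θ := by
  have key : ∀ (φ : Neretin d), ∀ a ∈ (singularTree φ).leaves, ∃ b ∈ (singularTree φ⁻¹).leaves,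
      φ.Sends a b := by
    intro φ a ha
    have h := (AdmTree.mem_leaves.1 ha).2
    rw [mem_interior_singularTree, not_not] at h
    obtain ⟨b, hb⟩ := h
    have hb' : b ∉ (singularTree φ⁻¹).interior := by
      rw [mem_interior_singularTree, not_not]
      exact ⟨a, hb.inv⟩
    refine ⟨b, ?_, hb⟩
    cases b with
    | nil => exact AdmTree.nil_mem_leaves.2 hb'
    | cons j w =>
      refine AdmTree.cons_mem_leaves.2 ⟨?_, hb'⟩
      -- Otherwise the parent of `a` would be sent to `w`.
      rw [mem_interior_singularTree]
      rintro ⟨v, hv⟩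
      obtain ⟨σ, hσ⟩ := hv.children
      obtain rfl := hb.inv.unique (hσ j)
      refine mem_interior_singularTree.1 (AdmTree.cons_mem_leaves.1 ha).1 ⟨w, ?_⟩
      have := hv.inv
      rwa [inv_inv] at this
  refine exists_eq_ofIso (key φ) fun b hb => ?_
  obtain ⟨a, ha, h⟩ := key φ⁻¹ b hb
  rw [inv_inv] at ha
  have h' := h.inv
  rw [inv_inv] at h'
  exact ⟨a, ha, h'⟩

/-- A forest isomorphism that represents `φ`, with the largest possible domain. -/
noncomputable def maxIso (φ : Neretin d) : ForestIso (singularTree φ) (singularTree φ⁻¹) :=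
  (exists_forestIso_singularTree φ).choose

theorem eq_ofIso_maxIso (φ : Neretin d) : φ = ofIso (maxIso φ) :=
  (exists_forestIso_singularTree φ).choose_spec

/-- The profile in the chart `1` of the point whose profile in the chart `φ` is
`raise (singularTree φ) 1 q`. -/
noncomputable def push (φ : Neretin d) (q : Word d → ℝ) (w : Word d) : ℝ :=
  if h : w ∈ (singularTree φ⁻¹).interior then 1 else q ((maxIso φ).symm ⟨w, h⟩).1

theorem isProfile_push (φ : Neretin d) {q : Word d → ℝ} (hq : IsProfile q) :
    IsProfile (push φ q) where
  nonneg w := by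
    unfold push
    split_ifs
    · exact zero_le_one
    · exact hq.nonneg _
  le_one w := by
    unfold push
    split_ifs
    · exact le_rfl
    · exact hq.le_one _
  finite := by
    have h : {w : Forest (singularTree φ⁻¹) | q ((maxIso φ).symm w).1 ≠ 0}.Finite :=
      hq.finite.preimage (f := fun w : Forest (singularTree φ⁻¹) => ((maxIso φ).symm w).1)
        (Subtype.val_injective.comp (maxIso φ).symm.injective).injOn
    refine ((singularTree φ⁻¹).interior.finite_toSet.union
      (h.image Subtype.val)).subset fun w hw => ?_
    by_cases hw' : w ∈ (singularTree φ⁻¹).interior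
    · exact Or.inl hw'
    · refine Or.inr ⟨⟨w, hw'⟩, ?_, rfl⟩
      have hw'' : push φ q w ≠ 0 := hw
      rwa [push, dif_neg hw'] at hw''
  parent j w h := by
    by_cases hw : w ∈ (singularTree φ⁻¹).interior
    · exact dif_pos hw
    · have hj : j :: w ∉ (singularTree φ⁻¹).interior :=
        fun h => hw (AdmTree.mem_interior_of_cons h)
      obtain ⟨i, hi⟩ := (maxIso φ).symm.map_rel_iff.2
        (show forestRel (singularTree φ⁻¹) ⟨w, hw⟩ ⟨j :: w, hj⟩ from ⟨j, rfl⟩)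
      rw [push, dif_neg hj, hi] at h
      rw [push, dif_neg hw]
      exact hq.parent i _ h

theorem chartPoint_raise_one (φ : Neretin d) (q : Word d → ℝ) :
    chartPoint φ (raise (singularTree φ) 1 q) = chartPoint 1 (push φ q) := by
  refine chartPoint_eq_of_forestIso (maxIso φ) ?_ (fun v hv => raise_one hv)
    (fun w hw => dif_pos hw) fun u => ?_
  · rw [inv_one, one_mul]
    exact eq_ofIso_maxIso φ
  · rw [raise, if_neg u.2, push, dif_neg ((maxIso φ) u).2, (maxIso φ).symm_apply_apply]

/-- The upward deformation does not depend on the chart. -/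
theorem chartPoint_raise_congr {φ ψ : Neretin d} {q q' : Word d → ℝ} (hq : IsProfile q)
    (hq' : IsProfile q') (h : chartPoint φ q = chartPoint ψ q') {s : ℝ}
    (hs : s ∈ Icc (0 : ℝ) 1) :
    chartPoint φ (raise (singularTree φ) s q) = chartPoint ψ (raise (singularTree ψ) s q') := by
  obtain ⟨θ, hθ, hqq⟩ := exists_forestIso_of_chartPoint_eq hq hq' h
  refine chartPoint_eq_of_forestIso θ hθ
    (fun v hv => raise_of_eq_one hq _ hs (hq.mem_interior_base.1 hv))
    (fun v hv => raise_of_eq_one hq' _ hs (hq'.mem_interior_base.1 hv)) fun u => ?_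
  have h1 := Sends.ofIso θ u
  rw [← hθ] at h1
  have h2 : (θ u).1 ∈ (singularTree ψ).interior ↔ u.1 ∈ (singularTree φ).interior := by
    rw [mem_interior_singularTree, mem_interior_singularTree]
    refine not_congr ⟨?_, ?_⟩
    · rintro ⟨w, hw⟩
      refine ⟨w, ?_⟩
      have := h1.mul hw
      rwa [mul_inv_cancel_left] at this
    · rintro ⟨w, hw⟩
      refine ⟨w, ?_⟩
      have := h1.inv.mul hw
      rwa [mul_inv_rev, inv_inv, mul_inv_cancel_left] at this
  unfold raise
  simp only [h2, hqq, deficit_forestIso hq hq' θ hqq]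

theorem push_congr {φ ψ : Neretin d} {q q' : Word d → ℝ} (hq : IsProfile q)
    (hq' : IsProfile q') (h : chartPoint φ q = chartPoint ψ q') : push φ q = push ψ q' := by
  refine eq_of_chartPoint_eq (φ := 1) (isProfile_push φ hq) (isProfile_push ψ hq') ?_
  rw [← chartPoint_raise_one, ← chartPoint_raise_one]
  exact chartPoint_raise_congr hq hq' h (by simp)

theorem continuous_push {Z : Type*} [TopologicalSpace Z] (φ : Neretin d)
    {q : Z → Word d → ℝ} (hq : ∀ v, Continuous fun z => q z v) (w : Word d) :
    Continuous fun z => push φ (q z) w := by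
  unfold push
  split_ifs
  · exact continuous_const
  · exact hq _

section Homotopies

variable (μ : (cubeComplex d).Realization)

/-- A chart that contains the point `μ`. -/
noncomputable def chartOf : Neretin d := (exists_chart μ).choose

/-- The profile of the point `μ` in the chart `chartOf μ`. -/
noncomputable def profileOf : Word d → ℝ := (exists_chart μ).choose_spec.choose

theorem isProfile_profileOf : IsProfile (profileOf μ) :=
  (exists_chart μ).choose_spec.choose_spec.1

theorem eq_chartPoint_profileOf : μ.1 = chartPoint (chartOf μ) (profileOf μ) :=
  (exists_chart μ).choose_spec.choose_spec.2

end Homotopies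

/-- The deformation of the realisation into the chart `1`. -/
noncomputable def raiseMap (z : unitInterval × (cubeComplex d).Realization) :
    (cubeComplex d).Realization :=
  chart (chartOf z.2) ((isProfile_profileOf z.2).raise (singularTree (chartOf z.2)) z.1.2)

/-- The retraction to the chart `1`, followed by the contraction of this chart. -/
noncomputable def shrinkMap (z : unitInterval × (cubeComplex d).Realization) :
    (cubeComplex d).Realization :=
  chart 1 ((isProfile_push (chartOf z.2) (isProfile_profileOf z.2)).shrink z.1)

theorem raiseMap_coe (z : unitInterval × (cubeComplex d).Realization) {φ : Neretin d}
    {q : Word d → ℝ} (hq : IsProfile q) (h : z.2.1 = chartPoint φ q) :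
    (raiseMap z).1 = chartPoint φ (raise (singularTree φ) z.1 q) :=
  chartPoint_raise_congr (isProfile_profileOf z.2) hq
    ((eq_chartPoint_profileOf z.2).symm.trans h) z.1.2

theorem shrinkMap_coe (z : unitInterval × (cubeComplex d).Realization) {φ : Neretin d}
    {q : Word d → ℝ} (hq : IsProfile q) (h : z.2.1 = chartPoint φ q) :
    (shrinkMap z).1 = chartPoint 1 (shrink z.1 (push φ q)) := by
  change chartPoint 1 (shrink z.1 (push (chartOf z.2) (profileOf z.2))) = _
  rw [push_congr (isProfile_profileOf z.2) hq ((eq_chartPoint_profileOf z.2).symm.trans h)]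

theorem continuous_raiseMap : Continuous (raiseMap (d := d)) := by
  refine continuous_of_cubes isCubeComplex locallyFinite _ fun n χ hχ => ?_
  obtain ⟨A, φ, a, ha, hA, h⟩ := id hχ
  refine continuous_induced_rng.2 ?_
  have e : ∀ z : unitInterval × (Fin n → unitInterval),
      (raiseMap (z.1, cubeMap hχ z.2)).1 =
        chartPoint φ (raise (singularTree φ) z.1 (cubeProfile A a fun i => (z.2 i : ℝ))) :=
    fun z => raiseMap_coe _ (isProfile_cubeProfile ha hA fun i => (z.2 i).2)
      (cubePoint_eq_chartPoint ha hA h _)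
  refine Continuous.congr ?_ fun z => (e z).symm
  exact continuous_chartPoint φ (continuous_raise _ (by fun_prop) (fun z => z.1.2.2)
    fun v => (continuous_cubeProfile A a v).comp continuous_snd)

theorem continuous_shrinkMap : Continuous (shrinkMap (d := d)) := by
  refine continuous_of_cubes isCubeComplex locallyFinite _ fun n χ hχ => ?_
  obtain ⟨A, φ, a, ha, hA, h⟩ := id hχ
  refine continuous_induced_rng.2 ?_
  have e : ∀ z : unitInterval × (Fin n → unitInterval),
      (shrinkMap (z.1, cubeMap hχ z.2)).1 =
        chartPoint 1 (shrink z.1 (push φ (cubeProfile A a fun i => (z.2 i : ℝ)))) :=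
    fun z => shrinkMap_coe _ (isProfile_cubeProfile ha hA fun i => (z.2 i).2)
      (cubePoint_eq_chartPoint ha hA h _)
  refine Continuous.congr ?_ fun z => (e z).symm
  exact continuous_chartPoint 1 (continuous_shrink (by fun_prop) (continuous_push φ
    fun v => (continuous_cubeProfile A a v).comp continuous_snd))

theorem contractibleSpace : ContractibleSpace (cubeComplex d).Realization := by
  rw [contractible_iff_id_nullhomotopic]
  refine ⟨chart 1 isProfile_zero, ?_⟩
  let r : C((cubeComplex d).Realization, (cubeComplex d).Realization) :=
    ⟨fun μ => shrinkMap (0, μ), continuous_shrinkMap.comp (by fun_prop)⟩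
  have h1 : (ContinuousMap.id (cubeComplex d).Realization).Homotopic r := by
    refine ⟨⟨⟨raiseMap, continuous_raiseMap⟩, fun μ => Subtype.ext ?_, fun μ => Subtype.ext ?_⟩⟩
    · change (raiseMap (0, μ)).1 = μ.1
      rw [raiseMap_coe _ (isProfile_profileOf μ) (eq_chartPoint_profileOf μ)]
      simp only [Icc.coe_zero]
      rw [raise_zero (isProfile_profileOf μ), ← eq_chartPoint_profileOf]
    · change (raiseMap (1, μ)).1 = (shrinkMap (0, μ)).1
      rw [raiseMap_coe _ (isProfile_profileOf μ) (eq_chartPoint_profileOf μ),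
        shrinkMap_coe _ (isProfile_profileOf μ) (eq_chartPoint_profileOf μ)]
      simp only [Icc.coe_zero, Icc.coe_one]
      rw [chartPoint_raise_one, shrink_zero]
  refine h1.trans ⟨⟨⟨shrinkMap, continuous_shrinkMap⟩, fun μ => rfl, fun μ => Subtype.ext ?_⟩⟩
  change (shrinkMap (1, μ)).1 = chartPoint 1 0
  rw [shrinkMap_coe _ (isProfile_profileOf μ) (eq_chartPoint_profileOf μ)]
  simp only [Icc.coe_one]
  rw [shrink_one]

theorem isCAT0 (hd : 2 ≤ d) : (cubeComplex d).IsCAT0 where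
  isCubeComplex := isCubeComplex
  simplyConnected :=
    have := contractibleSpace (d := d)
    inferInstance
  flag := link_flag hd

end Neretin

theorem theorem1p1 (d : ℕ) (hd : 2 ≤ d) :
    -- `𝒞` is a locally finite (hence locally compact) CAT(0) cube complex
    (Neretin.cubeComplex d).LocallyFinite ∧
    LocallyCompactSpace (Neretin.cubeComplex d).Realization ∧
    (Neretin.cubeComplex d).IsCAT0 ∧
    -- `N_d` acts properly on `𝒞`
    ProperSMul (Neretin d) (Neretin.cubeComplex d).Realization ∧
    -- the stabilisers of the vertices, and of all cubes, are open and compact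
    (∀ x : Neretin.Vertex d,
      IsOpen (MulAction.stabilizer (Neretin d) x : Set (Neretin d)) ∧
      IsCompact (MulAction.stabilizer (Neretin d) x : Set (Neretin d))) ∧
    (∀ (n : ℕ) (χ : Finset (Fin n) → Neretin.Vertex d), (Neretin.cubeComplex d).IsCube χ →
      IsOpen {g : Neretin d | (fun v => g • v) '' Set.range χ = Set.range χ} ∧
      IsCompact {g : Neretin d | (fun v => g • v) '' Set.range χ = Set.range χ}) ∧
    -- the stabiliser of `[R, φ]` is `φ Aut(T ∖∖ R) φ⁻¹`
    (∀ (R : NeretinCubes.AdmTree d) (φ : Neretin d),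
      MulAction.stabilizer (Neretin d) (Neretin.vertex R φ) =
        (Neretin.autForest R).map (MulAut.conj φ).toMonoidHom) ∧
    (∀ R : NeretinCubes.AdmTree d, Function.Injective (Neretin.forestHom R)) ∧
    -- the descending link of a vertex of height `h` is `I(d, h)`
    (∀ x : Neretin.Vertex d,
      SimplicialIso (Neretin.descendingLink x) (disjointSubsetComplex d (Neretin.height x))) := by
  have : NeZero d := ⟨by omega⟩
  exact ⟨Neretin.locallyFinite,
    CubeFamily.locallyCompactSpace Neretin.isCubeComplex Neretin.locallyFinite,
    Neretin.isCAT0 hd, Neretin.properSMul,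
    fun x => ⟨Neretin.isOpen_stabilizer x, Neretin.isCompact_stabilizer x⟩,
    fun _ _ _ => ⟨(Neretin.isClopen_setStabilizer (finite_range _)).2,
      Neretin.isCompact_setStabilizer (finite_range _) (range_nonempty _)⟩,
    Neretin.stabilizer_vertex, Neretin.forestHom_injective,
    Neretin.simplicialIso_descendingLink hd⟩
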